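/- Let $N=N_D\ge 1$ and $M\ge 1$, and let $R_1,\dots,R_M$ be real $4\times4$ Yukawa matrices. They couple $M$ real scalars $\phi_m$ to $4N$ Majorana fermions $\psi_a^A$ ($1\le a\le N$, $1\le A\le 4$) through the Yukawa term $\sum\phi_m\psi_a^A R_m^{AB}\psi_a^B$. The global symmetry group of the model is $$G=\Bigl\{(Q,\Omega)\in \mathrm O(4N)\times \mathrm O(M)\ :\ Q^{T}\Bigl(\sum_m\Omega_{mn}\,(1_N\otimes R_m)\Bigr)Q=1_N\otimes R_n\ \text{ for all } n\Bigr\},$$ i.e. the pairs under which the Yukawa term is invariant. The set $\{R_m\}$ is called valid if all $R_m$ are symmetric and $\mathrm{SO}(M)$ is unbroken: for every $\Omega\in\mathrm{SO}(M)$ there is $Q\in\mathrm O(4N)$ with $(Q,\Omega)\in G$. Let $\mathcal A$ be the (unital) real $*$-algebra generated by the $R_m$, acting on $\mathbb R^4$. A simple $\mathcal A$-module is real, complex or quaternionic if its endomorphism algebra is isomorphic to $\mathbb R$, $\mathbb C$ or $\mathbb H$. Let $m_j^{\mathbb R},m_j^{\mathbb C},m_j^{\mathbb H}$ be the multiplicities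 in $\mathbb R^4$ of the pairwise non-isomorphic real, complex and quaternionic simple modules that occur in it, and put $$H=\prod_j \mathrm O(N m^{\mathbb R}_j)\times\prod_j \mathrm U(N m^{\mathbb C}_j)\times\prod_j \mathrm{Sp}(N m^{\mathbb H}_j),$$ where $\mathrm{Sp}(n)$ is the group of unitary quaternionic $n\times n$ matrices. Let $K=\mathrm O(M)$ if $M>1$, or if $M=1$ and the spectrum of $R_1$ (with multiplicities) is symmetric about zero; let $K=1$ otherwise. **Theorem.** For a valid set $\{R_m\}$, the symmetry group is, as a topological group, $$G\;\cong\;H\rtimes K,$$ where the projection to $K$ is the action $(Q,\Omega)\mapsto\Omega$ on the scalars, or it is such a product up to a double cover. The latter alternative is needed only if $M>1$ and at least one of the numbers $N m_j^{\mathbb R},N m_j^{\mathbb C},N m_j^{\mathbb H}$ is odd. It means that there are a double cover $p:L\to K$ of topological groups, an action of $K$ on $H$ (and, through $p$, of $L$ on $H$), and a two-sheeted covering homomorphism $\pi:H\rtimes L\to G$ that is injective on $H$ and for which the $\Omega$-component of $\pi(h,l)$ is $p(l)$. (So $H\rtimes L$ is a common double cover of $G$ and $H\rtimes K$.) -/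

import Mathlib

open scoped Quaternion

namespace GNY

/-- The orthogonal group `O(ι)` of real `ι × ι` matrices. -/
abbrev O (ι : Type) [Fintype ι] [DecidableEq ι] : Type := ↥(Matrix.orthogonalGroup ι ℝ)

/-- The unitary group `U(n)`. -/
abbrev U (n : ℕ) : Type := ↥(Matrix.unitaryGroup (Fin n) ℂ)

/-- The compact symplectic group `Sp(n)`: quaternionic `n × n` matrices `X` with `Xᴴ X = 1`. -/
abbrev Sp (n : ℕ) : Type := ↥(unitary (Matrix (Fin n) (Fin n) ℍ[ℝ]))

/-- A Yukawa matrix for each of the `M` scalars `φ_m`, acting on the four Majorana components of a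
Dirac fermion. -/
abbrev Yukawa (M : ℕ) : Type := Fin M → Matrix (Fin 4) (Fin 4) ℝ

/-- The polarized Yukawa term `∑ φ_m ψ_a^A R_m^{AB} χ_a^B`, where `a` runs over the `N` Dirac
flavors and `A, B` over the four Majorana components of each. -/
def yukawaForm (N : ℕ) {M : ℕ} (R : Yukawa M) (φ : Fin M → ℝ) (ψ χ : Fin N × Fin 4 → ℝ) : ℝ :=
  ∑ m, ∑ a, ∑ A, ∑ B, φ m * ψ (a, A) * R m A B * χ (a, B)

/-- The global symmetry group: the pairs `(Q, Ω)` in `O(4N) × O(M)` under which the Yukawa term is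
invariant. (Orthogonality of `Q` and `Ω` is the invariance of the other terms.) -/
def symmetryGroup (N : ℕ) {M : ℕ} (R : Yukawa M) : Subgroup (O (Fin N × Fin 4) × O (Fin M)) where
  carrier := {g | ∀ (φ : Fin M → ℝ) (ψ χ : Fin N × Fin 4 → ℝ),
    yukawaForm N R (g.2.1.mulVec φ) (g.1.1.mulVec ψ) (g.1.1.mulVec χ) = yukawaForm N R φ ψ χ}
  one_mem' := by
    intro φ ψ χ
    simp
  mul_mem' := by
    intro g h hg hh φ ψ χ
    have e1 := hg (h.2.1.mulVec φ) (h.1.1.mulVec ψ) (h.1.1.mulVec χ)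
    simp only [Matrix.mulVec_mulVec] at e1
    exact e1.trans (hh φ ψ χ)
  inv_mem' := by
    intro g hg φ ψ χ
    have e1 := hg (g⁻¹.2.1.mulVec φ) (g⁻¹.1.1.mulVec ψ) (g⁻¹.1.1.mulVec χ)
    have h1 : g.1.1 * g⁻¹.1.1 = 1 := congrArg Subtype.val (mul_inv_cancel g.1)
    have h2 : g.2.1 * g⁻¹.2.1 = 1 := congrArg Subtype.val (mul_inv_cancel g.2)
    simp only [Matrix.mulVec_mulVec, h1, h2, Matrix.one_mulVec] at e1
    exact e1.symm

/-- A set of Yukawa matrices is valid when it consists of real symmetric matrices and the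
`SO(M)` rotations of the scalars are not explicitly broken: each of them is compensated by an
orthogonal transformation of the fermions. -/
structure IsValid (N : ℕ) {M : ℕ} (R : Yukawa M) : Prop where
  symm : ∀ m, (R m).IsSymm
  unbroken : ∀ Ω : O (Fin M), Ω.1.det = 1 →
    ∃ Q : O (Fin N × Fin 4), (Q, Ω) ∈ symmetryGroup N R

/-- The spectrum (eigenvalues with multiplicity) is symmetric about zero. -/
def HasEvenSpectrum (A : Matrix (Fin 4) (Fin 4) ℝ) : Prop :=
  A.charpoly.roots.map (fun x => -x) = A.charpoly.roots

open Classical in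
/-- The second factor: `O(M)` if `M > 1`, or if `M = 1` and the spectrum of `R` is even; the
trivial group otherwise. -/
noncomputable def scalarGroup {M : ℕ} (R : Yukawa M) : Subgroup (O (Fin M)) :=
  if 1 < M ∨ ∀ m, HasEvenSpectrum (R m) then ⊤ else ⊥

/-- The closure algebra: the (unital) real star-algebra generated by the Yukawa matrices. It acts
on `ℝ⁴` by matrix-vector multiplication. -/
def closureAlgebra {M : ℕ} (R : Yukawa M) : Subalgebra ℝ (Matrix (Fin 4) (Fin 4) ℝ) :=
  (StarAlgebra.adjoin ℝ (Set.range R)).toSubalgebra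

/-- The simple modules of the closure algebra occurring in `ℝ⁴`, up to isomorphism, each of them
represented by its isotypic component. -/
abbrev SimpleType {M : ℕ} (R : Yukawa M) : Type :=
  ↥(isotypicComponents (closureAlgebra R) (Fin 4 → ℝ))

/-- The multiplicity with which a simple module occurs in `ℝ⁴`: the number of simple summands of
its isotypic component. -/
noncomputable def multiplicity {M : ℕ} {R : Yukawa M} (c : SimpleType R) : ℕ :=
  (Module.length (closureAlgebra R) c.1).toNat

/-- The simple module represented by `c` has endomorphism algebra isomorphic to `D`. With
`D = ℝ, ℂ, ℍ` the module is real, complex or quaternionic. -/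
def HasEndType {M : ℕ} {R : Yukawa M} (c : SimpleType R) (D : Type) [Ring D] [Algebra ℝ D] :
    Prop :=
  ∃ S : Submodule (closureAlgebra R) (Fin 4 → ℝ),
    S ≤ c.1 ∧ IsSimpleModule (closureAlgebra R) S ∧
      Nonempty (Module.End (closureAlgebra R) S ≃ₐ[ℝ] D)

/-- `∏ O(N m_j^ℝ) × ∏ U(N m_j^ℂ) × ∏ Sp(N m_j^ℍ)`. -/
abbrev FlavorGroup (N : ℕ) {M : ℕ} (R : Yukawa M) : Type :=
  ((c : {c : SimpleType R // HasEndType c ℝ}) → O (Fin (N * multiplicity c.1))) ×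
  ((c : {c : SimpleType R // HasEndType c ℂ}) → U (N * multiplicity c.1)) ×
  ((c : {c : SimpleType R // HasEndType c ℍ[ℝ]}) → Sp (N * multiplicity c.1))

/-- A semidirect product carries the product topology. -/
instance semidirectTopology {H K : Type} [Group H] [Group K] [TopologicalSpace H]
    [TopologicalSpace K] (α : K →* MulAut H) : TopologicalSpace (H ⋊[α] K) :=
  TopologicalSpace.induced (fun x => (x.left, x.right)) inferInstance

/-- A two-sheeted covering homomorphism of topological groups. -/
structure IsDoubleCover {A B : Type} [Group A] [Group B] [TopologicalSpace A] [TopologicalSpace B]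
    (f : A →* B) : Prop where
  covering : IsCoveringMap f
  surjective : Function.Surjective f
  two_sheeted : Nat.card f.ker = 2

/-- `G` is a semidirect product `H ⋊ K` as a topological group, in which the second factor is the
part of `O(M)` acting on the scalars. -/
def IsSplit (N : ℕ) {M : ℕ} (R : Yukawa M) : Prop :=
  ∃ (α : scalarGroup R →* MulAut (FlavorGroup N R))
    (e : symmetryGroup N R ≃ₜ* FlavorGroup N R ⋊[α] scalarGroup R),
    ∀ g, ((e g).right : O (Fin M)) = g.1.2

/-- `G` is a semidirect product `H ⋊ K` up to a double cover: for a double cover `p : L → K` and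
an action of `K` on `H`, the group `H ⋊ L` (a double cover of `H ⋊ K`) is a double cover of `G`,
such that `H` embeds in `G` and `L` acts on the scalars through `p`. -/
def IsSplitUpToDoubleCover (N : ℕ) {M : ℕ} (R : Yukawa M) : Prop :=
  ∃ (L : Type) (_ : Group L) (_ : TopologicalSpace L) (_ : IsTopologicalGroup L)
    (p : L →* scalarGroup R) (α : scalarGroup R →* MulAut (FlavorGroup N R))
    (π : FlavorGroup N R ⋊[α.comp p] L →* symmetryGroup N R),
    IsDoubleCover p ∧ IsDoubleCover π ∧
    (∀ h : FlavorGroup N R, π (SemidirectProduct.inl h) = 1 → h = 1) ∧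
    ∀ x, (π x).1.2 = (p x.right : O (Fin M))

end GNY

namespace GNY
open Matrix

/-! ### Orthonormal frames of submodules, and Schur's lemma -/

/-- The columns of `B` form an orthonormal basis of the real subspace `S`. -/
structure IsFrame {n d : ℕ} (B : Matrix (Fin n) (Fin d) ℝ) (S : Set (Fin n → ℝ)) : Prop where
  orth : Bᵀ * B = 1
  mem_iff : ∀ v, v ∈ S ↔ B *ᵥ (Bᵀ *ᵥ v) = v

theorem exists_isFrame {n : ℕ} (S : Submodule ℝ (Fin n → ℝ)) :
    ∃ (d : ℕ) (B : Matrix (Fin n) (Fin d) ℝ), IsFrame B (S : Set (Fin n → ℝ)) := by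
  let W : Submodule ℝ (EuclideanSpace ℝ (Fin n)) :=
    S.comap (WithLp.linearEquiv 2 ℝ (Fin n → ℝ)).toLinearMap
  obtain ⟨d, b⟩ : ∃ d : ℕ, Nonempty (OrthonormalBasis (Fin d) ℝ W) := ⟨_, ⟨stdOrthonormalBasis ℝ W⟩⟩
  obtain ⟨b⟩ := b
  obtain ⟨B, hBdef⟩ : ∃ B : Matrix (Fin n) (Fin d) ℝ,
    ∀ i j, B i j = (b j : EuclideanSpace ℝ (Fin n)) i := ⟨Matrix.of fun i j => _, fun _ _ => rfl⟩
  have hB : Bᵀ * B = 1 := by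
    ext i j
    have h := orthonormal_iff_ite.mp b.orthonormal i j
    rw [Submodule.coe_inner, PiLp.inner_apply] at h
    rw [Matrix.mul_apply, Matrix.one_apply, ← h]
    refine Finset.sum_congr rfl fun k _ => ?_
    rw [Matrix.transpose_apply, hBdef, hBdef, real_inner_eq_re_inner]
    simp [mul_comm]
  have hsum : ∀ y : Fin d → ℝ, B *ᵥ y =
      ((∑ j, y j • b j : W) : EuclideanSpace ℝ (Fin n)).ofLp := by
    intro y
    ext i
    rw [Submodule.coe_sum, WithLp.ofLp_sum, Finset.sum_apply]
    change ∑ j, B i j * y j = ∑ j, y j * (b j : EuclideanSpace ℝ (Fin n)) i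
    simp only [hBdef, mul_comm]
  refine ⟨_, B, hB, fun v => ⟨fun hv => ?_, fun hv => ?_⟩⟩
  · have hw : WithLp.toLp 2 v ∈ W := hv
    have h2 : v = B *ᵥ (fun j => b.repr ⟨_, hw⟩ j) := by
      rw [hsum, b.sum_repr]
    rw [h2, Matrix.mulVec_mulVec, Matrix.mulVec_mulVec, Matrix.mul_assoc, hB, Matrix.mul_one]
  · rw [← hv, hsum]
    exact (∑ j, (Bᵀ *ᵥ v) j • b j : W).2

section Star

variable {n : ℕ} {A : Subalgebra ℝ (Matrix (Fin n) (Fin n) ℝ)}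

/-- The compression of `X` to the subspace framed by `B`. -/
abbrev compress {n d : ℕ} (B : Matrix (Fin n) (Fin d) ℝ) (X : Matrix (Fin n) (Fin n) ℝ) :
    Matrix (Fin d) (Fin d) ℝ := Bᵀ * X * B

theorem exists_frame (S : Submodule A (Fin n → ℝ)) :
    ∃ (d : ℕ) (B : Matrix (Fin n) (Fin d) ℝ), IsFrame B (S : Set (Fin n → ℝ)) :=
  exists_isFrame (S.restrictScalars ℝ)

theorem IsFrame.mulVec_mem {d : ℕ} {B : Matrix (Fin n) (Fin d) ℝ} {S : Set (Fin n → ℝ)}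
    (hB : IsFrame B S) (y : Fin d → ℝ) : B *ᵥ y ∈ S := by
  rw [hB.mem_iff, Matrix.mulVec_mulVec, Matrix.mulVec_mulVec, Matrix.mul_assoc, hB.orth,
    Matrix.mul_one]

theorem IsFrame.mulVec_injective {d : ℕ} {B : Matrix (Fin n) (Fin d) ℝ} {S : Set (Fin n → ℝ)}
    (hB : IsFrame B S) {y z : Fin d → ℝ} (h : B *ᵥ y = B *ᵥ z) : y = z := by
  have := congrArg (Bᵀ *ᵥ ·) h
  simpa [Matrix.mulVec_mulVec, hB.orth] using this

theorem eq_of_forall_mulVec {m n : Type*} [Fintype n] [DecidableEq n] {X Y : Matrix m n ℝ}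
    (h : ∀ v, X *ᵥ v = Y *ᵥ v) : X = Y := by
  apply Matrix.ext_of_mulVec_single
  intro i
  exact h _

theorem IsFrame.mul_compress {d : ℕ} {B : Matrix (Fin n) (Fin d) ℝ} {S : Submodule A (Fin n → ℝ)}
    (hB : IsFrame B (S : Set (Fin n → ℝ))) {X : Matrix (Fin n) (Fin n) ℝ} (hX : X ∈ A) :
    B * compress B X = X * B := by
  apply eq_of_forall_mulVec
  intro y
  have h : X *ᵥ (B *ᵥ y) ∈ S := S.smul_mem ⟨X, hX⟩ (hB.mulVec_mem y)
  have h2 := (hB.mem_iff _).1 h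
  simpa [compress, Matrix.mulVec_mulVec, Matrix.mul_assoc] using h2

theorem IsFrame.exists_pos {d : ℕ} {B : Matrix (Fin n) (Fin d) ℝ} {S : Submodule A (Fin n → ℝ)}
    (hB : IsFrame B (S : Set (Fin n → ℝ))) (hS : IsSimpleModule A S) : Nonempty (Fin d) := by
  by_contra h
  rw [not_nonempty_iff] at h
  have := IsSimpleModule.nontrivial A S
  apply (S.nontrivial_iff_ne_bot).1 this
  rw [eq_bot_iff]
  intro v hv
  have h2 := (hB.mem_iff v).1 hv
  rw [Submodule.mem_bot, ← h2]
  ext i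
  simp [Matrix.mulVec, dotProduct]

/-- Schur's lemma for symmetric operators. -/
theorem IsFrame.eq_smul_one {d : ℕ} {B : Matrix (Fin n) (Fin d) ℝ} {S : Submodule A (Fin n → ℝ)}
    (hB : IsFrame B (S : Set (Fin n → ℝ))) (hS : IsSimpleModule A S)
    {G : Matrix (Fin d) (Fin d) ℝ} (hG : G.IsSymm)
    (hcomm : ∀ X ∈ A, G * compress B X = compress B X * G) : ∃ g : ℝ, G = g • 1 := by
  obtain ⟨i0⟩ := hB.exists_pos hS
  have hH : G.IsHermitian := by
    rw [Matrix.IsHermitian, Matrix.conjTranspose_eq_transpose_of_trivial]; exact hG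
  have hev := hH.mulVec_eigenvectorBasis i0
  set μ := hH.eigenvalues i0
  have hne : (hH.eigenvectorBasis i0).ofLp ≠ 0 := by
    intro h
    exact hH.eigenvectorBasis.toBasis.ne_zero i0 (by ext j; simpa using congrFun h j)
  set y0 := (hH.eigenvectorBasis i0).ofLp
  -- An eigenspace of `G`, carried into `S` by the frame, is a nonzero submodule, hence all of the
  -- simple module `S`. A symmetric matrix has a real eigenvalue, so no field extension is needed.
  let K : Submodule A (Fin n → ℝ) :=
    { carrier := {v | ∃ y, v = B *ᵥ y ∧ G *ᵥ y = μ • y}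
      add_mem' := by
        rintro _ _ ⟨y, rfl, hy⟩ ⟨z, rfl, hz⟩
        exact ⟨y + z, by rw [Matrix.mulVec_add], by rw [Matrix.mulVec_add, hy, hz, smul_add]⟩
      zero_mem' := ⟨0, by simp, by simp⟩
      smul_mem' := by
        rintro ⟨X, hX⟩ _ ⟨y, rfl, hy⟩
        refine ⟨compress B X *ᵥ y, ?_, ?_⟩
        · rw [Matrix.mulVec_mulVec, hB.mul_compress hX, ← Matrix.mulVec_mulVec]; rfl
        · rw [Matrix.mulVec_mulVec, hcomm X hX, ← Matrix.mulVec_mulVec, hy, Matrix.mulVec_smul] }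
  have hKS : K ≤ S := by
    rintro _ ⟨y, rfl, _⟩
    exact hB.mulVec_mem y
  have hK0 : K ≠ ⊥ := by
    intro h
    have h1 : B *ᵥ y0 ∈ K := ⟨y0, rfl, hev⟩
    rw [h, Submodule.mem_bot] at h1
    exact hne (hB.mulVec_injective (by rw [h1, Matrix.mulVec_zero]))
  have hKeq : K = S := ((isSimpleModule_iff_isAtom.1 hS).le_iff_eq hK0).1 hKS
  refine ⟨μ, eq_of_forall_mulVec fun y => ?_⟩
  have hy : B *ᵥ y ∈ K := by rw [hKeq]; exact hB.mulVec_mem y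
  obtain ⟨z, hz, hz2⟩ := hy
  have : y = z := hB.mulVec_injective hz
  subst this
  rw [hz2, Matrix.smul_mulVec, Matrix.one_mulVec]

/-- The module homomorphism between framed modules with a given matrix. -/
def frameHom {d e : ℕ} {B : Matrix (Fin n) (Fin d) ℝ} {S : Submodule A (Fin n → ℝ)}
    (hB : IsFrame B (S : Set (Fin n → ℝ)))
    (hA : ∀ X ∈ A, Xᵀ ∈ A) {C : Matrix (Fin n) (Fin e) ℝ} {T : Submodule A (Fin n → ℝ)} (W : Submodule A (Fin n → ℝ))
    (hC : IsFrame C (T : Set (Fin n → ℝ)))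
    (Z : Matrix (Fin e) (Fin d) ℝ)
    (hZ : ∀ X ∈ A, Z * compress B X = compress C X * Z) : W →ₗ[A] T where
  toFun v := ⟨C *ᵥ (Z *ᵥ (Bᵀ *ᵥ v.1)), hC.mulVec_mem _⟩
  map_add' v w := by ext1; simp [Matrix.mulVec_add]
  map_smul' X v := by
    ext1
    -- Transposing `mul_compress` for `Xᵀ` shows that `Bᵀ` intertwines too. This is where closure
    -- under transposition enters: the orthogonal projection onto `S` is a module map.
    have h2 : Bᵀ * X.1 = compress B X.1 * Bᵀ := by
      have h3 := congrArg Matrix.transpose (hB.mul_compress (hA _ X.2))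
      simp only [Matrix.transpose_mul, Matrix.transpose_transpose] at h3
      rw [← h3, compress, ← Matrix.mul_assoc]
    change C *ᵥ (Z *ᵥ (Bᵀ *ᵥ (X.1 *ᵥ v.1))) = X.1 *ᵥ (C *ᵥ (Z *ᵥ (Bᵀ *ᵥ v.1)))
    simp only [Matrix.mulVec_mulVec]
    rw [h2, ← Matrix.mul_assoc Z, hZ X.1 X.2, ← Matrix.mul_assoc X.1, ← hC.mul_compress X.2]
    simp only [Matrix.mul_assoc]

theorem IsFrame.apply_mulVec {d : ℕ} {B : Matrix (Fin n) (Fin d) ℝ}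
    {S T : Submodule A (Fin n → ℝ)} (hB : IsFrame B (S : Set (Fin n → ℝ)))
    (f : S →ₗ[A] T) (y : Fin d → ℝ) :
    (f ⟨B *ᵥ y, hB.mulVec_mem y⟩).1 =
      (Matrix.of fun i j => (f ⟨B *ᵥ Pi.single j 1, hB.mulVec_mem _⟩).1 i) *ᵥ y := by
  let bv : Fin d → S := fun j => ⟨B *ᵥ Pi.single j 1, hB.mulVec_mem _⟩
  have h1 : (⟨B *ᵥ y, hB.mulVec_mem y⟩ : S) = ∑ j, (algebraMap ℝ A (y j)) • bv j := by
    ext1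
    rw [Submodule.coe_sum]
    have : ∀ j, ((algebraMap ℝ A (y j) • bv j : S) : Fin n → ℝ) = y j • (B *ᵥ Pi.single j 1) := by
      intro j
      change (algebraMap ℝ (Matrix (Fin n) (Fin n) ℝ) (y j)) *ᵥ (B *ᵥ Pi.single j 1) = _
      rw [Algebra.algebraMap_eq_smul_one, Matrix.smul_mulVec, Matrix.one_mulVec]
    simp only [this]
    ext i
    simp [Matrix.mulVec, dotProduct, mul_comm]
  rw [h1, map_sum]
  simp only [map_smul]
  have h2 : ∀ j, ((algebraMap ℝ A (y j) • f (bv j) : T) : Fin n → ℝ) = y j • (f (bv j)).1 := by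
    intro j
    change (algebraMap ℝ (Matrix (Fin n) (Fin n) ℝ) (y j)) *ᵥ (f (bv j)).1 = _
    rw [Algebra.algebraMap_eq_smul_one, Matrix.smul_mulVec, Matrix.one_mulVec]
  rw [Submodule.coe_sum]
  simp only [h2]
  ext i
  simp [Matrix.mulVec, dotProduct, mul_comm, bv]

/-- An isomorphism of simple submodules is represented by an isometry up to scale. -/
theorem IsFrame.exists_isometry {d : ℕ} {B : Matrix (Fin n) (Fin d) ℝ}
    {S T : Submodule A (Fin n → ℝ)} (hA : ∀ X ∈ A, Xᵀ ∈ A)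
    (hB : IsFrame B (S : Set (Fin n → ℝ))) (hS : IsSimpleModule A S) (e : S ≃ₗ[A] T) :
    ∃ J : Matrix (Fin n) (Fin d) ℝ, IsFrame J (T : Set (Fin n → ℝ)) ∧
      ∀ X ∈ A, X * J = J * compress B X := by
  let bv : Fin d → S := fun j => ⟨B *ᵥ Pi.single j 1, hB.mulVec_mem _⟩
  let J' : Matrix (Fin n) (Fin d) ℝ := Matrix.of fun i j => (e (bv j)).1 i
  have key : ∀ y, J' *ᵥ y = (e ⟨B *ᵥ y, hB.mulVec_mem y⟩).1 := fun y =>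
    (hB.apply_mulVec e.toLinearMap y).symm
  have hint : ∀ X ∈ A, X * J' = J' * compress B X := by
    intro X hX
    apply eq_of_forall_mulVec
    intro y
    rw [← Matrix.mulVec_mulVec, ← Matrix.mulVec_mulVec, key, key]
    have : (⟨B *ᵥ (compress B X *ᵥ y), hB.mulVec_mem _⟩ : S) =
        (⟨X, hX⟩ : A) • ⟨B *ᵥ y, hB.mulVec_mem y⟩ := by
      ext1
      change B *ᵥ (compress B X *ᵥ y) = X *ᵥ (B *ᵥ y)
      rw [Matrix.mulVec_mulVec, hB.mul_compress hX, Matrix.mulVec_mulVec]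
    rw [this, map_smul]
    rfl
  have hint' : ∀ X ∈ A, J'ᵀ * X = compress B X * J'ᵀ := by
    intro X hX
    have := congrArg Matrix.transpose (hint _ (hA X hX))
    simpa [Matrix.transpose_mul, Matrix.mul_assoc] using this
  -- The Gram matrix of an intertwiner is symmetric and commutes with the compressed action, so it
  -- is a scalar `g`. It is positive by injectivity, and dividing by its square root makes the
  -- intertwiner isometric.
  obtain ⟨g, hg⟩ := hB.eq_smul_one hS (G := J'ᵀ * J') (by simp [Matrix.IsSymm, Matrix.transpose_mul])
    (by
      intro X hX
      rw [Matrix.mul_assoc, ← hint X hX, ← Matrix.mul_assoc, hint' X hX, Matrix.mul_assoc])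
  obtain ⟨i0⟩ := hB.exists_pos hS
  have hgnn : g = ∑ i, J' i i0 * J' i i0 := by
    have := congrFun (congrFun hg i0) i0
    simpa [Matrix.mul_apply] using this.symm
  have hgpos : 0 < g := by
    rcases (Finset.sum_nonneg (fun i (_ : i ∈ Finset.univ) => mul_self_nonneg (J' i i0))).lt_or_eq with h | h
    · rw [hgnn]; exact h
    · exfalso
      have h0 : J' = 0 := by
        have : J'ᵀ * J' = 0 := by rw [hg, hgnn, ← h, zero_smul]
        have h3 : J'ᴴ * J' = 0 := by rwa [Matrix.conjTranspose_eq_transpose_of_trivial]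
        exact Matrix.conjTranspose_mul_self_eq_zero.1 h3
      have h4 := key (Pi.single i0 1)
      rw [h0, Matrix.zero_mulVec] at h4
      have h5 : e ⟨B *ᵥ (Pi.single i0 1), hB.mulVec_mem _⟩ = 0 := Subtype.ext h4.symm
      rw [LinearEquiv.map_eq_zero_iff] at h5
      have h6 : B *ᵥ (Pi.single i0 1) = B *ᵥ 0 := by
        rw [Matrix.mulVec_zero]; exact congrArg Subtype.val h5
      have h7 := congrFun (hB.mulVec_injective h6) i0
      simp at h7
  have h0 : Real.sqrt g ≠ 0 := (Real.sqrt_pos.2 hgpos).ne'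
  have horth : ((Real.sqrt g)⁻¹ • J')ᵀ * ((Real.sqrt g)⁻¹ • J') = 1 := by
    rw [Matrix.transpose_smul, Matrix.smul_mul, Matrix.mul_smul, hg, smul_smul, smul_smul]
    have : (Real.sqrt g)⁻¹ * (Real.sqrt g)⁻¹ * g = 1 := by
      have h1 := Real.mul_self_sqrt hgpos.le
      field_simp
      nlinarith
    rw [this, one_smul]
  refine ⟨(Real.sqrt g)⁻¹ • J', ⟨horth, fun v => ⟨fun hv => ?_, fun hv => ?_⟩⟩, ?_⟩
  · obtain ⟨y, rfl⟩ : ∃ y, v = ((Real.sqrt g)⁻¹ • J') *ᵥ y := by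
      refine ⟨Real.sqrt g • (Bᵀ *ᵥ (e.symm ⟨v, hv⟩).1), ?_⟩
      rw [Matrix.mulVec_smul, Matrix.smul_mulVec, smul_smul, mul_inv_cancel₀ h0, one_smul, key]
      have h2 := (hB.mem_iff _).1 (e.symm ⟨v, hv⟩).2
      have h3 : (⟨B *ᵥ (Bᵀ *ᵥ (e.symm ⟨v, hv⟩).1), hB.mulVec_mem _⟩ : S) = e.symm ⟨v, hv⟩ :=
        Subtype.ext h2
      rw [h3, LinearEquiv.apply_symm_apply]
    rw [Matrix.mulVec_mulVec _ _ ((Real.sqrt g)⁻¹ • J'), horth, Matrix.one_mulVec]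
  · rw [← hv, Matrix.smul_mulVec, ← Matrix.mulVec_smul, key]
    exact (e _).2
  · intro X hX
    rw [Matrix.mul_smul, Matrix.smul_mul, hint X hX]

end Star
end GNY

/-! ### Isotypic components as orthogonal sums of copies of a simple module -/

namespace GNY
open Matrix

section Isotypic

variable {n : ℕ} {A : Subalgebra ℝ (Matrix (Fin n) (Fin n) ℝ)}

instance isArtinian_subalgebra : IsArtinian A (Fin n → ℝ) :=
  isArtinian_of_tower ℝ inferInstance

instance isNoetherian_subalgebra : IsNoetherian A (Fin n → ℝ) :=
  isNoetherian_of_tower ℝ inferInstance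

theorem exists_simple_le {W : Submodule A (Fin n → ℝ)} (hW : W ≠ ⊥) :
    ∃ T ≤ W, IsSimpleModule A T := by
  obtain ⟨T, hT, hTW⟩ := (IsAtomic.eq_bot_or_exists_atom_le W).resolve_left hW
  exact ⟨T, hTW, isSimpleModule_iff_isAtom.2 hT⟩

/-- The part of `W` orthogonal to the range of the intertwiner `J`. -/
def orthPart (hA : ∀ X ∈ A, Xᵀ ∈ A) {d : ℕ} (J : Matrix (Fin n) (Fin d) ℝ)
    (ρ : Matrix (Fin n) (Fin n) ℝ → Matrix (Fin d) (Fin d) ℝ)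
    (hJ : ∀ X ∈ A, X * J = J * ρ X) (W : Submodule A (Fin n → ℝ)) : Submodule A (Fin n → ℝ) where
  carrier := {v | v ∈ W ∧ Jᵀ *ᵥ v = 0}
  add_mem' := by
    rintro v w ⟨hv, hv'⟩ ⟨hw, hw'⟩
    exact ⟨W.add_mem hv hw, by rw [Matrix.mulVec_add, hv', hw', add_zero]⟩
  zero_mem' := ⟨W.zero_mem, by simp⟩
  smul_mem' := by
    rintro ⟨X, hX⟩ v ⟨hv, hv'⟩
    refine ⟨W.smul_mem _ hv, ?_⟩
    change Jᵀ *ᵥ (X *ᵥ v) = 0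
    have h := congrArg Matrix.transpose (hJ _ (hA X hX))
    rw [Matrix.transpose_mul, Matrix.transpose_transpose, Matrix.transpose_mul] at h
    rw [Matrix.mulVec_mulVec, h, ← Matrix.mulVec_mulVec, hv', Matrix.mulVec_zero]

/-- Induction on the real dimension, bounded by `k`: a nonzero `W` contains a simple `T`,
necessarily isomorphic to `S`, and the orthogonal complement of `T` in `W` is a smaller submodule.
The number of isometries is the length of `W`, which is how `multiplicity` enters the size of the
matrix groups. -/
theorem exists_isometries (hA : ∀ X ∈ A, Xᵀ ∈ A) {d : ℕ} {B : Matrix (Fin n) (Fin d) ℝ}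
    {S : Submodule A (Fin n → ℝ)} (hB : IsFrame B (S : Set (Fin n → ℝ)))
    (hS : IsSimpleModule A S) (k : ℕ) :
    ∀ W : Submodule A (Fin n → ℝ), W ≤ isotypicComponent A (Fin n → ℝ) S →
      Module.finrank ℝ (W.restrictScalars ℝ) ≤ k →
      ∃ (m : ℕ) (J : Fin m → Matrix (Fin n) (Fin d) ℝ), Module.length A W = m ∧
        (∀ i j, (J i)ᵀ * J j = if i = j then 1 else 0) ∧
        (∀ i, ∀ X ∈ A, X * J i = J i * compress B X) ∧ (∀ i y, J i *ᵥ y ∈ W) ∧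
        ∀ v ∈ W, ∑ i, J i *ᵥ ((J i)ᵀ *ᵥ v) = v := by
  induction k with
  | zero =>
    intro W _ hk
    have h0 : W.restrictScalars ℝ = ⊥ := Submodule.finrank_eq_zero.1 (Nat.le_zero.1 hk)
    have h1 : W = ⊥ := (Submodule.restrictScalars_eq_bot_iff ..).1 h0
    subst h1
    refine ⟨0, Fin.elim0, ?_, fun i => i.elim0, fun i => i.elim0, fun i => i.elim0, ?_⟩
    · rw [Module.length_eq_zero]; rfl
    · intro v hv
      rw [Submodule.mem_bot] at hv
      simp [hv]
  | succ k ih =>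
    intro W hW hk
    by_cases hbot : W = ⊥
    · exact ih W hW (by
        have h0 : W.restrictScalars ℝ = ⊥ := (Submodule.restrictScalars_eq_bot_iff ..).2 hbot
        rw [Submodule.finrank_eq_zero.2 h0]; exact Nat.zero_le k)
    obtain ⟨T, hTW, hT⟩ := exists_simple_le hbot
    obtain ⟨e⟩ := isIsotypicOfType_submodule_iff.mp
      (IsIsotypicOfType.isotypicComponent A (Fin n → ℝ) S) T (hTW.trans hW)
    obtain ⟨J, hJ, hJX⟩ := hB.exists_isometry hA hS e.symm
    have hJt : ∀ X ∈ A, Jᵀ * X = compress B X * Jᵀ := by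
      intro X hX
      have := congrArg Matrix.transpose (hJX _ (hA X hX))
      simpa [Matrix.transpose_mul, Matrix.mul_assoc] using this
    set W' := orthPart hA J (compress B) hJX W with hW'
    have hmem : ∀ v, v ∈ W' ↔ v ∈ W ∧ Jᵀ *ᵥ v = 0 := fun v => Iff.rfl
    have hle : W' ≤ W := fun v hv => hv.1
    have hlt : W'.restrictScalars ℝ < W.restrictScalars ℝ := by
      refine lt_of_le_of_ne hle fun h => ?_
      obtain ⟨i0⟩ := hB.exists_pos hS
      have h1 : J *ᵥ Pi.single i0 1 ∈ W' := by
        have : J *ᵥ Pi.single i0 1 ∈ W.restrictScalars ℝ := hTW (hJ.mulVec_mem _)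
        rw [← h] at this
        exact this
      have h2 := h1.2
      rw [Matrix.mulVec_mulVec, hJ.orth, Matrix.one_mulVec] at h2
      simpa using congrFun h2 i0
    obtain ⟨m, J', hlen, horth, hint, hran, hsum⟩ := ih W' (hle.trans hW)
      (Nat.lt_succ_iff.1 ((Submodule.finrank_lt_finrank_of_lt hlt).trans_le hk))
    have hJJ' : ∀ i, Jᵀ * J' i = 0 := by
      intro i
      apply eq_of_forall_mulVec
      intro y
      rw [← Matrix.mulVec_mulVec, (hran i y).2, Matrix.zero_mulVec]
    refine ⟨m + 1, Fin.cons J J', ?_, ?_, ?_, ?_, ?_⟩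
    -- The orthogonal projection of `W` onto `T` has kernel `W'`. Additivity of length on this short
    -- exact sequence raises the count by one.
    · let g : W →ₗ[A] T := frameHom hJ hA W hJ 1 (fun X _ => by rw [Matrix.one_mul, Matrix.mul_one])
      have hg : ∀ v : W, (g v).1 = J *ᵥ (Jᵀ *ᵥ v.1) := by
        intro v
        change J *ᵥ ((1 : Matrix (Fin d) (Fin d) ℝ) *ᵥ (Jᵀ *ᵥ v.1)) = _
        rw [Matrix.one_mulVec]
      have hgs : Function.Surjective g := by
        intro t
        refine ⟨⟨t.1, hTW t.2⟩, Subtype.ext ?_⟩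
        rw [hg]
        exact (hJ.mem_iff _).1 t.2
      have hex : Function.Exact (Submodule.inclusion hle) g := by
        intro v
        constructor
        · intro h
          have h1 := hg v
          rw [h] at h1
          have h2 : Jᵀ *ᵥ v.1 = 0 := hJ.mulVec_injective (by rw [← h1, Matrix.mulVec_zero]; rfl)
          exact ⟨⟨v.1, v.2, h2⟩, rfl⟩
        · rintro ⟨w, rfl⟩
          apply Subtype.ext
          rw [hg]
          change J *ᵥ (Jᵀ *ᵥ w.1) = 0
          rw [w.2.2, Matrix.mulVec_zero]
      rw [Module.length_eq_add_of_exact (R := A) (N := W') (M := W) (P := T) _ g (Submodule.inclusion_injective hle) hgs hex, hlen,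
        Module.length_eq_one]
      norm_cast
    · intro i j
      refine Fin.cases ?_ (fun i => ?_) i <;> refine Fin.cases ?_ (fun j => ?_) j
      · simpa using hJ.orth
      · simpa [Fin.succ_ne_zero, eq_comm] using hJJ' j
      · have := congrArg Matrix.transpose (hJJ' i)
        simpa [Matrix.transpose_mul] using this
      · simpa using horth i j
    · intro i
      refine Fin.cases ?_ (fun i => ?_) i
      · simpa using hJX
      · simpa using hint i
    · intro i
      refine Fin.cases ?_ (fun i => ?_) i
      · intro y; exact hTW (hJ.mulVec_mem y)
      · intro y; exact (hran i y).1
    · intro v hv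
      rw [Fin.sum_univ_succ]
      simp only [Fin.cons_zero, Fin.cons_succ]
      have hv' : v - J *ᵥ (Jᵀ *ᵥ v) ∈ W' := by
        refine ⟨W.sub_mem hv (hTW (hJ.mulVec_mem _)), ?_⟩
        rw [Matrix.mulVec_sub, Matrix.mulVec_mulVec _ _ J, hJ.orth, Matrix.one_mulVec, sub_self]
      have h1 := hsum _ hv'
      have h2 : ∀ i, (J' i)ᵀ *ᵥ (J *ᵥ (Jᵀ *ᵥ v)) = 0 := by
        intro i
        have := congrArg Matrix.transpose (hJJ' i)
        rw [Matrix.transpose_mul, Matrix.transpose_transpose, Matrix.transpose_zero] at this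
        rw [Matrix.mulVec_mulVec, this, Matrix.zero_mulVec]
      simp only [Matrix.mulVec_sub, h2, sub_zero] at h1
      rw [h1]
      abel

/-- Isometric embeddings of the simple module framed by `B` which exhaust the component `c`. -/
structure IsIsotypicFrame {d m : ℕ} (B : Matrix (Fin n) (Fin d) ℝ)
    (c : Submodule A (Fin n → ℝ)) (J : Fin m → Matrix (Fin n) (Fin d) ℝ) : Prop where
  orth : ∀ i j, (J i)ᵀ * J j = if i = j then 1 else 0
  mul_eq : ∀ i, ∀ X ∈ A, X * J i = J i * compress B X
  mem : ∀ i y, J i *ᵥ y ∈ c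
  sum : ∀ v ∈ c, ∑ i, J i *ᵥ ((J i)ᵀ *ᵥ v) = v

theorem exists_isIsotypicFrame (hA : ∀ X ∈ A, Xᵀ ∈ A) {d : ℕ} {B : Matrix (Fin n) (Fin d) ℝ}
    {S c : Submodule A (Fin n → ℝ)} (hB : IsFrame B (S : Set (Fin n → ℝ)))
    (hS : IsSimpleModule A S) (hc : c ∈ isotypicComponents A (Fin n → ℝ)) (hSc : S ≤ c) :
    ∃ J : Fin (Module.length A c).toNat → Matrix (Fin n) (Fin d) ℝ, IsIsotypicFrame B c J := by
  obtain ⟨m, J, hlen, h1, h2, h3, h4⟩ := exists_isometries hA hB hS _ c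
    (eq_isotypicComponent_of_le hc hSc).le le_rfl
  have : (Module.length A c).toNat = m := by rw [hlen]; rfl
  subst this
  exact ⟨J, h1, h2, h3, h4⟩

end Isotypic
end GNY

/-! ### The endomorphism algebra of a simple module -/

namespace GNY
open Matrix

section EndAlgebra

variable {n : ℕ} {A : Subalgebra ℝ (Matrix (Fin n) (Fin n) ℝ)}

/-- The matrices of the endomorphisms of a framed module. -/
noncomputable def endMatrix {d : ℕ} {B : Matrix (Fin n) (Fin d) ℝ} {S : Submodule A (Fin n → ℝ)}
    (hB : IsFrame B (S : Set (Fin n → ℝ))) (f : Module.End A S) : Matrix (Fin d) (Fin d) ℝ :=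
  Bᵀ * Matrix.of fun i j => (f ⟨B *ᵥ Pi.single j 1, hB.mulVec_mem _⟩).1 i

theorem mulVec_endMatrix {d : ℕ} {B : Matrix (Fin n) (Fin d) ℝ} {S : Submodule A (Fin n → ℝ)}
    (hB : IsFrame B (S : Set (Fin n → ℝ))) (f : Module.End A S) (y : Fin d → ℝ) :
    B *ᵥ (endMatrix hB f *ᵥ y) = (f ⟨B *ᵥ y, hB.mulVec_mem y⟩).1 := by
  rw [endMatrix, ← Matrix.mulVec_mulVec, ← hB.apply_mulVec f y]
  exact (hB.mem_iff _).1 (f _).2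

/-- The matrix representation of the endomorphism algebra of a framed module. -/
noncomputable def endMatrixHom {d : ℕ} {B : Matrix (Fin n) (Fin d) ℝ}
    {S : Submodule A (Fin n → ℝ)} (hB : IsFrame B (S : Set (Fin n → ℝ))) :
    Module.End A S →ₐ[ℝ] Matrix (Fin d) (Fin d) ℝ :=
  AlgHom.ofLinearMap
    { toFun := endMatrix hB
      map_add' := by
        intro f g
        apply eq_of_forall_mulVec
        intro y
        apply hB.mulVec_injective
        rw [mulVec_endMatrix, Matrix.add_mulVec, Matrix.mulVec_add, mulVec_endMatrix,
          mulVec_endMatrix]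
        rfl
      map_smul' := by
        intro r f
        apply eq_of_forall_mulVec
        intro y
        apply hB.mulVec_injective
        rw [mulVec_endMatrix, Matrix.smul_mulVec, Matrix.mulVec_smul, RingHom.id_apply,
          mulVec_endMatrix]
        rfl }
    (by
      apply eq_of_forall_mulVec
      intro y
      apply hB.mulVec_injective
      rw [Matrix.one_mulVec]
      exact mulVec_endMatrix hB 1 y)
    (by
      intro f g
      apply eq_of_forall_mulVec
      intro y
      apply hB.mulVec_injective
      rw [← Matrix.mulVec_mulVec]
      change B *ᵥ (endMatrix hB (f * g) *ᵥ y) = B *ᵥ (endMatrix hB f *ᵥ (endMatrix hB g *ᵥ y))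
      rw [mulVec_endMatrix, mulVec_endMatrix]
      have : (⟨B *ᵥ (endMatrix hB g *ᵥ y), hB.mulVec_mem _⟩ : S) =
          g ⟨B *ᵥ y, hB.mulVec_mem y⟩ := Subtype.ext (mulVec_endMatrix hB g y)
      rw [this]
      rfl)

theorem endMatrixHom_injective {d : ℕ} {B : Matrix (Fin n) (Fin d) ℝ}
    {S : Submodule A (Fin n → ℝ)} (hB : IsFrame B (S : Set (Fin n → ℝ))) :
    Function.Injective (endMatrixHom hB) := by
  intro f g h
  ext1 v
  have hv := (hB.mem_iff v.1).1 v.2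
  have hv' : v = ⟨B *ᵥ (Bᵀ *ᵥ v.1), hB.mulVec_mem _⟩ := Subtype.ext hv.symm
  apply Subtype.ext
  rw [hv', ← mulVec_endMatrix hB, ← mulVec_endMatrix hB]
  change B *ᵥ (endMatrixHom hB f *ᵥ _) = B *ᵥ (endMatrixHom hB g *ᵥ _)
  rw [h]

/-- Identifies the endomorphism algebra with a commutant inside real matrices, where it is visibly
closed under transposition and where its symmetric elements are scalar by Schur's lemma. -/
theorem mem_range_endMatrixHom {d : ℕ} {B : Matrix (Fin n) (Fin d) ℝ}
    {S : Submodule A (Fin n → ℝ)} (hA : ∀ X ∈ A, Xᵀ ∈ A)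
    (hB : IsFrame B (S : Set (Fin n → ℝ))) (Z : Matrix (Fin d) (Fin d) ℝ) :
    Z ∈ (endMatrixHom hB).range ↔ ∀ X ∈ A, Z * compress B X = compress B X * Z := by
  constructor
  · rintro ⟨f, rfl⟩ X hX
    apply eq_of_forall_mulVec
    intro y
    apply hB.mulVec_injective
    change B *ᵥ ((endMatrix hB f * compress B X) *ᵥ y) =
      B *ᵥ ((compress B X * endMatrix hB f) *ᵥ y)
    rw [← Matrix.mulVec_mulVec y (endMatrix hB f), ← Matrix.mulVec_mulVec y (compress B X)]
    change B *ᵥ (endMatrix hB f *ᵥ _) = B *ᵥ (compress B X *ᵥ (endMatrix hB f *ᵥ y))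
    rw [mulVec_endMatrix]
    have : (⟨B *ᵥ (compress B X *ᵥ y), hB.mulVec_mem _⟩ : S) =
        (⟨X, hX⟩ : A) • ⟨B *ᵥ y, hB.mulVec_mem y⟩ := by
      ext1
      change B *ᵥ (compress B X *ᵥ y) = X *ᵥ (B *ᵥ y)
      rw [Matrix.mulVec_mulVec, hB.mul_compress hX, Matrix.mulVec_mulVec]
    rw [this, map_smul]
    change X *ᵥ (f _).1 = _
    rw [← mulVec_endMatrix hB f y, Matrix.mulVec_mulVec _ B (compress B X), hB.mul_compress hX,
      ← Matrix.mulVec_mulVec]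
  · intro hZ
    refine ⟨frameHom hB hA S hB Z hZ, ?_⟩
    apply eq_of_forall_mulVec
    intro y
    apply hB.mulVec_injective
    refine (mulVec_endMatrix hB _ y).trans ?_
    change B *ᵥ (Z *ᵥ (Bᵀ *ᵥ (B *ᵥ y))) = _
    rw [Matrix.mulVec_mulVec _ Bᵀ, hB.orth, Matrix.one_mulVec]

end EndAlgebra

section Frobenius

variable {d : ℕ} {C : Subalgebra ℝ (Matrix (Fin d) (Fin d) ℝ)}

theorem eq_zero_of_transpose_mul_self {Z : Matrix (Fin d) (Fin d) ℝ} (h : Zᵀ * Z = 0) : Z = 0 := by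
  rw [← Matrix.conjTranspose_mul_self_eq_zero, Matrix.conjTranspose_eq_transpose_of_trivial, h]

theorem smul_one_nonneg [Nonempty (Fin d)] {Z : Matrix (Fin d) (Fin d) ℝ} {g : ℝ}
    (h : Zᵀ * Z = g • 1) : 0 ≤ g := by
  obtain ⟨i⟩ := ‹Nonempty (Fin d)›
  have := congrFun (congrFun h i) i
  rw [Matrix.mul_apply] at this
  simp only [Matrix.transpose_apply, Matrix.smul_apply, Matrix.one_apply_eq, smul_eq_mul,
    mul_one] at this
  rw [← this]
  exact Finset.sum_nonneg fun j _ => mul_self_nonneg _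

/-- In an algebra in which symmetric elements are scalar, complex structures are orthogonal. -/
theorem transpose_eq_neg_of_mul_self [Nonempty (Fin d)] (hT : ∀ Z ∈ C, Zᵀ ∈ C)
    (hs : ∀ Z ∈ C, Z.IsSymm → ∃ g : ℝ, Z = g • 1) {J : Matrix (Fin d) (Fin d) ℝ} (hJ : J ∈ C)
    (hJ2 : J * J = -1) : Jᵀ = -J := by
  obtain ⟨s, hsum⟩ := hs (J + Jᵀ) (C.add_mem hJ (hT J hJ)) (by
    rw [Matrix.IsSymm, Matrix.transpose_add, Matrix.transpose_transpose, add_comm])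
  obtain ⟨g, hg⟩ := hs (Jᵀ * J) (C.mul_mem (hT J hJ) hJ) (by
    rw [Matrix.IsSymm, Matrix.transpose_mul, Matrix.transpose_transpose])
  have hJT : Jᵀ = s • 1 - J := by rw [← hsum]; abel
  have h1 : s • J = (g - 1) • (1 : Matrix (Fin d) (Fin d) ℝ) := by
    rw [hJT, sub_mul, hJ2, smul_mul_assoc, one_mul, sub_neg_eq_add] at hg
    rw [sub_smul, ← hg, one_smul, add_sub_cancel_right]
  by_cases hs0 : s = 0
  · rw [hJT, hs0, zero_smul, zero_sub]
  · exfalso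
    have h2 : J = (s⁻¹ * (g - 1)) • (1 : Matrix (Fin d) (Fin d) ℝ) := by
      rw [mul_smul, ← h1, smul_smul, inv_mul_cancel₀ hs0, one_smul]
    rw [h2] at hJ2
    obtain ⟨i⟩ := ‹Nonempty (Fin d)›
    have := congrFun (congrFun hJ2 i) i
    simp only [smul_mul_assoc, one_mul, Matrix.smul_apply, Matrix.one_apply_eq,
      smul_eq_mul, mul_one, Matrix.neg_apply] at this
    nlinarith [mul_self_nonneg (s⁻¹ * (g - 1))]

/-- The symmetric matrix `Zᵀ * Z` is a scalar `g > 0`, and `Z * Z = -(Zᵀ * Z)` for antisymmetric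
`Z`; so `Z` divided by the square root of `g` squares to `-1`. -/
theorem exists_complex_structure [Nonempty (Fin d)] 
    (hs : ∀ Z ∈ C, Z.IsSymm → ∃ g : ℝ, Z = g • 1) {Z : Matrix (Fin d) (Fin d) ℝ} (hZ : Z ∈ C)
    (hZT : Zᵀ = -Z) (hZ0 : Z ≠ 0) : ∃ g : ℝ, g ≠ 0 ∧ (g • Z) * (g • Z) = -1 := by
  obtain ⟨g, hg⟩ := hs (Zᵀ * Z) (by rw [hZT]; exact C.mul_mem (C.neg_mem hZ) hZ) (by
    rw [Matrix.IsSymm, Matrix.transpose_mul, Matrix.transpose_transpose])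
  have hg0 : g ≠ 0 := by
    rintro rfl
    exact hZ0 (eq_zero_of_transpose_mul_self (by rw [hg, zero_smul]))
  have hgp : 0 < g := lt_of_le_of_ne (smul_one_nonneg hg) hg0.symm
  have h0 : Real.sqrt g ≠ 0 := (Real.sqrt_pos.2 hgp).ne'
  refine ⟨(Real.sqrt g)⁻¹, inv_ne_zero h0, ?_⟩
  have h1 : Z * Z = -(g • 1) := by rw [← hg, hZT, neg_mul, neg_neg]
  rw [Matrix.smul_mul, Matrix.mul_smul, h1, smul_smul, smul_neg, smul_smul]
  have h2 := Real.mul_self_sqrt hgp.le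
  have : (Real.sqrt g)⁻¹ * (Real.sqrt g)⁻¹ * g = 1 := by
    field_simp
    nlinarith
  rw [this, one_smul]

theorem nonempty_algEquiv_of_range_eq {D E : Type*} [Ring D] [Algebra ℝ D] [Ring E] [Algebra ℝ E]
    {C : Subalgebra ℝ E} (θ : D →ₐ[ℝ] E) (hθ : Function.Injective θ) (h : θ.range = C) :
    Nonempty (C ≃ₐ[ℝ] D) := by
  subst h
  exact ⟨(AlgEquiv.ofInjective θ hθ).symm⟩

/-- The theorem of Frobenius, for algebras of real matrices whose symmetric elements are scalar. -/
theorem frobenius [Nonempty (Fin d)] (hT : ∀ Z ∈ C, Zᵀ ∈ C)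
    (hs : ∀ Z ∈ C, Z.IsSymm → ∃ g : ℝ, Z = g • 1) :
    Nonempty (C ≃ₐ[ℝ] ℝ) ∨ Nonempty (C ≃ₐ[ℝ] ℂ) ∨ Nonempty (C ≃ₐ[ℝ] ℍ[ℝ]) := by
  -- Symmetric parts are scalar, so only the antisymmetric elements have to be determined. The three
  -- cases are: there are none, they form a line, or there are two independent ones.
  have hdec : ∀ Z ∈ C, ∃ (g : ℝ) (W : Matrix (Fin d) (Fin d) ℝ), W ∈ C ∧ Wᵀ = -W ∧
      Z = g • 1 + W := by
    intro Z hZ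
    obtain ⟨g, hg⟩ := hs (Z + Zᵀ) (C.add_mem hZ (hT Z hZ)) (by
      rw [Matrix.IsSymm, Matrix.transpose_add, Matrix.transpose_transpose, add_comm])
    refine ⟨g / 2, (1 / 2 : ℝ) • (Z - Zᵀ), C.smul_mem (C.sub_mem hZ (hT Z hZ)) _, ?_, ?_⟩
    · rw [Matrix.transpose_smul, Matrix.transpose_sub, Matrix.transpose_transpose, ← smul_neg,
        neg_sub]
    · have : (g / 2) • (1 : Matrix (Fin d) (Fin d) ℝ) = (1 / 2 : ℝ) • (Z + Zᵀ) := by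
        rw [hg, smul_smul]; congr 1; ring
      rw [this, ← smul_add]
      have : Z + Zᵀ + (Z - Zᵀ) = (2 : ℝ) • Z := by rw [two_smul]; abel
      rw [this, smul_smul]; norm_num
  by_cases h1 : ∀ W ∈ C, Wᵀ = -W → W = 0
  · left
    refine nonempty_algEquiv_of_range_eq (Algebra.ofId ℝ _) (FaithfulSMul.algebraMap_injective _ _) ?_
    apply le_antisymm
    · rintro _ ⟨g, rfl⟩; exact C.algebraMap_mem g
    · intro Z hZ
      obtain ⟨g, W, hW, hWT, rfl⟩ := hdec Z hZ
      rw [h1 W hW hWT, add_zero]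
      exact ⟨g, Algebra.algebraMap_eq_smul_one g⟩
  right
  push Not at h1
  obtain ⟨I', hI', hI'T, hI'0⟩ := h1
  obtain ⟨g, hg0, hII⟩ := exists_complex_structure hs hI' hI'T hI'0
  have hIC : g • I' ∈ C := C.smul_mem hI' g
  have hIT : (g • I')ᵀ = -(g • I') := by rw [Matrix.transpose_smul, hI'T, smul_neg]
  generalize g • I' = I at hII hIC hIT
  by_cases h2 : ∀ W ∈ C, Wᵀ = -W → ∃ r : ℝ, W = r • I
  · left
    refine nonempty_algEquiv_of_range_eq (Complex.liftAux I hII) (RingHom.injective _) ?_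
    apply le_antisymm
    · rintro _ ⟨z, rfl⟩
      change Complex.liftAux I hII z ∈ C
      rw [Complex.liftAux_apply]
      exact C.add_mem (C.algebraMap_mem _) (C.smul_mem hIC _)
    · intro Z hZ
      obtain ⟨g, W, hW, hWT, rfl⟩ := hdec Z hZ
      obtain ⟨r, rfl⟩ := h2 W hW hWT
      refine ⟨⟨g, r⟩, ?_⟩
      change Complex.liftAux I hII _ = _
      rw [Complex.liftAux_apply, Algebra.algebraMap_eq_smul_one]
  right
  push Not at h2
  obtain ⟨J', hJ', hJ'T, hJ'0⟩ := h2
  -- Anticommutators of antisymmetric elements are symmetric, hence scalar. They act as an inner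
  -- product, and a Gram-Schmidt step yields a complex structure anticommuting with `I`.
  have hanti : ∀ {Z}, Z ∈ C → Zᵀ = -Z → ∀ {K}, K ∈ C → Kᵀ = -K → ∃ s : ℝ, Z * K + K * Z = s • 1 := by
    intro Z hZ hZT K hK hKT
    apply hs _ (C.add_mem (C.mul_mem hZ hK) (C.mul_mem hK hZ))
    rw [Matrix.IsSymm, Matrix.transpose_add, Matrix.transpose_mul, Matrix.transpose_mul, hZT, hKT,
      neg_mul_neg, neg_mul_neg, add_comm]
  obtain ⟨s, hsJ⟩ := hanti hJ' hJ'T hIC hIT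
  have hK0 : J' + (s / 2) • I ≠ 0 := by
    intro h
    exact hJ'0 (-(s / 2)) (by rw [neg_smul]; exact eq_neg_of_add_eq_zero_left h)
  have hKC : J' + (s / 2) • I ∈ C := C.add_mem hJ' (C.smul_mem hIC _)
  have hKT : (J' + (s / 2) • I)ᵀ = -(J' + (s / 2) • I) := by
    rw [Matrix.transpose_add, Matrix.transpose_smul, hJ'T, hIT]; module
  have hKI : (J' + (s / 2) • I) * I = -(I * (J' + (s / 2) • I)) := by
    rw [add_mul, mul_add, smul_mul_assoc, mul_smul_comm, hII]
    rw [← sub_eq_zero]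
    have : J' * I + (s / 2) • (-1 : Matrix (Fin d) (Fin d) ℝ) - -(I * J' + (s / 2) • -1) =
      (J' * I + I * J') - s • 1 := by module
    rw [this, hsJ, sub_self]
  obtain ⟨t, ht0, hJJ⟩ := exists_complex_structure hs hKC hKT hK0
  have hJC : t • (J' + (s / 2) • I) ∈ C := C.smul_mem hKC t
  have hJT : (t • (J' + (s / 2) • I))ᵀ = -(t • (J' + (s / 2) • I)) := by
    rw [Matrix.transpose_smul, hKT, smul_neg]
  have hJI : (t • (J' + (s / 2) • I)) * I = -(I * (t • (J' + (s / 2) • I))) := by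
    rw [smul_mul_assoc, mul_smul_comm, hKI, smul_neg]
  generalize t • (J' + (s / 2) • I) = J at hJJ hJC hJT hJI
  have hIJC : I * J ∈ C := C.mul_mem hIC hJC
  let q : QuaternionAlgebra.Basis (Matrix (Fin d) (Fin d) ℝ) (-1 : ℝ) 0 (-1) :=
    { i := I, j := J, k := I * J
      i_mul_i := by rw [hII]; module
      j_mul_j := by rw [hJJ]; module
      i_mul_j := rfl
      j_mul_i := by rw [hJI]; module }
  refine nonempty_algEquiv_of_range_eq (D := ℍ[ℝ]) q.liftHom (RingHom.injective _) ?_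
  have hq : ∀ x : ℍ[ℝ], q.liftHom x = algebraMap ℝ _ x.re + x.imI • I + x.imJ • J + x.imK • (I * J) :=
    fun x => rfl
  apply le_antisymm
  · rintro _ ⟨x, rfl⟩
    change q.liftHom x ∈ C
    rw [hq]
    exact C.add_mem (C.add_mem (C.add_mem (C.algebraMap_mem _) (C.smul_mem hIC _))
      (C.smul_mem hJC _)) (C.smul_mem hIJC _)
  · intro Z hZ
    obtain ⟨g, W, hW, hWT, rfl⟩ := hdec Z hZ
    obtain ⟨a, ha⟩ := hanti hW hWT hIC hIT
    obtain ⟨b, hb⟩ := hanti hW hWT hJC hJT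
    -- Removing the components along `I` and `J` leaves `V` anticommuting with both. Then `I * J *
    -- V` is symmetric, hence scalar, so `V` is a multiple of `I * J` and nothing beyond the
    -- quaternions occurs.
    set V := W + (a / 2) • I + (b / 2) • J with hV
    have hVC : V ∈ C := C.add_mem (C.add_mem hW (C.smul_mem hIC _)) (C.smul_mem hJC _)
    have hVT : Vᵀ = -V := by
      rw [hV, Matrix.transpose_add, Matrix.transpose_add, Matrix.transpose_smul,
        Matrix.transpose_smul, hWT, hIT, hJT]
      module
    have hVI : V * I = -(I * V) := by
      rw [hV]
      simp only [add_mul, mul_add, smul_mul_assoc, mul_smul_comm, hII, hJI]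
      rw [eq_sub_of_add_eq ha]
      module
    have hVJ : V * J = -(J * V) := by
      rw [hV]
      simp only [add_mul, mul_add, smul_mul_assoc, mul_smul_comm, hJJ, hJI]
      rw [eq_sub_of_add_eq hb]
      module
    obtain ⟨c, hc⟩ := hs (I * J * V) (C.mul_mem hIJC hVC) (by
      rw [Matrix.IsSymm, Matrix.transpose_mul, Matrix.transpose_mul, hVT, hIT, hJT, neg_mul_neg,
        hJI, mul_neg, neg_mul, neg_neg, ← mul_assoc, hVI, neg_mul, mul_assoc, hVJ, mul_neg, neg_neg,
        mul_assoc])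
    have hIJ2 : (I * J) * (I * J) = -1 := by
      rw [mul_assoc, ← mul_assoc J, hJI, neg_mul, mul_neg, mul_assoc, hJJ, mul_neg, mul_neg, mul_one,
        neg_neg, hII]
    have hVe : V = -(c • (I * J)) := by
      have := congrArg ((I * J) * ·) hc
      simp only [← mul_assoc (I * J) (I * J), hIJ2, mul_smul_comm, mul_one, neg_mul, one_mul] at this
      rw [← this, neg_neg]
    refine ⟨⟨g, -(a / 2), -(b / 2), -c⟩, ?_⟩
    refine (hq _).trans ?_
    rw [Algebra.algebraMap_eq_smul_one]
    have : W = -((a / 2) • I) + -((b / 2) • J) + V := by rw [hV]; module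
    rw [this, hVe]
    module

end Frobenius
end GNY

/-! ### Orthogonal projections onto isotypic components -/

namespace GNY
open Matrix
open scoped Kronecker

section Projection

variable {n : ℕ} {A : Subalgebra ℝ (Matrix (Fin n) (Fin n) ℝ)}

/-- `P` is the orthogonal projection onto `c`. -/
structure IsProj (P : Matrix (Fin n) (Fin n) ℝ) (c : Submodule A (Fin n → ℝ)) : Prop where
  symm : Pᵀ = P
  mem : ∀ v, P *ᵥ v ∈ c
  eq_self : ∀ v ∈ c, P *ᵥ v = v

theorem exists_isProj (c : Submodule A (Fin n → ℝ)) : ∃ P, IsProj P c := by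
  obtain ⟨d, B, hB⟩ := exists_frame c
  refine ⟨B * Bᵀ, by simp, fun v => ?_, fun v hv => ?_⟩
  · rw [← Matrix.mulVec_mulVec]; exact hB.mulVec_mem _
  · rw [← Matrix.mulVec_mulVec]; exact (hB.mem_iff v).1 hv

theorem IsProj.mul_eq {P Z : Matrix (Fin n) (Fin n) ℝ} {c : Submodule A (Fin n → ℝ)}
    (hP : IsProj P c) (hZ : ∀ v, Z *ᵥ v ∈ c) : P * Z = Z := by
  apply eq_of_forall_mulVec
  intro v
  rw [← Matrix.mulVec_mulVec, hP.eq_self _ (hZ v)]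

theorem IsProj.mul_self {P : Matrix (Fin n) (Fin n) ℝ} {c : Submodule A (Fin n → ℝ)}
    (hP : IsProj P c) : P * P = P := hP.mul_eq hP.mem

theorem IsProj.unique {P P' : Matrix (Fin n) (Fin n) ℝ} {c : Submodule A (Fin n → ℝ)}
    (hP : IsProj P c) (hP' : IsProj P' c) : P = P' := by
  have h1 := hP.mul_eq hP'.mem
  have h2 := congrArg Matrix.transpose (hP'.mul_eq hP.mem)
  rw [Matrix.transpose_mul, hP.symm, hP'.symm] at h2
  rw [← h1, h2]

/-- Invariance of `c` under `Z` gives `P Z P = Z P`; invariance under `Zᵀ`, transposed, gives `P Z P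
= P Z`. -/
theorem IsProj.commute {P Z : Matrix (Fin n) (Fin n) ℝ} {c : Submodule A (Fin n → ℝ)}
    (hP : IsProj P c) (h1 : ∀ v ∈ c, Z *ᵥ v ∈ c) (h2 : ∀ v ∈ c, Zᵀ *ᵥ v ∈ c) :
    P * Z = Z * P := by
  have e1 : P * (Z * P) = Z * P :=
    hP.mul_eq fun v => by rw [← Matrix.mulVec_mulVec]; exact h1 _ (hP.mem v)
  have e2 : P * (Zᵀ * P) = Zᵀ * P :=
    hP.mul_eq fun v => by rw [← Matrix.mulVec_mulVec]; exact h2 _ (hP.mem v)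
  have e3 := congrArg Matrix.transpose e2
  simp only [Matrix.transpose_mul, hP.symm, Matrix.transpose_transpose] at e3
  rw [← e3, ← e1, Matrix.mul_assoc]

theorem IsProj.commute_of_mem {P : Matrix (Fin n) (Fin n) ℝ} {c : Submodule A (Fin n → ℝ)}
    (hA : ∀ X ∈ A, Xᵀ ∈ A) (hP : IsProj P c) {X : Matrix (Fin n) (Fin n) ℝ} (hX : X ∈ A) :
    P * X = X * P :=
  hP.commute (fun _ hv => c.smul_mem ⟨X, hX⟩ hv) (fun _ hv => c.smul_mem ⟨Xᵀ, hA X hX⟩ hv)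

/-- The orthogonal complement of a submodule is again a submodule. -/
theorem isSemisimpleModule_of_transpose_mem (hA : ∀ X ∈ A, Xᵀ ∈ A) :
    IsSemisimpleModule A (Fin n → ℝ) := by
  refine (isSemisimpleModule_iff ..).2 ⟨fun c => ?_⟩
  obtain ⟨P, hP⟩ := exists_isProj c
  refine ⟨orthPart hA P id (fun X hX => (hP.commute_of_mem hA hX).symm.trans rfl) ⊤, ?_, ?_⟩
  · rw [disjoint_iff, eq_bot_iff]
    rintro v ⟨hv, hv'⟩
    have h1 : Pᵀ *ᵥ v = 0 := hv'.2
    rw [hP.symm, hP.eq_self v hv] at h1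
    exact h1
  · rw [codisjoint_iff, eq_top_iff]
    intro v _
    have h1 : v = P *ᵥ v + (v - P *ᵥ v) := by abel
    rw [h1]
    refine Submodule.add_mem_sup (hP.mem v) ⟨trivial, ?_⟩
    rw [hP.symm, Matrix.mulVec_sub, Matrix.mulVec_mulVec, hP.mul_self, sub_self]

/-- A matrix commuting with `A` as an endomorphism. -/
def commutantHom (Z : Matrix (Fin n) (Fin n) ℝ) (hZ : ∀ X ∈ A, Z * X = X * Z) :
    (Fin n → ℝ) →ₗ[A] (Fin n → ℝ) where
  toFun v := Z *ᵥ v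
  map_add' v w := Matrix.mulVec_add _ _ _
  map_smul' X v := by
    change Z *ᵥ (X.1 *ᵥ v) = X.1 *ᵥ (Z *ᵥ v)
    rw [Matrix.mulVec_mulVec, Matrix.mulVec_mulVec, hZ X.1 X.2]

theorem mulVec_mem_isotypicComponents {c : Submodule A (Fin n → ℝ)}
    (hc : c ∈ isotypicComponents A (Fin n → ℝ)) {Z : Matrix (Fin n) (Fin n) ℝ}
    (hZ : ∀ X ∈ A, Z * X = X * Z) {v : Fin n → ℝ} (hv : v ∈ c) : Z *ᵥ v ∈ c := by
  obtain ⟨S, _, rfl⟩ := hc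
  exact LinearMap.le_comap_isotypicComponent S (commutantHom Z hZ) hv

theorem transpose_commute (hA : ∀ X ∈ A, Xᵀ ∈ A) {Z : Matrix (Fin n) (Fin n) ℝ}
    (hZ : ∀ X ∈ A, Z * X = X * Z) : ∀ X ∈ A, Zᵀ * X = X * Zᵀ := by
  intro X hX
  have := congrArg Matrix.transpose (hZ _ (hA X hX))
  simpa [Matrix.transpose_mul] using this.symm

theorem IsProj.commute_of_commute (hA : ∀ X ∈ A, Xᵀ ∈ A) {c : Submodule A (Fin n → ℝ)}
    (hc : c ∈ isotypicComponents A (Fin n → ℝ)) {P : Matrix (Fin n) (Fin n) ℝ} (hP : IsProj P c)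
    {Z : Matrix (Fin n) (Fin n) ℝ} (hZ : ∀ X ∈ A, Z * X = X * Z) : P * Z = Z * P :=
  hP.commute (fun _ hv => mulVec_mem_isotypicComponents hc hZ hv)
    (fun _ hv => mulVec_mem_isotypicComponents hc (transpose_commute hA hZ) hv)

/-- `P` commutes with the algebra, hence with the projection `P'` onto the fully invariant `c'`. The
range of `P * P'` therefore lies in both components, which are disjoint. -/
theorem IsProj.mul_eq_zero (hA : ∀ X ∈ A, Xᵀ ∈ A) {c c' : Submodule A (Fin n → ℝ)}
    (hc : c ∈ isotypicComponents A (Fin n → ℝ)) (hc' : c' ∈ isotypicComponents A (Fin n → ℝ))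
    (hne : c ≠ c') {P P' : Matrix (Fin n) (Fin n) ℝ} (hP : IsProj P c) (hP' : IsProj P' c') :
    P * P' = 0 := by
  have hcomm := hP'.commute_of_commute hA hc' (Z := P) (fun X hX => hP.commute_of_mem hA hX)
  apply eq_of_forall_mulVec
  intro v
  have h1 : (P * P') *ᵥ v ∈ c := by rw [← Matrix.mulVec_mulVec]; exact hP.mem _
  have h2 : (P * P') *ᵥ v ∈ c' := by
    rw [← hcomm, ← Matrix.mulVec_mulVec]; exact hP'.mem _
  have hdis : Disjoint c c' :=
    ((sSupIndep_isotypicComponents A (Fin n → ℝ)).pairwiseDisjoint hc hc' hne)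
  rw [Matrix.zero_mulVec]
  exact (Submodule.disjoint_def.1 hdis) _ h1 h2

/-- The vectors fixed by the sum form a submodule containing every isotypic component, and by
semisimplicity the components span. -/
theorem sum_isProj_eq_one (hA : ∀ X ∈ A, Xᵀ ∈ A) [Fintype (isotypicComponents A (Fin n → ℝ))]
    (P : isotypicComponents A (Fin n → ℝ) → Matrix (Fin n) (Fin n) ℝ)
    (hP : ∀ c, IsProj (P c) c.1) : ∑ c, P c = 1 := by
  classical
  have := isSemisimpleModule_of_transpose_mem hA
  let K : Submodule A (Fin n → ℝ) :=
    LinearMap.eqLocus (commutantHom (∑ c, P c) (fun X hX => by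
      rw [Finset.sum_mul, Finset.mul_sum]
      exact Finset.sum_congr rfl fun c _ => (hP c).commute_of_mem hA hX)) LinearMap.id
  have hK : sSup (isotypicComponents A (Fin n → ℝ)) ≤ K := by
    refine sSup_le fun c hc v hv => ?_
    change (∑ c, P c) *ᵥ v = v
    rw [Matrix.sum_mulVec, Finset.sum_eq_single ⟨c, hc⟩]
    · exact (hP ⟨c, hc⟩).eq_self v hv
    · intro c' _ hne
      have h := (hP c').mul_eq_zero hA c'.2 hc (fun h => hne (Subtype.ext h)) (hP ⟨c, hc⟩)
      rw [← (hP ⟨c, hc⟩).eq_self v hv, Matrix.mulVec_mulVec, h, Matrix.zero_mulVec]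
    · intro h; exact absurd (Finset.mem_univ _) h
  rw [sSup_isotypicComponents] at hK
  apply eq_of_forall_mulVec
  intro v
  rw [Matrix.one_mulVec]
  exact hK (Submodule.mem_top : v ∈ ⊤)

theorem IsIsotypicFrame.isProj {d m : ℕ} {B : Matrix (Fin n) (Fin d) ℝ}
    {c : Submodule A (Fin n → ℝ)} {J : Fin m → Matrix (Fin n) (Fin d) ℝ}
    (hJ : IsIsotypicFrame B c J) : IsProj (∑ i, J i * (J i)ᵀ) c where
  symm := by simp [Matrix.transpose_sum]
  mem v := by
    rw [Matrix.sum_mulVec]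
    exact c.sum_mem fun i _ => by rw [← Matrix.mulVec_mulVec]; exact hJ.mem i _
  eq_self v hv := by
    rw [Matrix.sum_mulVec]
    simpa only [← Matrix.mulVec_mulVec] using hJ.sum v hv

end Projection

/-! ### Frames for `N` flavors of an isotypic component -/

section Assemble

variable {n N : ℕ}

/-- The isometries `J i`, placed side by side in each of `N` copies. -/
def assemble (N : ℕ) {m d : ℕ} (J : Fin m → Matrix (Fin n) (Fin d) ℝ) :
    Matrix (Fin N × Fin n) (Fin (N * m) × Fin d) ℝ :=
  Matrix.of fun p q => if p.1 = (finProdFinEquiv.symm q.1).1 then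
    J (finProdFinEquiv.symm q.1).2 p.2 q.2 else 0

theorem assemble_transpose_mul_assemble {m d : ℕ} {J : Fin m → Matrix (Fin n) (Fin d) ℝ}
    (hJ : ∀ i j, (J i)ᵀ * J j = if i = j then 1 else 0) :
    (assemble N J)ᵀ * assemble N J = 1 := by
  ext ⟨k, y⟩ ⟨l, z⟩
  obtain ⟨⟨a, i⟩, rfl⟩ := finProdFinEquiv.surjective k
  obtain ⟨⟨b, j⟩, rfl⟩ := finProdFinEquiv.surjective l
  have h := congrFun (congrFun (hJ i j) y) z
  rw [Matrix.mul_apply] at h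
  rw [Matrix.mul_apply, Fintype.sum_prod_type]
  simp only [assemble, Matrix.transpose_apply, Matrix.of_apply, Equiv.symm_apply_apply, ite_mul,
    zero_mul, mul_ite, mul_zero]
  simp only [Matrix.transpose_apply] at h
  rw [Finset.sum_eq_single a]
  · simp only [if_true]
    by_cases hab : a = b
    · subst hab
      simp only [if_true, h, Matrix.one_apply, Prod.mk.injEq, EmbeddingLike.apply_eq_iff_eq, true_and]
      by_cases hij : i = j
      · simp [hij, Matrix.one_apply]
      · simp [hij]
    · simp [hab]
  · intro c _ hc
    simp [hc]
  · simp

theorem one_kronecker_mul_assemble {m d : ℕ} (J : Fin m → Matrix (Fin n) (Fin d) ℝ)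
    (X : Matrix (Fin n) (Fin n) ℝ) :
    ((1 : Matrix (Fin N) (Fin N) ℝ) ⊗ₖ X) * assemble N J = assemble N fun i => X * J i := by
  ext ⟨a, x⟩ ⟨k, y⟩
  rw [Matrix.mul_apply, Fintype.sum_prod_type, Finset.sum_eq_single a]
  · by_cases h : a = (finProdFinEquiv.symm k).1
    · simp only [assemble, Matrix.of_apply, if_pos h, Matrix.mul_apply, Matrix.kroneckerMap_apply,
        Matrix.one_apply_eq, one_mul]
    · simp only [assemble, Matrix.of_apply, if_neg h, mul_zero, Finset.sum_const_zero]
  · intro b _ hb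
    simp [Ne.symm hb]
  · simp

theorem assemble_mul_one_kronecker {m d : ℕ} (J : Fin m → Matrix (Fin n) (Fin d) ℝ)
    (r : Matrix (Fin d) (Fin d) ℝ) :
    assemble N J * ((1 : Matrix (Fin (N * m)) (Fin (N * m)) ℝ) ⊗ₖ r) =
      assemble N fun i => J i * r := by
  ext ⟨a, x⟩ ⟨k, y⟩
  rw [Matrix.mul_apply, Fintype.sum_prod_type, Finset.sum_eq_single k]
  · by_cases h : a = (finProdFinEquiv.symm k).1
    · simp only [assemble, Matrix.of_apply, if_pos h, Matrix.mul_apply, Matrix.kroneckerMap_apply,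
        Matrix.one_apply_eq, one_mul]
    · simp only [assemble, Matrix.of_apply, if_neg h, zero_mul, Finset.sum_const_zero]
  · intro b _ hb
    simp [hb]
  · simp

theorem assemble_mul_assemble_transpose {m d : ℕ} (J : Fin m → Matrix (Fin n) (Fin d) ℝ) :
    assemble N J * (assemble N J)ᵀ = (1 : Matrix (Fin N) (Fin N) ℝ) ⊗ₖ ∑ i, J i * (J i)ᵀ := by
  ext ⟨a, x⟩ ⟨b, y⟩
  rw [Matrix.mul_apply, Fintype.sum_prod_type, ← finProdFinEquiv.sum_comp, Fintype.sum_prod_type]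
  simp only [assemble, Matrix.transpose_apply, Matrix.of_apply, Equiv.symm_apply_apply, ite_mul,
    zero_mul, mul_ite, mul_zero, Matrix.kroneckerMap_apply, Matrix.sum_apply, Matrix.mul_apply]
  rw [Finset.sum_eq_single a]
  · by_cases hab : b = a
    · subst hab
      simp
    · simp [hab, Ne.symm hab]
  · intro c _ hc
    simp [Ne.symm hc]
  · simp

end Assemble
end GNY

/-! ### Conjugation on `ℝ`, `ℂ`, `ℍ` as transposition -/

namespace GNY
open Matrix
open scoped Kronecker

section ImaginarySpan

/-- Every element of `D` is a combination of `1` and of square roots of `-1`, and the involution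
is the standard conjugation. -/
def IsImaginarySpan (D : Type*) [Ring D] [StarRing D] [Algebra ℝ D] : Prop :=
  ∀ q : D, ∃ (k : ℕ) (r : ℝ) (u : Fin k → D) (a : Fin k → ℝ), (∀ i, u i * u i = -1) ∧
    q = algebraMap ℝ D r + ∑ i, a i • u i ∧ star q = algebraMap ℝ D r - ∑ i, a i • u i

theorem isImaginarySpan_real : IsImaginarySpan ℝ := fun q =>
  ⟨0, q, Fin.elim0, Fin.elim0, fun i => i.elim0, by simp, by simp⟩

theorem isImaginarySpan_complex : IsImaginarySpan ℂ := fun q =>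
  ⟨1, q.re, fun _ => Complex.I, fun _ => q.im, fun _ => Complex.I_mul_I,
    by simp, by simp [Complex.ext_iff]⟩

theorem isImaginarySpan_quaternion : IsImaginarySpan ℍ[ℝ] := by
  intro q
  have hu : ∀ a b c : ℝ, ∃ u : ℍ[ℝ], u.re = 0 ∧ u.imI = a ∧ u.imJ = b ∧ u.imK = c :=
    fun a b c => ⟨⟨0, a, b, c⟩, rfl, rfl, rfl, rfl⟩
  obtain ⟨i, hi⟩ := hu 1 0 0
  obtain ⟨j, hj⟩ := hu 0 1 0
  obtain ⟨k, hk⟩ := hu 0 0 1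
  refine ⟨3, q.re, ![i, j, k], ![q.imI, q.imJ, q.imK], fun m => ?_, ?_, ?_⟩
  · fin_cases m <;> ext <;> simp [hi, hj, hk]
  · ext <;> simp [Fin.sum_univ_three, hi, hj, hk, Quaternion.algebraMap_def]
  · ext <;> simp [Fin.sum_univ_three, hi, hj, hk, Quaternion.algebraMap_def]

variable {D : Type*} [Ring D] [StarRing D] [Algebra ℝ D]

/-- An algebra isomorphism with `D` is not assumed to respect the involutions. It does so
automatically, because square roots of `-1` go to complex structures, and these are antisymmetric
when symmetric elements are scalar. -/
theorem IsImaginarySpan.map_star (hD : IsImaginarySpan D) {d : ℕ} [Nonempty (Fin d)]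
    (θ : D →ₐ[ℝ] Matrix (Fin d) (Fin d) ℝ) (hT : ∀ Z ∈ θ.range, Zᵀ ∈ θ.range)
    (hs : ∀ Z ∈ θ.range, Z.IsSymm → ∃ g : ℝ, Z = g • 1) (q : D) : θ (star q) = (θ q)ᵀ := by
  obtain ⟨k, r, u, a, hu, hq, hq'⟩ := hD q
  have h1 : ∀ i, (θ (u i))ᵀ = -θ (u i) := fun i =>
    transpose_eq_neg_of_mul_self hT hs ⟨u i, rfl⟩ (by rw [← map_mul, hu, map_neg, map_one])
  rw [hq', hq, map_sub, map_add, map_sum, Matrix.transpose_add, Matrix.transpose_sum, sub_eq_add_neg,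
    ← Finset.sum_neg_distrib]
  congr 1
  · rw [AlgHom.commutes, Algebra.algebraMap_eq_smul_one, Matrix.transpose_smul, Matrix.transpose_one]
  · refine Finset.sum_congr rfl fun i _ => ?_
    rw [map_smul, Matrix.transpose_smul, h1, smul_neg]

end ImaginarySpan

/-! ### Groups embedded as orthogonal elements of corners -/

section Corner

variable {I : Type*} [Fintype I] [DecidableEq I]

/-- A topological embedding of the group `F` as the group of orthogonal elements of the corner of
the algebra `𝒞` cut out by its central projection `P`. -/
structure IsCorner {F : Type*} [Group F] [TopologicalSpace F] (𝒞 : Subalgebra ℝ (Matrix I I ℝ))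
    (P : Matrix I I ℝ) (f : F → Matrix I I ℝ) : Prop where
  map_one : f 1 = P
  map_mul : ∀ a b, f (a * b) = f a * f b
  transpose : ∀ a, (f a)ᵀ = f a⁻¹
  mem : ∀ a, f a ∈ 𝒞
  embedding : Topology.IsEmbedding f
  comm : ∀ Q ∈ 𝒞, P * Q = Q * P
  surj : ∀ Q ∈ 𝒞, Qᵀ * Q = 1 → Q * Qᵀ = 1 → ∃ a, f a = P * Q

variable {𝒞 : Subalgebra ℝ (Matrix I I ℝ)}

namespace IsCorner

section

variable {F : Type*} [Group F] [TopologicalSpace F] {P : Matrix I I ℝ} {f : F → Matrix I I ℝ}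

theorem proj_mul (h : IsCorner 𝒞 P f) (a : F) : P * f a = f a := by
  rw [← h.map_one, ← h.map_mul, one_mul]

theorem mul_proj (h : IsCorner 𝒞 P f) (a : F) : f a * P = f a := by
  rw [← h.map_one, ← h.map_mul, mul_one]

theorem mul_eq_zero {F' : Type*} [Group F'] [TopologicalSpace F'] {P' : Matrix I I ℝ}
    {f' : F' → Matrix I I ℝ} (h : IsCorner 𝒞 P f) (h' : IsCorner 𝒞 P' f') (hPP : P * P' = 0)
    (a : F) (b : F') : f a * f' b = 0 := by
  rw [← h.mul_proj, ← h'.proj_mul, mul_assoc, ← mul_assoc P, hPP, zero_mul, mul_zero]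

theorem proj_mul_eq_zero {F' : Type*} [Group F'] [TopologicalSpace F'] {P' : Matrix I I ℝ}
    {f' : F' → Matrix I I ℝ} (h' : IsCorner 𝒞 P' f') (hPP : P * P' = 0)
    (b : F') : P * f' b = 0 := by
  rw [← h'.proj_mul, ← mul_assoc, hPP, zero_mul]

end

/-- The projections are mutually orthogonal, so multiplication by `P c` recovers the factor `c`
continuously. This gives both multiplicativity and the topological embedding. -/
theorem pi {κ : Type*} [Fintype κ] [DecidableEq κ] {F : κ → Type*} [∀ c, Group (F c)]
    [∀ c, TopologicalSpace (F c)] {P : κ → Matrix I I ℝ} {f : ∀ c, F c → Matrix I I ℝ}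
    (h : ∀ c, IsCorner 𝒞 (P c) (f c)) (hP : ∀ c c', c ≠ c' → P c * P c' = 0) :
    IsCorner 𝒞 (∑ c, P c) (fun a : (∀ c, F c) => ∑ c, f c (a c)) where
  map_one := Finset.sum_congr rfl fun c _ => (h c).map_one
  map_mul a b := by
    rw [Finset.sum_mul]
    refine Finset.sum_congr rfl fun c _ => ?_
    rw [Finset.mul_sum, Finset.sum_eq_single c, Pi.mul_apply, (h c).map_mul]
    · intro c' _ hc
      exact (h c).mul_eq_zero (h c') (hP c c' hc.symm) _ _
    · simp
  transpose a := by
    rw [Matrix.transpose_sum]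
    exact Finset.sum_congr rfl fun c _ => (h c).transpose _
  mem a := 𝒞.sum_mem fun c _ => (h c).mem _
  embedding := by
    have h1 : Continuous fun a : (∀ c, F c) => ∑ c, f c (a c) :=
      continuous_finsetSum _ fun c _ => (h c).embedding.continuous.comp (continuous_apply c)
    have h2 : Continuous fun (Q : Matrix I I ℝ) (c : κ) => P c * Q :=
      continuous_pi fun c => continuous_const.matrix_mul continuous_id
    refine Topology.IsEmbedding.of_comp h1 h2 ?_
    have h3 : (fun (Q : Matrix I I ℝ) (c : κ) => P c * Q) ∘
        (fun a : (∀ c, F c) => ∑ c, f c (a c)) = Pi.map f := by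
      funext a c
      simp only [Function.comp_apply, Pi.map_apply]
      rw [Finset.mul_sum, Finset.sum_eq_single c, (h c).proj_mul]
      · intro c' _ hc
        exact (h c').proj_mul_eq_zero (hP c c' hc.symm) _
      · simp
    rw [h3]
    exact Topology.IsEmbedding.piMap fun c => (h c).embedding
  comm Q hQ := by
    rw [Finset.sum_mul, Finset.mul_sum]
    exact Finset.sum_congr rfl fun c _ => (h c).comm Q hQ
  surj Q hQ h1 h2 := by
    choose a ha using fun c => (h c).surj Q hQ h1 h2
    exact ⟨a, by simp only [ha, Finset.sum_mul]⟩

theorem prod {F F' : Type*} [Group F] [TopologicalSpace F] [Group F'] [TopologicalSpace F']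
    {P P' : Matrix I I ℝ} {f : F → Matrix I I ℝ} {f' : F' → Matrix I I ℝ}
    (h : IsCorner 𝒞 P f) (h' : IsCorner 𝒞 P' f') (hP : P * P' = 0) (hP' : P' * P = 0) :
    IsCorner 𝒞 (P + P') (fun a : F × F' => f a.1 + f' a.2) where
  map_one := by simp [h.map_one, h'.map_one]
  map_mul a b := by
    rw [Prod.fst_mul, Prod.snd_mul, h.map_mul, h'.map_mul, add_mul, mul_add, mul_add,
      h.mul_eq_zero h' hP, h'.mul_eq_zero h hP']
    abel
  transpose a := by rw [Matrix.transpose_add, h.transpose, h'.transpose]; rfl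
  mem a := 𝒞.add_mem (h.mem _) (h'.mem _)
  embedding := by
    have h1 : Continuous fun a : F × F' => f a.1 + f' a.2 :=
      (h.embedding.continuous.comp continuous_fst).add (h'.embedding.continuous.comp continuous_snd)
    have h2 : Continuous fun (Q : Matrix I I ℝ) => (P * Q, P' * Q) :=
      (continuous_const.matrix_mul continuous_id).prodMk (continuous_const.matrix_mul continuous_id)
    refine Topology.IsEmbedding.of_comp h1 h2 ?_
    have h3 : (fun (Q : Matrix I I ℝ) => (P * Q, P' * Q)) ∘
        (fun a : F × F' => f a.1 + f' a.2) = Prod.map f f' := by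
      funext a
      simp only [Function.comp_apply, Prod.map_apply']
      rw [mul_add, mul_add, h.proj_mul, h'.proj_mul, h.proj_mul_eq_zero hP',
        h'.proj_mul_eq_zero hP, add_zero, zero_add]
    rw [h3]
    exact h.embedding.prodMap h'.embedding
  comm Q hQ := by rw [add_mul, mul_add, h.comm Q hQ, h'.comm Q hQ]
  surj Q hQ h1 h2 := by
    obtain ⟨a, ha⟩ := h.surj Q hQ h1 h2
    obtain ⟨b, hb⟩ := h'.surj Q hQ h1 h2
    exact ⟨(a, b), by simp only [ha, hb, add_mul]⟩

end IsCorner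

end Corner

/-! ### The corner of the commutant cut out by one isotypic component -/

section TypeCorner

variable {n : ℕ} {A : Subalgebra ℝ (Matrix (Fin n) (Fin n) ℝ)}

/-- The commutant of `A`, acting on `N` copies of its defining module. -/
def flavorCommutant (N : ℕ) (A : Subalgebra ℝ (Matrix (Fin n) (Fin n) ℝ)) :
    Subalgebra ℝ (Matrix (Fin N × Fin n) (Fin N × Fin n) ℝ) :=
  Subalgebra.centralizer ℝ ((fun X => (1 : Matrix (Fin N) (Fin N) ℝ) ⊗ₖ X) '' (A : Set _))

theorem mem_flavorCommutant {N : ℕ} {Q : Matrix (Fin N × Fin n) (Fin N × Fin n) ℝ} :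
    Q ∈ flavorCommutant N A ↔
      ∀ X ∈ A, ((1 : Matrix (Fin N) (Fin N) ℝ) ⊗ₖ X) * Q = Q * ((1 : Matrix (Fin N) (Fin N) ℝ) ⊗ₖ X) := by
  rw [flavorCommutant, Subalgebra.mem_centralizer_iff]
  simp

/-- Reduces commutation on `N` flavors to commutation of each flavor block, so that statements about
one copy of the module apply. -/
theorem one_kronecker_comm_iff {N d e : ℕ} {X : Matrix (Fin e) (Fin e) ℝ} {Y : Matrix (Fin d) (Fin d) ℝ}
    {Q : Matrix (Fin N × Fin e) (Fin N × Fin d) ℝ} :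
    ((1 : Matrix (Fin N) (Fin N) ℝ) ⊗ₖ X) * Q = Q * ((1 : Matrix (Fin N) (Fin N) ℝ) ⊗ₖ Y) ↔
      ∀ a b, X * (Matrix.of fun x y => Q (a, x) (b, y)) =
        (Matrix.of fun x y => Q (a, x) (b, y)) * Y := by
  have h1 : ∀ a b x y, (((1 : Matrix (Fin N) (Fin N) ℝ) ⊗ₖ X) * Q) (a, x) (b, y) =
      (X * (Matrix.of fun x y => Q (a, x) (b, y))) x y := by
    intro a b x y
    rw [Matrix.mul_apply, Fintype.sum_prod_type, Finset.sum_eq_single a]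
    · simp [Matrix.mul_apply]
    · intro c _ hc; simp [Ne.symm hc]
    · simp
  have h2 : ∀ a b x y, (Q * ((1 : Matrix (Fin N) (Fin N) ℝ) ⊗ₖ Y)) (a, x) (b, y) =
      ((Matrix.of fun x y => Q (a, x) (b, y)) * Y) x y := by
    intro a b x y
    rw [Matrix.mul_apply, Fintype.sum_prod_type, Finset.sum_eq_single b]
    · simp [Matrix.mul_apply]
    · intro c _ hc; simp [hc]
    · simp
  constructor
  · intro h a b
    ext x y
    rw [← h1, ← h2, h]
  · intro h
    ext ⟨a, x⟩ ⟨b, y⟩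
    rw [h1, h2, h]

theorem IsProj.kronecker_commute (hA : ∀ X ∈ A, Xᵀ ∈ A) {c : Submodule A (Fin n → ℝ)}
    (hc : c ∈ isotypicComponents A (Fin n → ℝ)) {P : Matrix (Fin n) (Fin n) ℝ} (hP : IsProj P c)
    {N : ℕ} {Q : Matrix (Fin N × Fin n) (Fin N × Fin n) ℝ} (hQ : Q ∈ flavorCommutant N A) :
    ((1 : Matrix (Fin N) (Fin N) ℝ) ⊗ₖ P) * Q = Q * ((1 : Matrix (Fin N) (Fin N) ℝ) ⊗ₖ P) := by
  rw [one_kronecker_comm_iff]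
  intro a b
  exact hP.commute_of_commute hA hc fun X hX =>
    (one_kronecker_comm_iff.1 (mem_flavorCommutant.1 hQ X hX) a b).symm

variable {D : Type} [Ring D] [Algebra ℝ D]

/-- The real matrix of a matrix over `D` in the representation `θ` of `D`. -/
noncomputable def realify {d : ℕ} (k : ℕ) (θ : D →ₐ[ℝ] Matrix (Fin d) (Fin d) ℝ) :
    Matrix (Fin k) (Fin k) D →ₐ[ℝ] Matrix (Fin k × Fin d) (Fin k × Fin d) ℝ :=
  (Matrix.compAlgEquiv (Fin k) (Fin d) ℝ ℝ).toAlgHom.comp θ.mapMatrix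

theorem realify_apply {d k : ℕ} (θ : D →ₐ[ℝ] Matrix (Fin d) (Fin d) ℝ)
    (X : Matrix (Fin k) (Fin k) D) (p q : Fin k × Fin d) :
    realify k θ X p q = θ (X p.1 q.1) p.2 q.2 := rfl

theorem realify_injective {d k : ℕ} {θ : D →ₐ[ℝ] Matrix (Fin d) (Fin d) ℝ}
    (hθ : Function.Injective θ) : Function.Injective (realify k θ) := by
  intro X Y h
  ext i j
  apply hθ
  ext x y
  exact congrFun (congrFun h (i, x)) (j, y)

/-- The frame `V` presents `N` flavors of `c` as `N m` copies of `S`, and a matrix over `D` acts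
there through the representation `θ` of `D` as endomorphisms of `S`. By Schur's lemma every element
of the corner arises in this way, and unitarity over `D` matches orthogonality because `θ` turns
`star` into transposition. -/
theorem exists_isCorner [StarRing D] [TopologicalSpace D] [IsTopologicalAddGroup D] [ContinuousSMul ℝ D]
    [T2Space D] [FiniteDimensional ℝ D] (hD : IsImaginarySpan D) (hA : ∀ X ∈ A, Xᵀ ∈ A)
    {c : Submodule A (Fin n → ℝ)} (hc : c ∈ isotypicComponents A (Fin n → ℝ))
    (h : ∃ S : Submodule A (Fin n → ℝ), S ≤ c ∧ IsSimpleModule A S ∧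
      Nonempty (Module.End A S ≃ₐ[ℝ] D)) (N : ℕ) {P : Matrix (Fin n) (Fin n) ℝ} (hP : IsProj P c) :
    ∃ f : unitary (Matrix (Fin (N * (Module.length A c).toNat))
        (Fin (N * (Module.length A c).toNat)) D) → Matrix (Fin N × Fin n) (Fin N × Fin n) ℝ,
      IsCorner (flavorCommutant N A) ((1 : Matrix (Fin N) (Fin N) ℝ) ⊗ₖ P) f := by
  obtain ⟨S, hSc, hS, ⟨e⟩⟩ := h
  obtain ⟨d, B, hB⟩ := exists_frame S
  obtain ⟨J, hJ⟩ := exists_isIsotypicFrame hA hB hS hc hSc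
  have : Nonempty (Fin d) := hB.exists_pos hS
  generalize (Module.length A c).toNat = m at J hJ
  let θ : D →ₐ[ℝ] Matrix (Fin d) (Fin d) ℝ := (endMatrixHom hB).comp e.symm.toAlgHom
  have hθ : Function.Injective θ := (endMatrixHom_injective hB).comp e.symm.injective
  have hrange : ∀ Z, Z ∈ θ.range ↔ ∀ X ∈ A, Z * compress B X = compress B X * Z := by
    intro Z
    rw [← mem_range_endMatrixHom hA hB]
    constructor
    · rintro ⟨q, rfl⟩; exact ⟨e.symm q, rfl⟩
    · rintro ⟨g, rfl⟩; exact ⟨e g, by simp [θ]⟩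
  have hct : ∀ X, (compress B X)ᵀ = compress B Xᵀ := by
    intro X
    simp only [compress, Matrix.transpose_mul, Matrix.transpose_transpose, Matrix.mul_assoc]
  have hT : ∀ Z ∈ θ.range, Zᵀ ∈ θ.range := by
    intro Z hZ
    rw [hrange] at hZ ⊢
    intro X hX
    have := congrArg Matrix.transpose (hZ _ (hA X hX))
    rw [Matrix.transpose_mul Z, Matrix.transpose_mul _ Z, hct, Matrix.transpose_transpose] at this
    exact this.symm
  have hstar := hD.map_star θ hT fun Z hZ hsym => hB.eq_smul_one hS hsym ((hrange Z).1 hZ)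
  set k := N * m with hk
  set V := assemble N J with hV
  have hVV : Vᵀ * V = 1 := assemble_transpose_mul_assemble hJ.orth
  have hVVt : V * Vᵀ = (1 : Matrix (Fin N) (Fin N) ℝ) ⊗ₖ P := by
    rw [hV, assemble_mul_assemble_transpose, hJ.isProj.unique hP]
  have hXV : ∀ X ∈ A, ((1 : Matrix (Fin N) (Fin N) ℝ) ⊗ₖ X) * V =
      V * ((1 : Matrix (Fin k) (Fin k) ℝ) ⊗ₖ compress B X) := by
    intro X hX
    rw [hV, one_kronecker_mul_assemble, assemble_mul_one_kronecker]
    congr 1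
    funext i
    exact hJ.mul_eq i X hX
  have hVX : ∀ X ∈ A, Vᵀ * ((1 : Matrix (Fin N) (Fin N) ℝ) ⊗ₖ X) =
      ((1 : Matrix (Fin k) (Fin k) ℝ) ⊗ₖ compress B X) * Vᵀ := by
    intro X hX
    have := congrArg Matrix.transpose (hXV _ (hA X hX))
    rw [Matrix.transpose_mul, Matrix.transpose_mul, ← Matrix.kroneckerMap_transpose,
      ← Matrix.kroneckerMap_transpose, hct, Matrix.transpose_transpose, Matrix.transpose_one,
      Matrix.transpose_one] at this
    exact this
  have hstar' : ∀ X : Matrix (Fin k) (Fin k) D, realify k θ (star X) = (realify k θ X)ᵀ := by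
    intro X
    ext p q
    rw [Matrix.transpose_apply, realify_apply, realify_apply, Matrix.star_apply, hstar]
    rfl
  let F : Matrix (Fin k) (Fin k) D → Matrix (Fin N × Fin n) (Fin N × Fin n) ℝ :=
    fun X => V * realify k θ X * Vᵀ
  have hFc : Continuous F := by
    refine (continuous_const.matrix_mul ?_).matrix_mul continuous_const
    refine continuous_matrix fun p q => ?_
    have h1 : Continuous θ := LinearMap.continuous_of_finiteDimensional θ.toLinearMap
    have h2 : Continuous fun X : Matrix (Fin k) (Fin k) D => θ (X p.1 q.1) :=
      h1.comp (continuous_id.matrix_elem _ _)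
    exact h2.matrix_elem _ _
  -- A linear left inverse of `θ`, continuous by finite dimensionality, is applied block by block to
  -- invert `F` on its image. This makes `F` a topological embedding.
  obtain ⟨g, hg⟩ := LinearMap.exists_leftInverse_of_injective θ.toLinearMap
    (LinearMap.ker_eq_bot.2 hθ)
  have hgc : Continuous g := LinearMap.continuous_of_finiteDimensional g
  let G : Matrix (Fin N × Fin n) (Fin N × Fin n) ℝ → Matrix (Fin k) (Fin k) D :=
    fun Y => Matrix.of fun i j => g (Matrix.of fun x y => (Vᵀ * Y * V) (i, x) (j, y))
  have hGc : Continuous G := by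
    refine continuous_matrix fun i j => hgc.comp ?_
    have h1 : Continuous fun Y : Matrix (Fin N × Fin n) (Fin N × Fin n) ℝ => Vᵀ * Y * V :=
      (continuous_const.matrix_mul continuous_id).matrix_mul continuous_const
    exact continuous_matrix fun x y => h1.matrix_elem _ _
  have hVFV : ∀ X, Vᵀ * F X * V = realify k θ X := by
    intro X
    simp only [F]
    rw [Matrix.mul_assoc, Matrix.mul_assoc, hVV, Matrix.mul_one, ← Matrix.mul_assoc, hVV,
      Matrix.one_mul]
  have hGF : Function.LeftInverse G F := by
    intro X
    ext i j
    simp only [G, hVFV]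
    exact LinearMap.congr_fun hg (X i j)
  have hFmul : ∀ X Y, F (X * Y) = F X * F Y := by
    intro X Y
    simp only [F]
    rw [map_mul]
    simp only [Matrix.mul_assoc]
    rw [← Matrix.mul_assoc Vᵀ, hVV, Matrix.one_mul]
  have hreal_mem : ∀ (X : Matrix (Fin k) (Fin k) D) (Y : Matrix (Fin n) (Fin n) ℝ), Y ∈ A →
      ((1 : Matrix (Fin k) (Fin k) ℝ) ⊗ₖ compress B Y) * realify k θ X =
        realify k θ X * ((1 : Matrix (Fin k) (Fin k) ℝ) ⊗ₖ compress B Y) := by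
    intro X Y hY
    rw [one_kronecker_comm_iff]
    intro a b
    exact ((hrange (θ (X a b))).1 ⟨_, rfl⟩ Y hY).symm
  refine ⟨fun X => F X.1, ?_, ?_, ?_, ?_, ?_, ?_, ?_⟩
  · change F 1 = _
    simp only [F]
    rw [map_one, Matrix.mul_one, hVVt]
  · intro X Y
    exact hFmul X.1 Y.1
  · intro X
    change (V * realify k θ X.1 * Vᵀ)ᵀ = V * realify k θ (star X.1) * Vᵀ
    rw [hstar', Matrix.transpose_mul, Matrix.transpose_mul, Matrix.transpose_transpose,
      Matrix.mul_assoc]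
  · intro X
    rw [mem_flavorCommutant]
    intro Y hY
    simp only [F]
    rw [Matrix.mul_assoc _ _ (_ ⊗ₖ _), hVX Y hY, ← Matrix.mul_assoc, ← Matrix.mul_assoc, hXV Y hY,
      Matrix.mul_assoc V, hreal_mem _ Y hY, Matrix.mul_assoc, Matrix.mul_assoc, Matrix.mul_assoc]
  · exact (hGF.isEmbedding hGc hFc).comp Topology.IsEmbedding.subtypeVal
  · intro Q hQ
    exact hP.kronecker_commute hA hc hQ
  · intro Q hQ h1 h2
    have hPQ := hP.kronecker_commute hA hc hQ
    rw [← hVVt] at hPQ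
    have hZ : ∀ i j, (Matrix.of fun x y => (Vᵀ * Q * V) (i, x) (j, y)) ∈ θ.range := by
      intro i j
      rw [hrange]
      intro X hX
      have h3 : ((1 : Matrix (Fin k) (Fin k) ℝ) ⊗ₖ compress B X) * (Vᵀ * Q * V) =
          (Vᵀ * Q * V) * ((1 : Matrix (Fin k) (Fin k) ℝ) ⊗ₖ compress B X) := by
        rw [Matrix.mul_assoc (Vᵀ * Q), ← hXV X hX, ← Matrix.mul_assoc, ← Matrix.mul_assoc,
          ← hVX X hX, Matrix.mul_assoc Vᵀ, mem_flavorCommutant.1 hQ X hX]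
        simp only [Matrix.mul_assoc]
      exact (one_kronecker_comm_iff.1 h3 i j).symm
    choose x hx using hZ
    have hX : realify k θ (Matrix.of x) = Vᵀ * Q * V := by
      ext ⟨i, y⟩ ⟨j, z⟩
      exact congrFun (congrFun (hx i j) y) z
    -- Compression by `V` is multiplicative here because `Q` commutes with the projection `V * Vᵀ`.
    -- So the compression of `Q` inherits orthogonality.
    have hu : ∀ Q' : Matrix (Fin N × Fin n) (Fin N × Fin n) ℝ, Q' * Q = 1 →
        (Vᵀ * Q' * V) * (Vᵀ * Q * V) = 1 := by
      intro Q' hQ'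
      rw [Matrix.mul_assoc (Vᵀ * Q'), Matrix.mul_assoc Vᵀ Q V, ← Matrix.mul_assoc V,
        ← Matrix.mul_assoc (V * Vᵀ), hPQ]
      rw [Matrix.mul_assoc Q, Matrix.mul_assoc V, hVV, Matrix.mul_one, ← Matrix.mul_assoc,
        Matrix.mul_assoc Vᵀ, hQ', Matrix.mul_one, hVV]
    have hl : realify k θ (star (Matrix.of x) * Matrix.of x) = realify k θ 1 := by
      rw [map_mul, hstar', hX, map_one, ← hu Qᵀ h1]
      congr 1
      rw [Matrix.transpose_mul, Matrix.transpose_mul, Matrix.transpose_transpose, Matrix.mul_assoc]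
    have hr : realify k θ (Matrix.of x * star (Matrix.of x)) = realify k θ 1 := by
      have h4 : realify k θ (star (Matrix.of x)) * realify k θ (Matrix.of x) = 1 := by
        rw [← map_mul, hl, map_one]
      rw [map_mul, map_one]
      exact mul_eq_one_comm.1 h4
    refine ⟨⟨Matrix.of x, ?_⟩, ?_⟩
    · rw [Unitary.mem_iff]
      exact ⟨realify_injective hθ hl, realify_injective hθ hr⟩
    · simp only [F]
      rw [hX, ← hVVt]
      calc V * (Vᵀ * Q * V) * Vᵀ = V * Vᵀ * (Q * (V * Vᵀ)) := by simp only [Matrix.mul_assoc]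
        _ = V * Vᵀ * Q := by
          rw [← hPQ, ← Matrix.mul_assoc, Matrix.mul_assoc V, ← Matrix.mul_assoc Vᵀ, hVV,
            Matrix.one_mul]

end TypeCorner
end GNY

/-! ### The flavor group as the orthogonal part of the commutant -/

namespace GNY
open Matrix
open scoped Kronecker

section Flavor

variable {N M : ℕ} {R : Yukawa M}

theorem transpose_mem_closureAlgebra : ∀ X ∈ closureAlgebra R, Xᵀ ∈ closureAlgebra R := by
  intro X hX
  have h : star X ∈ StarAlgebra.adjoin ℝ (Set.range R) := star_mem hX
  rwa [Matrix.star_eq_conjTranspose, Matrix.conjTranspose_eq_transpose_of_trivial] at h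

theorem mem_closureAlgebra (m : Fin M) : R m ∈ closureAlgebra R :=
  StarAlgebra.subset_adjoin ℝ _ ⟨m, rfl⟩

/-- The generators are symmetric, so a matrix commuting with them also commutes with their adjoints,
and its star-centralizer contains the whole closure algebra. -/
theorem commute_closureAlgebra (hR : ∀ m, (R m).IsSymm) {Z : Matrix (Fin 4) (Fin 4) ℝ}
    (hZ : ∀ m, Z * R m = R m * Z) : ∀ X ∈ closureAlgebra R, Z * X = X * Z := by
  intro X hX
  have hX' : X ∈ StarAlgebra.adjoin ℝ (Set.range R) := hX
  have h : StarAlgebra.adjoin ℝ (Set.range R) ≤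
      StarSubalgebra.centralizer ℝ {Z} := by
    refine StarAlgebra.adjoin_le ?_
    rintro _ ⟨m, rfl⟩
    rw [SetLike.mem_coe, StarSubalgebra.mem_centralizer_iff]
    rintro z rfl
    refine ⟨hZ m, ?_⟩
    have := congrArg Matrix.transpose (hZ m)
    rw [Matrix.transpose_mul, Matrix.transpose_mul, hR m] at this
    rw [Matrix.star_eq_conjTranspose, Matrix.conjTranspose_eq_transpose_of_trivial, this]
  have := (StarSubalgebra.mem_centralizer_iff ℝ).1 (h hX') Z rfl
  exact this.1

theorem mem_flavorCommutant_iff (hR : ∀ m, (R m).IsSymm)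
    {Q : Matrix (Fin N × Fin 4) (Fin N × Fin 4) ℝ} :
    Q ∈ flavorCommutant N (closureAlgebra R) ↔ ∀ m,
      ((1 : Matrix (Fin N) (Fin N) ℝ) ⊗ₖ R m) * Q = Q * ((1 : Matrix (Fin N) (Fin N) ℝ) ⊗ₖ R m) := by
  rw [mem_flavorCommutant]
  constructor
  · intro h m
    exact h _ (mem_closureAlgebra m)
  · intro h X hX
    rw [one_kronecker_comm_iff]
    intro a b
    exact (commute_closureAlgebra hR (fun m => (one_kronecker_comm_iff.1 (h m) a b).symm) X hX).symm

/-- Two simple submodules of one isotypic component are isomorphic, so their endomorphism algebras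
have the same dimension. The dimensions 1, 2, 4 then make the three types mutually exclusive. -/
theorem HasEndType.unique {c : SimpleType R} {D D' : Type} [Ring D] [Algebra ℝ D] [Ring D']
    [Algebra ℝ D'] (h : HasEndType c D) (h' : HasEndType c D') :
    Module.finrank ℝ D = Module.finrank ℝ D' := by
  obtain ⟨S, hS, hS', ⟨e⟩⟩ := h
  obtain ⟨T, hT, hT', ⟨e'⟩⟩ := h'
  obtain ⟨i⟩ := isIsotypicOfType_submodule_iff.mp
    ((isIsotypic_submodule_iff.1 (IsIsotypic.isotypicComponents c.2)) T hT) S hS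
  have h1 := (i.conjAlgEquiv ℝ).toLinearEquiv.finrank_eq
  rw [← e.toLinearEquiv.finrank_eq, ← e'.toLinearEquiv.finrank_eq, h1]

theorem hasEndType_cases (c : SimpleType R) :
    HasEndType c ℝ ∨ HasEndType c ℂ ∨ HasEndType c ℍ[ℝ] := by
  obtain ⟨S, hSc, hS⟩ := exists_simple_le (bot_lt_isotypicComponents c.2).ne'
  obtain ⟨d, B, hB⟩ := exists_frame S
  have := hB.exists_pos hS
  have hA := transpose_mem_closureAlgebra (R := R)
  have hmem := mem_range_endMatrixHom hA hB
  have hct : ∀ X, (compress B X)ᵀ = compress B Xᵀ := by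
    intro X
    simp only [compress, Matrix.transpose_mul, Matrix.transpose_transpose, Matrix.mul_assoc]
  have hT : ∀ Z ∈ (endMatrixHom hB).range, Zᵀ ∈ (endMatrixHom hB).range := by
    intro Z hZ
    rw [hmem] at hZ ⊢
    intro X hX
    have := congrArg Matrix.transpose (hZ _ (hA X hX))
    rw [Matrix.transpose_mul Z, Matrix.transpose_mul _ Z, hct, Matrix.transpose_transpose] at this
    exact this.symm
  have e := AlgEquiv.ofInjective _ (endMatrixHom_injective hB)
  rcases frobenius hT (fun Z hZ hsym => hB.eq_smul_one hS hsym ((hmem Z).1 hZ)) with h | h | h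
  · exact Or.inl ⟨S, hSc, hS, h.map e.trans⟩
  · exact Or.inr (Or.inl ⟨S, hSc, hS, h.map e.trans⟩)
  · exact Or.inr (Or.inr ⟨S, hSc, hS, h.map e.trans⟩)

theorem kronecker_proj_mul_eq_zero {c c' : SimpleType R} (hne : c ≠ c')
    {P P' : Matrix (Fin 4) (Fin 4) ℝ} (hP : IsProj P c.1) (hP' : IsProj P' c'.1) :
    ((1 : Matrix (Fin N) (Fin N) ℝ) ⊗ₖ P) * ((1 : Matrix (Fin N) (Fin N) ℝ) ⊗ₖ P') = 0 := by
  rw [← Matrix.mul_kronecker_mul, hP.mul_eq_zero transpose_mem_closureAlgebra c.2 c'.2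
    (fun h => hne (Subtype.ext h)) hP', Matrix.kronecker_zero]

theorem exists_typeCorner {D : Type} [Ring D] [StarRing D] [Algebra ℝ D] [TopologicalSpace D]
    [IsTopologicalAddGroup D] [ContinuousSMul ℝ D]
    [T2Space D] [FiniteDimensional ℝ D] (hD : IsImaginarySpan D)
    [Fintype {c : SimpleType R // HasEndType c D}]
    (P : SimpleType R → Matrix (Fin 4) (Fin 4) ℝ) (hP : ∀ c, IsProj (P c) c.1) :
    ∃ f : ((c : {c : SimpleType R // HasEndType c D}) →
        unitary (Matrix (Fin (N * multiplicity c.1)) (Fin (N * multiplicity c.1)) D)) →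
        Matrix (Fin N × Fin 4) (Fin N × Fin 4) ℝ,
      IsCorner (flavorCommutant N (closureAlgebra R))
        (∑ c : {c : SimpleType R // HasEndType c D}, (1 : Matrix (Fin N) (Fin N) ℝ) ⊗ₖ P c.1) f := by
  classical
  choose f hf using fun c : {c : SimpleType R // HasEndType c D} =>
    exists_isCorner hD transpose_mem_closureAlgebra c.1.2 c.2 N (hP c.1)
  exact ⟨_, IsCorner.pi hf fun c c' hne =>
    kronecker_proj_mul_eq_zero (fun h => hne (Subtype.ext h)) (hP c.1) (hP c'.1)⟩

theorem sum_subtype_mul_sum_subtype_eq_zero {D D' : Type} [Ring D] [Algebra ℝ D] [Ring D']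
    [Algebra ℝ D'] (hDD : Module.finrank ℝ D ≠ Module.finrank ℝ D')
    [Fintype {c : SimpleType R // HasEndType c D}] [Fintype {c : SimpleType R // HasEndType c D'}]
    (P : SimpleType R → Matrix (Fin 4) (Fin 4) ℝ) (hP : ∀ c, IsProj (P c) c.1) :
    (∑ c : {c : SimpleType R // HasEndType c D}, (1 : Matrix (Fin N) (Fin N) ℝ) ⊗ₖ P c.1) *
      (∑ c : {c : SimpleType R // HasEndType c D'}, (1 : Matrix (Fin N) (Fin N) ℝ) ⊗ₖ P c.1) = 0 := by
  rw [Finset.sum_mul]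
  refine Finset.sum_eq_zero fun c _ => ?_
  rw [Finset.mul_sum]
  refine Finset.sum_eq_zero fun c' _ => ?_
  refine kronecker_proj_mul_eq_zero (fun h => hDD ?_) (hP c.1) (hP c'.1)
  have h2 := c'.2
  rw [← h] at h2
  exact HasEndType.unique c.2 h2

/-- The flavor group is the group of orthogonal elements of the commutant. -/
theorem exists_flavorCorner (N : ℕ) (R : Yukawa M) :
    ∃ f : FlavorGroup N R → Matrix (Fin N × Fin 4) (Fin N × Fin 4) ℝ,
      IsCorner (flavorCommutant N (closureAlgebra R)) 1 f := by
  classical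
  have : Fintype (SimpleType R) := Fintype.ofFinite _
  choose P hP using fun c : SimpleType R => exists_isProj c.1
  obtain ⟨f₁, h₁⟩ := exists_typeCorner (N := N) isImaginarySpan_real P hP
  obtain ⟨f₂, h₂⟩ := exists_typeCorner (N := N) isImaginarySpan_complex P hP
  obtain ⟨f₃, h₃⟩ := exists_typeCorner (N := N) isImaginarySpan_quaternion P hP
  have d1 : Module.finrank ℝ ℝ = 1 := Module.finrank_self ℝ
  have d2 : Module.finrank ℝ ℂ = 2 := Complex.finrank_real_complex
  have d4 : Module.finrank ℝ ℍ[ℝ] = 4 := Quaternion.finrank_eq_four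
  have n12 : Module.finrank ℝ ℝ ≠ Module.finrank ℝ ℂ := by omega
  have n13 : Module.finrank ℝ ℝ ≠ Module.finrank ℝ ℍ[ℝ] := by omega
  have n23 : Module.finrank ℝ ℂ ≠ Module.finrank ℝ ℍ[ℝ] := by omega
  have h := h₁.prod (h₂.prod h₃ (sum_subtype_mul_sum_subtype_eq_zero n23 P hP)
    (sum_subtype_mul_sum_subtype_eq_zero n23.symm P hP))
    (by rw [mul_add, sum_subtype_mul_sum_subtype_eq_zero n12 P hP,
      sum_subtype_mul_sum_subtype_eq_zero n13 P hP, add_zero])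
    (by rw [add_mul, sum_subtype_mul_sum_subtype_eq_zero n12.symm P hP,
      sum_subtype_mul_sum_subtype_eq_zero n13.symm P hP, add_zero])
  have hsum : (∑ c : {c : SimpleType R // HasEndType c ℝ}, (1 : Matrix (Fin N) (Fin N) ℝ) ⊗ₖ P c.1) +
      ((∑ c : {c : SimpleType R // HasEndType c ℂ}, (1 : Matrix (Fin N) (Fin N) ℝ) ⊗ₖ P c.1) +
      (∑ c : {c : SimpleType R // HasEndType c ℍ[ℝ]}, (1 : Matrix (Fin N) (Fin N) ℝ) ⊗ₖ P c.1)) = 1 := by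
    have hsub : ∀ p : SimpleType R → Prop, ∑ c : {c : SimpleType R // p c},
        (1 : Matrix (Fin N) (Fin N) ℝ) ⊗ₖ P c.1 =
          ∑ c, if p c then (1 : Matrix (Fin N) (Fin N) ℝ) ⊗ₖ P c else 0 := by
      intro p
      rw [← Finset.sum_filter]
      exact (Finset.sum_subtype (Finset.univ.filter p) (fun c => by simp)
        (fun c => (1 : Matrix (Fin N) (Fin N) ℝ) ⊗ₖ P c)).symm
    rw [hsub, hsub, hsub, ← Finset.sum_add_distrib, ← Finset.sum_add_distrib]
    have h4 : (1 : Matrix (Fin N × Fin 4) (Fin N × Fin 4) ℝ) =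
        ∑ c, (1 : Matrix (Fin N) (Fin N) ℝ) ⊗ₖ P c := by
      rw [← Matrix.one_kronecker_one, ← sum_isProj_eq_one transpose_mem_closureAlgebra P hP]
      ext p q
      simp [Matrix.sum_apply, Finset.mul_sum]
    rw [h4]
    refine Finset.sum_congr rfl fun c _ => ?_
    -- Each component has exactly one of the three types, so its projection is counted exactly once.
    rcases hasEndType_cases c with hc | hc | hc
    · have h5 : ¬ HasEndType c ℂ := fun h' => n12 (hc.unique h')
      have h6 : ¬ HasEndType c ℍ[ℝ] := fun h' => n13 (hc.unique h')
      simp [hc, h5, h6]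
    · have h5 : ¬ HasEndType c ℝ := fun h' => n12 (h'.unique hc)
      have h6 : ¬ HasEndType c ℍ[ℝ] := fun h' => n23 (hc.unique h')
      simp [hc, h5, h6]
    · have h5 : ¬ HasEndType c ℝ := fun h' => n13 (h'.unique hc)
      have h6 : ¬ HasEndType c ℂ := fun h' => n23 (h'.unique hc)
      simp [hc, h5, h6]
  rw [hsum] at h
  exact ⟨_, h⟩

end Flavor
end GNY

/-! ### Splitting extensions of compact groups -/

namespace GNY
open Matrix
open scoped Kronecker

section Extension

/-- A continuous surjection from a compact to a Hausdorff space is a quotient map, and the finite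
kernel is discrete; the quotient by a discrete subgroup is a covering. -/
theorem isDoubleCover_of_compact {A B : Type} [Group A] [Group B] [TopologicalSpace A]
    [TopologicalSpace B] [IsTopologicalGroup A] [CompactSpace A] [T2Space A] [T2Space B]
    (f : A →* B) (hc : Continuous f) (hs : Function.Surjective f) (hk : Nat.card f.ker = 2) :
    IsDoubleCover f := by
  refine ⟨?_, hs, hk⟩
  have hq := Topology.IsQuotientMap.of_surjective_continuous hs hc
  have : Finite f.ker := Nat.finite_of_card_ne_zero (by omega)
  have hd : IsDiscrete (f.ker : Set A) := by
    constructor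
    change DiscreteTopology f.ker
    infer_instance
  exact (Topology.IsQuotientMap.isQuotientCoveringMap_of_isDiscrete_ker_monoidHom hq hd).isCoveringMap

variable {F G K L : Type} [Group F] [Group G] [Group K] [Group L]

/-- The homomorphism from a semidirect product to an extension `G` of `K`. -/
def extensionHom (j : F →* G) (s : L →* G) (φ : L →* MulAut F)
    (hφ : ∀ l a, j (φ l a) = s l * j a * (s l)⁻¹) : F ⋊[φ] L →* G :=
  SemidirectProduct.lift j s fun l => by
    ext a
    simp [hφ]

theorem extensionHom_apply (j : F →* G) (s : L →* G) (φ : L →* MulAut F)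
    (hφ : ∀ l a, j (φ l a) = s l * j a * (s l)⁻¹) (x : F ⋊[φ] L) :
    extensionHom j s φ hφ x = j x.left * s x.right := rfl

/-- The action of a group on a normal subgroup, given as the range of an embedding. -/
theorem exists_conj_action (j : F →* G) (hj : Function.Injective j) (q : G →* K)
    (hq : ∀ g, q g = 1 ↔ ∃ a, j a = g) (s : L →* G) :
    ∃ φ : L →* MulAut F, ∀ l a, j (φ l a) = s l * j a * (s l)⁻¹ := by
  have hr : q.ker = j.range := by
    ext g
    rw [MonoidHom.mem_ker, hq, MonoidHom.mem_range]
  have hn : j.range.Normal := hr ▸ inferInstance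
  let ε : F ≃* j.range := MonoidHom.ofInjective hj
  refine ⟨((MulAut.congr ε.symm).toMonoidHom.comp MulAut.conjNormal).comp s, fun l a => ?_⟩
  have h1 : ∀ x : j.range, j (ε.symm x) = x.1 := by
    intro x
    obtain ⟨b, rfl⟩ := ε.surjective x
    rw [MulEquiv.symm_apply_apply]; rfl
  change j (ε.symm (MulAut.conjNormal (s l) (ε a))) = _
  rw [h1, MulAut.conjNormal_apply]
  rfl

variable [TopologicalSpace F] [TopologicalSpace G] [TopologicalSpace L]

theorem semidirect_continuous_left {φ : L →* MulAut F} :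
    Continuous (fun x : F ⋊[φ] L => x.left) :=
  continuous_fst.comp (continuous_induced_dom (f := fun x : F ⋊[φ] L => (x.left, x.right)))

theorem semidirect_continuous_right {φ : L →* MulAut F} :
    Continuous (fun x : F ⋊[φ] L => x.right) :=
  continuous_snd.comp (continuous_induced_dom (f := fun x : F ⋊[φ] L => (x.left, x.right)))

/-- A semidirect product is homeomorphic to the product. -/
def semidirectHomeomorph (φ : L →* MulAut F) : F ⋊[φ] L ≃ₜ F × L where
  toFun x := (x.left, x.right)
  invFun y := ⟨y.1, y.2⟩
  left_inv _ := rfl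
  right_inv _ := rfl
  continuous_toFun := continuous_induced_dom
  continuous_invFun := continuous_induced_rng.2 continuous_id

variable [IsTopologicalGroup G]

theorem continuous_extensionHom {j : F →* G} (hjc : Continuous j) {s : L →* G} (hsc : Continuous s)
    {φ : L →* MulAut F} (hφ : ∀ l a, j (φ l a) = s l * j a * (s l)⁻¹) :
    Continuous (extensionHom j s φ hφ) :=
  (hjc.comp semidirect_continuous_left).mul (hsc.comp semidirect_continuous_right)

/-- A section of an extension of compact groups splits it topologically. -/
theorem exists_split_of_section [T2Space G] [CompactSpace F] [TopologicalSpace K]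
    [CompactSpace K] {j : F →* G}
    (hj : Function.Injective j) (hjc : Continuous j) {q : G →* K}
    (hq : ∀ g, q g = 1 ↔ ∃ a, j a = g) {s : K →* G} (hsc : Continuous s) (hs : ∀ k, q (s k) = k) :
    ∃ (φ : K →* MulAut F) (e : G ≃ₜ* F ⋊[φ] K), ∀ g, (e g).right = q g := by
  obtain ⟨φ, hφ⟩ := exists_conj_action j hj q hq s
  have hqj : ∀ a, q (j a) = 1 := fun a => (hq _).2 ⟨a, rfl⟩
  have hbij : Function.Bijective (extensionHom j s φ hφ) := by
    constructor
    · rw [injective_iff_map_eq_one]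
      intro x hx
      rw [extensionHom_apply] at hx
      have h1 := congrArg q hx
      rw [map_mul, hqj, one_mul, hs, map_one] at h1
      rw [h1, map_one, mul_one] at hx
      have h2 : x.left = 1 := hj (by rw [hx, map_one])
      exact SemidirectProduct.ext h2 h1
    · intro g
      obtain ⟨a, ha⟩ := (hq (g * (s (q g))⁻¹)).1 (by rw [map_mul, map_inv, hs, mul_inv_cancel])
      exact ⟨⟨a, q g⟩, by rw [extensionHom_apply]; simp [ha]⟩
  have : CompactSpace (F ⋊[φ] K) := (semidirectHomeomorph φ).symm.compactSpace
  let e₀ := MulEquiv.ofBijective _ hbij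
  have hc : Continuous e₀ := continuous_extensionHom hjc hsc hφ
  let e : F ⋊[φ] K ≃ₜ* G :=
    { e₀ with
      continuous_toFun := hc
      continuous_invFun := hc.continuous_symm_of_equiv_compact_to_t2 (f := e₀.toEquiv) }
  refine ⟨φ, e.symm, fun g => ?_⟩
  obtain ⟨x, rfl⟩ := e.surjective g
  rw [ContinuousMulEquiv.symm_apply_apply]
  change _ = q (j x.left * s x.right)
  rw [map_mul, hqj, one_mul, hs]

/-- A lift to the extension `G` of `K` of a double cover of `K` splits `G` up to a double cover. -/
theorem exists_doubleCover_of_lift [T2Space G] [CompactSpace F] [T2Space F] [CompactSpace L] [T2Space L]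
    [IsTopologicalGroup L] {j : F →* G}
    (hj : Function.Injective j) (hjc : Continuous j) {q : G →* K}
    (hq : ∀ g, q g = 1 ↔ ∃ a, j a = g) {p : L →* K} (hp : Function.Surjective p)
    (hcard : Nat.card p.ker = 2)
    {s : L →* G} (hsc : Continuous s) (hs : ∀ l, q (s l) = p l)
    (hcent : ∀ l ∈ p.ker, ∀ a, s l * j a = j a * s l) :
    ∃ (α : K →* MulAut F) (π : F ⋊[α.comp p] L →* G), IsDoubleCover π ∧
      (∀ a, π (SemidirectProduct.inl a) = 1 → a = 1) ∧ ∀ x, q (π x) = p x.right := by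
  obtain ⟨φ, hφ⟩ := exists_conj_action j hj q hq s
  have hqj : ∀ a, q (j a) = 1 := fun a => (hq _).2 ⟨a, rfl⟩
  -- The lift of the kernel of `p` commutes with the image of `F`, so conjugation by lifts is an
  -- action of `K` and not merely of `L`.
  have hker : p.ker ≤ φ.ker := by
    intro l hl
    rw [MonoidHom.mem_ker]
    ext a
    apply hj
    rw [hφ, hcent l hl, mul_inv_cancel_right]
    rfl
  let α : K →* MulAut F := p.liftOfSurjective hp ⟨φ, hker⟩
  have hα : ∀ l, α (p l) = φ l := fun l =>
    MonoidHom.liftOfRightInverse_comp_apply p _ (Function.rightInverse_surjInv hp) ⟨φ, hker⟩ l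
  have hφ' : ∀ l a, j ((α.comp p) l a) = s l * j a * (s l)⁻¹ := by
    intro l a
    rw [MonoidHom.comp_apply, hα, hφ]
  let π := extensionHom j s (α.comp p) hφ'
  have hπ : ∀ x, π x = j x.left * s x.right := fun x => rfl
  have hπc : Continuous π := continuous_extensionHom hjc hsc hφ'
  have hqπ : ∀ x, q (π x) = p x.right := by
    intro x
    rw [hπ, map_mul, hqj, one_mul, hs]
  have : CompactSpace (F ⋊[α.comp p] L) := (semidirectHomeomorph (α.comp p)).symm.compactSpace
  have : T2Space (F ⋊[α.comp p] L) := (semidirectHomeomorph (α.comp p)).symm.t2Space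
  -- The product topology on the semidirect product is not known in advance to be a group topology.
  -- Compactness makes the injection into `G × L` a closed embedding, and the group topology is
  -- inherited from there.
  have hemb : Topology.IsEmbedding (π.prod (SemidirectProduct.rightHom (φ := α.comp p))) := by
    refine (Continuous.isClosedEmbedding (hπc.prodMk semidirect_continuous_right) ?_).isEmbedding
    intro x y h
    have h1 : π x = π y := congrArg Prod.fst h
    have h2 : x.right = y.right := congrArg Prod.snd h
    rw [hπ, hπ, h2] at h1
    exact SemidirectProduct.ext (hj (mul_right_cancel h1)) h2
  have : IsTopologicalGroup (F ⋊[α.comp p] L) := hemb.isInducing.topologicalGroup _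
  refine ⟨α, π, isDoubleCover_of_compact π hπc ?_ ?_, ?_, hqπ⟩
  · intro g
    obtain ⟨l, hl⟩ := hp (q g)
    obtain ⟨a, ha⟩ := (hq (g * (s l)⁻¹)).1 (by rw [map_mul, map_inv, hs, hl, mul_inv_cancel])
    exact ⟨⟨a, l⟩, by rw [hπ]; simp [ha]⟩
  -- The kernel of `π` projects bijectively onto that of `p`: if `p l = 1`, then `s l` lies in the
  -- image of `F`, which determines the unique left component cancelling it.
  · rw [← hcard]
    refine Nat.card_eq_of_bijective (f := fun x : π.ker => (⟨x.1.right, ?_⟩ : p.ker)) ⟨?_, ?_⟩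
    · have h1 : π x.1 = 1 := x.2
      rw [MonoidHom.mem_ker, ← hqπ, h1, map_one]
    · intro x y h
      have h2 : x.1.right = y.1.right := congrArg Subtype.val h
      have hx : π x.1 = 1 := x.2
      have hy : π y.1 = 1 := y.2
      rw [hπ] at hx hy
      rw [h2, ← hy] at hx
      exact Subtype.ext (SemidirectProduct.ext (hj (mul_right_cancel hx)) h2)
    · rintro ⟨l, hl⟩
      obtain ⟨a, ha⟩ := (hq (s l)⁻¹).1 (by rw [map_inv, hs, hl, inv_one])
      exact ⟨⟨⟨a, l⟩, by rw [MonoidHom.mem_ker, hπ]; simp [ha]⟩, rfl⟩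
  · intro a ha
    have h1 : j a * s 1 = 1 := ha
    rw [map_one, mul_one] at h1
    exact hj (by rw [h1, map_one])

end Extension
end GNY

/-! ### The symmetry group as an extension of its scalar part -/

namespace GNY
open Matrix
open scoped Kronecker

section Orthogonal

variable {ι κ : Type} [Fintype ι] [DecidableEq ι] [Fintype κ] [DecidableEq κ]

theorem O.transpose_mul_self (Q : O ι) : Q.1ᵀ * Q.1 = 1 := by
  exact (mem_orthogonalGroup_iff' ι ℝ).1 Q.2

theorem O.mul_transpose_self (Q : O ι) : Q.1 * Q.1ᵀ = 1 :=
  mul_eq_one_comm.1 Q.transpose_mul_self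

/-- An orthogonal matrix as an element of the orthogonal group. -/
def O.mk (A : Matrix ι ι ℝ) (h : Aᵀ * A = 1) : O ι :=
  ⟨A, (mem_orthogonalGroup_iff' ι ℝ).2 h⟩

/-- A multiplicative map to orthogonal matrices as a homomorphism. -/
def O.hom {L : Type} [Group L] (f : L → Matrix ι ι ℝ) (h1 : f 1 = 1)
    (hmul : ∀ a b, f (a * b) = f a * f b) (ho : ∀ a, (f a)ᵀ * f a = 1) : L →* O ι where
  toFun a := O.mk (f a) (ho a)
  map_one' := Subtype.ext h1
  map_mul' a b := Subtype.ext (hmul a b)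

@[simp] theorem O.hom_coe {L : Type} [Group L] (f : L → Matrix ι ι ℝ) (h1 : f 1 = 1)
    (hmul : ∀ a b, f (a * b) = f a * f b) (ho : ∀ a, (f a)ᵀ * f a = 1) (a : L) :
    (O.hom f h1 hmul ho a).1 = f a := rfl

theorem O.continuous_hom {L : Type} [Group L] [TopologicalSpace L] {f : L → Matrix ι ι ℝ}
    {h1 : f 1 = 1} {hmul : ∀ a b, f (a * b) = f a * f b} {ho : ∀ a, (f a)ᵀ * f a = 1}
    (hf : Continuous f) : Continuous (O.hom f h1 hmul ho) :=
  hf.subtype_mk _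

variable (ι) in
theorem isCompact_orthogonal : IsCompact {A : Matrix ι ι ℝ | Aᵀ * A = 1} := by
  refine (isCompact_univ_pi fun _ : ι => isCompact_univ_pi fun _ : ι =>
    isCompact_Icc (a := (-1 : ℝ)) (b := 1)).of_isClosed_subset ?_ ?_
  · exact isClosed_eq (by fun_prop) continuous_const
  · intro A hA
    have h := entry_norm_bound_of_unitary (O.mk A hA).2
    simp only [Set.mem_pi]
    intro i _ j _
    exact abs_le.1 (h i j)

instance : CompactSpace (O ι) := by
  have h : ((Matrix.orthogonalGroup ι ℝ : Submonoid (Matrix ι ι ℝ)) : Set (Matrix ι ι ℝ)) =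
      {A | Aᵀ * A = 1} := by
    ext A
    exact ⟨fun hA => O.transpose_mul_self ⟨A, hA⟩, fun hA => (O.mk A hA).2⟩
  exact isCompact_iff_compactSpace.1 (h ▸ isCompact_orthogonal ι)

end Orthogonal

section Comb

variable {ι κ : Type} {M : ℕ}

/-- The mass matrix `∑ φ_m R_m` in the background `φ`. -/
def comb (R : Fin M → Matrix ι ι ℝ) (φ : Fin M → ℝ) : Matrix ι ι ℝ := ∑ m, φ m • R m

theorem comb_apply (R : Fin M → Matrix ι ι ℝ) (φ : Fin M → ℝ) (i j : ι) :
    comb R φ i j = ∑ m, φ m * R m i j := by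
  simp [comb, Matrix.sum_apply]

theorem comb_single [DecidableEq (Fin M)] (R : Fin M → Matrix ι ι ℝ) (m : Fin M) :
    comb R (Pi.single m 1) = R m := by
  rw [comb, Finset.sum_eq_single m] <;> simp +contextual

theorem comb_add (R : Fin M → Matrix ι ι ℝ) (φ φ' : Fin M → ℝ) :
    comb R (φ + φ') = comb R φ + comb R φ' := by
  simp [comb, add_smul, Finset.sum_add_distrib]

theorem comb_smul (R : Fin M → Matrix ι ι ℝ) (c : ℝ) (φ : Fin M → ℝ) :
    comb R (c • φ) = c • comb R φ := by
  simp [comb, mul_smul, Finset.smul_sum]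

/-- The Yukawa matrices of several flavors. -/
def flavors (κ : Type) [DecidableEq κ] (R : Fin M → Matrix ι ι ℝ) :
    Fin M → Matrix (κ × ι) (κ × ι) ℝ :=
  fun m => (1 : Matrix κ κ ℝ) ⊗ₖ R m

theorem comb_flavors [DecidableEq κ] (R : Fin M → Matrix ι ι ℝ) (φ : Fin M → ℝ) :
    comb (flavors κ R) φ = (1 : Matrix κ κ ℝ) ⊗ₖ comb R φ := by
  ext ⟨a, i⟩ ⟨b, j⟩
  simp only [comb_apply, flavors, kroneckerMap_apply, Finset.mul_sum]
  exact Finset.sum_congr rfl fun m _ => by ring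

theorem comb_conj {ι' : Type} [Fintype ι] (R : Fin M → Matrix ι ι ℝ) (A : Matrix ι' ι ℝ)
    (B : Matrix ι ι' ℝ) (φ : Fin M → ℝ) :
    comb (fun m => A * R m * B) φ = A * comb R φ * B := by
  simp [comb, Matrix.mul_sum, Matrix.sum_mul]

/-- Invariance of the Yukawa matrices under a pair of transformations. -/
def Intertwines [Fintype ι] (R : Fin M → Matrix ι ι ℝ) (Q : Matrix ι ι ℝ)
    (Ω : Matrix (Fin M) (Fin M) ℝ) : Prop :=
  ∀ φ, Q * comb R φ * Qᵀ = comb R (Ω *ᵥ φ)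

end Comb

section Form

variable {N M : ℕ} {R : Yukawa M}

theorem yukawaForm_eq (φ : Fin M → ℝ) (ψ χ : Fin N × Fin 4 → ℝ) :
    yukawaForm N R φ ψ χ = ψ ⬝ᵥ (comb (flavors (Fin N) R) φ *ᵥ χ) := by
  rw [comb_flavors]
  simp only [yukawaForm, dotProduct, mulVec, Fintype.sum_prod_type, kroneckerMap_apply, comb_apply,
    Finset.mul_sum, Matrix.one_apply, Finset.sum_mul]
  rw [Finset.sum_comm]
  refine Finset.sum_congr rfl fun a _ => ?_
  rw [Finset.sum_comm]
  refine Finset.sum_congr rfl fun A _ => ?_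
  rw [Finset.sum_eq_single a, Finset.sum_comm]
  · refine Finset.sum_congr rfl fun B _ => Finset.sum_congr rfl fun m _ => ?_
    simp; ring
  · intro b _ hb
    simp [hb.symm]
  · simp

theorem eq_of_forall_dotProduct {ι : Type} [Fintype ι] [DecidableEq ι] {A B : Matrix ι ι ℝ}
    (h : ∀ ψ χ : ι → ℝ, ψ ⬝ᵥ (A *ᵥ χ) = ψ ⬝ᵥ (B *ᵥ χ)) : A = B := by
  ext i j
  simpa using h (Pi.single i 1) (Pi.single j 1)

/-- Invariance of the bilinear forms is moved into the equivariance `Q R(φ) Qᵀ = R(Ω φ)`, the form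
in which representations of covering groups are inserted later. -/
theorem mem_symmetryGroup_iff {g : O (Fin N × Fin 4) × O (Fin M)} :
    g ∈ symmetryGroup N R ↔ Intertwines (flavors (Fin N) R) g.1.1 g.2.1 := by
  have h0 : g ∈ symmetryGroup N R ↔ ∀ (φ : Fin M → ℝ) (ψ χ : Fin N × Fin 4 → ℝ),
    yukawaForm N R (g.2.1.mulVec φ) (g.1.1.mulVec ψ) (g.1.1.mulVec χ) = yukawaForm N R φ ψ χ := Iff.rfl
  have h1 : g ∈ symmetryGroup N R ↔ ∀ φ, g.1.1ᵀ * comb (flavors (Fin N) R) (g.2.1 *ᵥ φ) * g.1.1 =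
      comb (flavors (Fin N) R) φ := by
    rw [h0]
    simp only [yukawaForm_eq]
    refine forall_congr' fun φ => ⟨fun h => eq_of_forall_dotProduct fun ψ χ => ?_, fun h ψ χ => ?_⟩
    · rw [← h, ← mulVec_mulVec, ← mulVec_mulVec, dotProduct_mulVec ψ, vecMul_transpose]
    · rw [← h, ← mulVec_mulVec, ← mulVec_mulVec, dotProduct_mulVec ψ, vecMul_transpose]
  rw [h1]
  refine forall_congr' fun φ => ⟨fun h => ?_, fun h => ?_⟩
  · rw [← h, ← Matrix.mul_assoc, ← Matrix.mul_assoc, g.1.mul_transpose_self, Matrix.one_mul,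
      Matrix.mul_assoc, g.1.mul_transpose_self, Matrix.mul_one]
  · rw [← h, ← Matrix.mul_assoc, ← Matrix.mul_assoc, g.1.transpose_mul_self, Matrix.one_mul,
      Matrix.mul_assoc, g.1.transpose_mul_self, Matrix.mul_one]

/-- Identifies the kernel of `(Q, Ω) ↦ Ω` with the orthogonal part of the commutant, to which the
corner description applies. -/
theorem mem_symmetryGroup_one_iff (hR : ∀ m, (R m).IsSymm) {Q : O (Fin N × Fin 4)} :
    (Q, 1) ∈ symmetryGroup N R ↔ Q.1 ∈ flavorCommutant N (closureAlgebra R) := by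
  rw [mem_symmetryGroup_iff, mem_flavorCommutant_iff hR]
  have h1 : ∀ A : Matrix (Fin N × Fin 4) (Fin N × Fin 4) ℝ,
      Q.1 * A * Q.1ᵀ = A ↔ A * Q.1 = Q.1 * A := by
    intro A
    constructor
    · intro h
      nth_rw 1 [← h]
      rw [Matrix.mul_assoc, Q.transpose_mul_self, Matrix.mul_one]
    · intro h
      rw [← h, Matrix.mul_assoc, Q.mul_transpose_self, Matrix.mul_one]
  simp only [Intertwines]
  constructor
  · intro h m
    have h2 := h (Pi.single m 1)
    rw [comb_single] at h2
    rw [← h1]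
    change _ = comb _ ((1 : Matrix _ _ ℝ) *ᵥ _) at h2
    rw [Matrix.one_mulVec, comb_single] at h2
    exact h2
  · intro h φ
    change Q.1 * _ * Q.1ᵀ = comb _ ((1 : Matrix _ _ ℝ) *ᵥ φ)
    rw [Matrix.one_mulVec, h1, comb, Finset.sum_mul, Finset.mul_sum]
    refine Finset.sum_congr rfl fun m _ => ?_
    rw [Matrix.smul_mul, Matrix.mul_smul]
    exact congrArg _ (h m)

instance : CompactSpace (scalarGroup R) := by
  have h : IsCompact (scalarGroup R : Set (O (Fin M))) := by
    unfold scalarGroup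
    split_ifs
    · exact isCompact_univ
    · exact isCompact_singleton
  exact isCompact_iff_compactSpace.1 h

/-- The image of the embedding is cut out of the compact orthogonal group by the closed linear
conditions of commuting with the Yukawa matrices. -/
theorem flavorGroup_compact (hR : ∀ m, (R m).IsSymm)
    {f : FlavorGroup N R → Matrix (Fin N × Fin 4) (Fin N × Fin 4) ℝ}
    (hf : IsCorner (flavorCommutant N (closureAlgebra R)) 1 f) : CompactSpace (FlavorGroup N R) := by
  have hrange : Set.range f = {Q | Qᵀ * Q = 1} ∩ ⋂ m,
      {Q | ((1 : Matrix (Fin N) (Fin N) ℝ) ⊗ₖ R m) * Q = Q * ((1 : Matrix (Fin N) (Fin N) ℝ) ⊗ₖ R m)} := by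
    ext Q
    simp only [Set.mem_inter_iff, Set.mem_iInter, Set.mem_ofPred_eq, ← mem_flavorCommutant_iff hR]
    constructor
    · rintro ⟨a, rfl⟩
      exact ⟨by rw [hf.transpose, ← hf.map_mul, inv_mul_cancel, hf.map_one], hf.mem a⟩
    · rintro ⟨h1, h2⟩
      obtain ⟨a, ha⟩ := hf.surj Q h2 h1 (mul_eq_one_comm.1 h1)
      exact ⟨a, by rw [ha, Matrix.one_mul]⟩
  have hc : IsClosed (Set.range f) := by
    rw [hrange]
    refine ((isCompact_orthogonal _).isClosed).inter (isClosed_iInter fun m => ?_)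
    exact isClosed_eq (by fun_prop) (by fun_prop)
  have hcl : Topology.IsClosedEmbedding f := ⟨hf.embedding, hc⟩
  have hcomp : IsCompact (f ⁻¹' {Q | Qᵀ * Q = 1}) := hcl.isCompact_preimage (isCompact_orthogonal _)
  have huniv : f ⁻¹' {Q | Qᵀ * Q = 1} = Set.univ := by
    ext a
    simp only [Set.mem_preimage, Set.mem_ofPred_eq, Set.mem_univ, iff_true]
    rw [hf.transpose, ← hf.map_mul, inv_mul_cancel, hf.map_one]
  exact ⟨huniv ▸ hcomp⟩

/-- The flavor group as a subgroup of the symmetry group. -/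
theorem exists_flavorHom (hR : ∀ m, (R m).IsSymm) :
    ∃ j : FlavorGroup N R →* symmetryGroup N R, Function.Injective j ∧ Continuous j ∧
      (∀ g : symmetryGroup N R, g.1.2 = 1 ↔ ∃ a, j a = g) ∧ CompactSpace (FlavorGroup N R) ∧
        T2Space (FlavorGroup N R) := by
  obtain ⟨f, hf⟩ := exists_flavorCorner N R
  have ho : ∀ a, (f a)ᵀ * f a = 1 := fun a => by
    rw [hf.transpose, ← hf.map_mul, inv_mul_cancel, hf.map_one]
  let s := O.hom f hf.map_one hf.map_mul ho
  let j : FlavorGroup N R →* symmetryGroup N R :=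
    (s.prod 1).codRestrict _ fun a => (mem_symmetryGroup_one_iff hR).2 (hf.mem a)
  have hj : ∀ a, (j a).1.1.1 = f a := fun a => rfl
  refine ⟨j, ?_, ?_, ?_, flavorGroup_compact hR hf, hf.embedding.t2Space⟩
  · intro a b hab
    exact hf.embedding.injective (by rw [← hj, ← hj, hab])
  · exact ((O.continuous_hom hf.embedding.continuous).prodMk continuous_const).subtype_mk _
  · rintro ⟨⟨Q, Ω⟩, hg⟩
    constructor
    · rintro rfl
      obtain ⟨a, ha⟩ := hf.surj Q.1 ((mem_symmetryGroup_one_iff hR).1 hg) Q.transpose_mul_self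
        Q.mul_transpose_self
      refine ⟨a, Subtype.ext (Prod.ext (Subtype.ext ?_) rfl)⟩
      change f a = Q.1
      rw [ha, Matrix.one_mul]
    · rintro ⟨a, ha⟩
      rw [← ha]
      rfl

/-- Only the fermionic component of a section has to be supplied; the scalar component is the
inclusion of `K`. -/
theorem isSplit_of_section (hR : ∀ m, (R m).IsSymm)
    (hproj : ∀ g ∈ symmetryGroup N R, g.2 ∈ scalarGroup R)
    (s : scalarGroup R →* O (Fin N × Fin 4)) (hsc : Continuous s)
    (hs : ∀ k, (s k, k.1) ∈ symmetryGroup N R) : IsSplit N R := by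
  obtain ⟨j, hj, hjc, hjq, hF, -⟩ := exists_flavorHom (N := N) hR
  let q : symmetryGroup N R →* scalarGroup R :=
    ((MonoidHom.snd _ _).comp (symmetryGroup N R).subtype).codRestrict _ fun g => hproj g.1 g.2
  let s' : scalarGroup R →* symmetryGroup N R :=
    (s.prod (scalarGroup R).subtype).codRestrict _ hs
  obtain ⟨φ, e, he⟩ := exists_split_of_section hj hjc (q := q)
    (fun g => by rw [← hjq, ← Subtype.coe_inj]; rfl) (s := s')
    ((hsc.prodMk continuous_subtype_val).subtype_mk _) (fun k => rfl)
  exact ⟨φ, e, fun g => congrArg Subtype.val (he g)⟩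

theorem isSplitUpToDoubleCover_of_lift (hR : ∀ m, (R m).IsSymm)
    (hproj : ∀ g ∈ symmetryGroup N R, g.2 ∈ scalarGroup R)
    {L : Type} [Group L] [TopologicalSpace L] [IsTopologicalGroup L] [CompactSpace L] [T2Space L]
    (p : L →* scalarGroup R) (hpc : Continuous p) (hp : Function.Surjective p)
    (hcard : Nat.card p.ker = 2)
    (s : L →* O (Fin N × Fin 4)) (hsc : Continuous s)
    (hs : ∀ l, (s l, (p l).1) ∈ symmetryGroup N R)
    (hcent : ∀ l, p l = 1 → ∀ Q, s l * Q = Q * s l) :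
    IsSplitUpToDoubleCover N R := by
  obtain ⟨j, hj, hjc, hjq, hF, hF2⟩ := exists_flavorHom (N := N) hR
  let q : symmetryGroup N R →* scalarGroup R :=
    ((MonoidHom.snd _ _).comp (symmetryGroup N R).subtype).codRestrict _ fun g => hproj g.1 g.2
  let s' : L →* symmetryGroup N R := (s.prod ((scalarGroup R).subtype.comp p)).codRestrict _ hs
  obtain ⟨α, π, h1, h2, h3⟩ := exists_doubleCover_of_lift hj hjc (q := q)
    (fun g => by rw [← hjq, ← Subtype.coe_inj]; rfl) hp hcard (s := s')
    ((hsc.prodMk (continuous_subtype_val.comp hpc)).subtype_mk _) (fun k => rfl) (by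
      intro l hl a
      have hl' : p l = 1 := hl
      refine Subtype.ext (Prod.ext (hcent l hl' _) ?_)
      change (p l).1 * (j a).1.2 = (j a).1.2 * (p l).1
      rw [hl', OneMemClass.coe_one, one_mul, mul_one])
  exact ⟨L, _, _, inferInstance, p, α, π, isDoubleCover_of_compact p hpc hp hcard, h1, h2,
    fun x => congrArg Subtype.val (h3 x)⟩

end Form
end GNY

/-! ### A single scalar -/

namespace GNY
open Matrix
open scoped Kronecker

section SingleScalar

variable {N : ℕ}

theorem O.fin_one_cases (Ω : O (Fin 1)) : Ω.1 0 0 = 1 ∨ Ω.1 0 0 = -1 := by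
  have h := congrFun (congrFun Ω.transpose_mul_self 0) 0
  simp only [Matrix.mul_apply, Fin.sum_univ_one, Matrix.transpose_apply, Matrix.one_apply_eq] at h
  exact mul_self_eq_one_iff.1 h

theorem O.fin_one_eq_one {Ω : O (Fin 1)} (h : Ω.1 0 0 = 1) : Ω = 1 := by
  ext i j
  rw [Subsingleton.elim i 0, Subsingleton.elim j 0, h]
  rfl

theorem charpoly_neg_of_even {ι : Type} [Fintype ι] [DecidableEq ι] (hι : Even (Fintype.card ι))
    (A : Matrix ι ι ℝ) : (-A).charpoly = A.charpoly.comp (-Polynomial.X) := by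
  refine Polynomial.funext fun x => ?_
  rw [Polynomial.eval_comp, eval_charpoly, eval_charpoly, Polynomial.eval_neg, Polynomial.eval_X,
    ← neg_neg (scalar ι (-x) - A), Matrix.det_neg, hι.neg_one_pow, one_mul, map_neg]
  congr 1
  abel

theorem charpoly_one_kronecker {𝕜 ι κ : Type} [Field 𝕜] [Infinite 𝕜] [Fintype ι] [DecidableEq ι]
    [Fintype κ] [DecidableEq κ] (A : Matrix ι ι 𝕜) :
    ((1 : Matrix κ κ 𝕜) ⊗ₖ A).charpoly = A.charpoly ^ Fintype.card κ := by
  refine Polynomial.funext fun x => ?_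
  have h : scalar (κ × ι) x - (1 : Matrix κ κ 𝕜) ⊗ₖ A =
      (1 : Matrix κ κ 𝕜) ⊗ₖ (scalar ι x - A) := by
    have h2 : scalar (κ × ι) x = (1 : Matrix κ κ 𝕜) ⊗ₖ scalar ι x := by
      ext ⟨a, i⟩ ⟨b, j⟩
      by_cases h1 : a = b <;> by_cases h2 : i = j <;> simp [h1, h2]
    rw [h2, sub_eq_add_neg, sub_eq_add_neg, Matrix.kronecker_add]
    congr 1
    rw [← neg_one_smul 𝕜 A, ← neg_one_smul 𝕜 (kroneckerMap _ _ _), Matrix.kronecker_smul]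
  rw [Polynomial.eval_pow, eval_charpoly, eval_charpoly, h, det_kronecker]
  simp

/-- Conjugation preserves the characteristic polynomial, so the `N`-fold multiset of eigenvalues is
symmetric. Multiplicities can be divided by `N` since `N ≥ 1`. -/
theorem hasEvenSpectrum_of_conj (hN : 1 ≤ N) {A : Matrix (Fin 4) (Fin 4) ℝ}
    (Q : O (Fin N × Fin 4)) (h : Q.1 * ((1 : Matrix (Fin N) (Fin N) ℝ) ⊗ₖ A) * Q.1ᵀ =
      -((1 : Matrix (Fin N) (Fin N) ℝ) ⊗ₖ A)) : HasEvenSpectrum A := by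
  have h1 : (-((1 : Matrix (Fin N) (Fin N) ℝ) ⊗ₖ A)).charpoly =
      ((1 : Matrix (Fin N) (Fin N) ℝ) ⊗ₖ A).charpoly := by
    rw [← h, Matrix.charpoly_mul_comm, ← Matrix.mul_assoc, Q.transpose_mul_self, Matrix.one_mul]
  rw [charpoly_neg_of_even (by simp [Nat.even_mul]; right; decide), charpoly_one_kronecker,
    Fintype.card_fin] at h1
  have h2 := congrArg Polynomial.roots h1
  rw [Polynomial.roots_comp_neg_X, Polynomial.roots_pow, Multiset.map_nsmul] at h2
  refine Multiset.ext.2 fun x => ?_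
  have h3 := congrArg (Multiset.count x) h2
  rw [Multiset.count_nsmul, Multiset.count_nsmul] at h3
  exact Nat.eq_of_mul_eq_mul_left hN h3

/-- Negation reverses the sorted order of a symmetric list, so reversing positions in the sorted
list matches each value with its negative. An arbitrary matching need not be an involution, but
reversal is one. -/
theorem exists_involution_of_even {n : ℕ} (f : Fin n → ℝ)
    (h : Multiset.map (fun i => -f i) Finset.univ.val = Multiset.map f Finset.univ.val) :
    ∃ σ : Equiv.Perm (Fin n), (∀ i, f (σ i) = -f i) ∧ ∀ i, σ (σ i) = i := by
  let τ := Tuple.sort f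
  have hmono : Monotone (f ∘ τ) := Tuple.monotone_sort f
  have hmono' : Monotone fun i : Fin n => -(f ∘ τ) i.rev := fun i j hij =>
    neg_le_neg (hmono (Fin.rev_le_rev.2 hij))
  have hmap : ∀ (g : Fin n → ℝ) (ρ : Equiv.Perm (Fin n)),
      Multiset.map (g ∘ ρ) Finset.univ.val = Multiset.map g Finset.univ.val := by
    intro g ρ
    rw [← Multiset.map_map]
    congr 1
    exact congrArg Finset.val (Finset.map_univ_equiv ρ)
  have hperm : (List.ofFn fun i : Fin n => -(f ∘ τ) i.rev).Perm (List.ofFn (f ∘ τ)) := by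
    rw [← Multiset.coe_eq_coe, ← Fin.univ_val_map, ← Fin.univ_val_map]
    have h1 := hmap (fun i => -f i) (Fin.revPerm.trans τ)
    have h2 := hmap f τ
    rw [h2, ← h, ← h1]
    rfl
  have heq := List.ofFn_injective (hperm.eq_of_sortedLE (List.sortedLE_ofFn_iff.2 hmono')
    (List.sortedLE_ofFn_iff.2 hmono))
  refine ⟨τ.symm.trans (Fin.revPerm.trans τ), fun i => ?_, fun i => ?_⟩
  · have h1 := congrFun heq (τ.symm i)
    simp only [Function.comp_apply, Equiv.apply_symm_apply] at h1
    simp only [Equiv.trans_apply, Fin.revPerm_apply]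
    linarith
  · simp

/-- In an eigenbasis, take the permutation matrix of the involution that exchanges opposite
eigenvalues. -/
theorem exists_antiInvolution {A : Matrix (Fin 4) (Fin 4) ℝ} (hA : A.IsSymm)
    (hev : HasEvenSpectrum A) :
    ∃ P : Matrix (Fin 4) (Fin 4) ℝ, Pᵀ = P ∧ P * P = 1 ∧ P * A = -(A * P) := by
  have hH : A.IsHermitian := by
    rw [Matrix.IsHermitian, conjTranspose_eq_transpose_of_trivial]; exact hA
  obtain ⟨σ, hσ, hσσ⟩ := exists_involution_of_even hH.eigenvalues (by
    have h := hev
    rw [HasEvenSpectrum, hH.roots_charpoly_eq_eigenvalues, Multiset.map_map] at h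
    exact h)
  set V := (hH.eigenvectorUnitary : Matrix (Fin 4) (Fin 4) ℝ) with hV
  have hVV : Vᵀ * V = 1 := O.transpose_mul_self hH.eigenvectorUnitary
  have hsp : A = V * diagonal hH.eigenvalues * Vᵀ := by
    have h := hH.spectral_theorem
    rw [Unitary.conjStarAlgAut_apply, star_eq_conjTranspose,
      conjTranspose_eq_transpose_of_trivial] at h
    exact h
  set D := diagonal hH.eigenvalues
  let S : Matrix (Fin 4) (Fin 4) ℝ := Matrix.of fun i j => if j = σ i then 1 else 0
  have hS : Sᵀ = S := by
    ext i j
    simp only [S, transpose_apply, of_apply]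
    refine if_congr ⟨fun h => by rw [h, hσσ], fun h => by rw [h, hσσ]⟩ rfl rfl
  have hSS : S * S = 1 := by
    ext i j
    rw [Matrix.mul_apply, Finset.sum_eq_single (σ i)]
    · simp [S, Matrix.one_apply, hσσ, eq_comm]
    · intro k _ hk
      simp [S, hk]
    · simp
  have hSD : S * D = -(D * S) := by
    ext i j
    rw [Matrix.neg_apply, Matrix.mul_diagonal, Matrix.diagonal_mul]
    by_cases h : j = σ i
    · simp [S, h, hσ]
    · simp [S, h]
  refine ⟨V * S * Vᵀ, ?_, ?_, ?_⟩
  · rw [transpose_mul, transpose_mul, hS, transpose_transpose, Matrix.mul_assoc]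
  · calc V * S * Vᵀ * (V * S * Vᵀ) = V * S * (Vᵀ * V) * S * Vᵀ := by simp only [Matrix.mul_assoc]
      _ = V * (S * S) * Vᵀ := by rw [hVV, Matrix.mul_one]; simp only [Matrix.mul_assoc]
      _ = 1 := by rw [hSS, Matrix.mul_one]; exact O.mul_transpose_self hH.eigenvectorUnitary
  · calc V * S * Vᵀ * A = V * S * (Vᵀ * V) * D * Vᵀ := by
          nth_rw 1 [hsp]; simp only [Matrix.mul_assoc]
      _ = V * (S * D) * Vᵀ := by rw [hVV, Matrix.mul_one]; simp only [Matrix.mul_assoc]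
      _ = -(V * D * (Vᵀ * V) * S * Vᵀ) := by
          rw [hSD, hVV, Matrix.mul_one]
          simp only [Matrix.mul_neg, Matrix.neg_mul, Matrix.mul_assoc]
      _ = -(A * (V * S * Vᵀ)) := by
          rw [show A * (V * S * Vᵀ) = V * D * Vᵀ * (V * S * Vᵀ) from congrArg (· * _) hsp]
          simp only [Matrix.mul_assoc]

theorem intertwines_fin_one {R : Yukawa 1} {Q : Matrix (Fin N × Fin 4) (Fin N × Fin 4) ℝ}
    {Ω : Matrix (Fin 1) (Fin 1) ℝ} : Intertwines (flavors (Fin N) R) Q Ω ↔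
      Q * ((1 : Matrix (Fin N) (Fin N) ℝ) ⊗ₖ R 0) * Qᵀ =
        Ω 0 0 • ((1 : Matrix (Fin N) (Fin N) ℝ) ⊗ₖ R 0) := by
  have h1 : ∀ φ, comb (flavors (Fin N) R) φ = φ 0 • ((1 : Matrix (Fin N) (Fin N) ℝ) ⊗ₖ R 0) := by
    intro φ
    simp [comb, flavors]
  simp only [Intertwines, h1, Matrix.mul_smul, Matrix.smul_mul]
  constructor
  · intro h
    simpa [mulVec, dotProduct] using h 1
  · intro h φ
    rw [h, smul_smul]
    simp [mulVec, dotProduct, mul_comm]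

theorem scalarGroup_eq_top_of_hasEvenSpectrum {R : Yukawa 1} (h : HasEvenSpectrum (R 0)) :
    scalarGroup R = ⊤ := by
  rw [scalarGroup, if_pos]
  right
  intro m
  rwa [Subsingleton.elim m 0]

theorem isSplit_of_fin_one (hN : 1 ≤ N) {R : Yukawa 1} (hR : ∀ m, (R m).IsSymm) :
    IsSplit N R := by
  by_cases hev : HasEvenSpectrum (R 0)
  · obtain ⟨P₀, hP₁, hP₂, hP₃⟩ := exists_antiInvolution (hR 0) hev
    set P := (1 : Matrix (Fin N) (Fin N) ℝ) ⊗ₖ P₀ with hP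
    have hPT : Pᵀ = P := by rw [hP, ← kroneckerMap_transpose, hP₁, transpose_one]
    have hPP : P * P = 1 := by
      rw [hP, ← mul_kronecker_mul, hP₂, Matrix.mul_one, one_kronecker_one]
    have hPR : P * ((1 : Matrix (Fin N) (Fin N) ℝ) ⊗ₖ R 0) * P =
        -((1 : Matrix (Fin N) (Fin N) ℝ) ⊗ₖ R 0) := by
      rw [hP, ← mul_kronecker_mul, ← mul_kronecker_mul, hP₃, Matrix.neg_mul, Matrix.mul_assoc (R 0), hP₂]
      ext; simp
    -- The affine interpolation in the entry of `Ω`, equal to `1` at `+1` and to `P` at `-1`, makes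
    -- continuity evident.
    let f : scalarGroup R → Matrix (Fin N × Fin 4) (Fin N × Fin 4) ℝ := fun k =>
      ((1 + k.1.1 0 0) / 2) • (1 : Matrix _ _ ℝ) + ((1 - k.1.1 0 0) / 2) • P
    have hk : ∀ k : scalarGroup R, k.1.1 0 0 = 1 ∧ f k = 1 ∨ k.1.1 0 0 = -1 ∧ f k = P := by
      intro k
      rcases k.1.fin_one_cases with h | h
      · left; refine ⟨h, ?_⟩; simp only [f, h]; norm_num
      · right; refine ⟨h, ?_⟩; simp only [f, h]; norm_num
    have hkk : ∀ k l : scalarGroup R, (k * l).1.1 0 0 = k.1.1 0 0 * l.1.1 0 0 := by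
      intro k l
      change (k.1.1 * l.1.1) 0 0 = _
      simp [Matrix.mul_apply]
    refine isSplit_of_section hR (fun g _ => by
      rw [scalarGroup_eq_top_of_hasEvenSpectrum hev]; trivial) (O.hom f ?_ ?_ ?_) ?_ ?_
    · have : (1 : scalarGroup R).1.1 0 0 = 1 := rfl
      simp only [f, this]; norm_num
    · intro k l
      have h := hkk k l
      rcases hk k with ⟨h1, h2⟩ | ⟨h1, h2⟩ <;> rcases hk l with ⟨h3, h4⟩ | ⟨h3, h4⟩ <;>
        rw [h1, h3] at h <;> rw [h2, h4] <;> simp only [f, h, hPP, mul_one, one_mul] <;> norm_num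
    · intro k
      rcases hk k with ⟨-, h⟩ | ⟨-, h⟩ <;> rw [h] <;> simp [hPT, hPP]
    · refine O.continuous_hom ?_
      have hc : Continuous fun k : scalarGroup R => k.1.1 0 0 :=
        (continuous_subtype_val.comp continuous_subtype_val).matrix_elem 0 0
      exact (((continuous_const.add hc).div_const 2).smul continuous_const).add
        (((continuous_const.sub hc).div_const 2).smul continuous_const)
    · intro k
      rw [mem_symmetryGroup_iff, intertwines_fin_one]
      change f k * _ * (f k)ᵀ = _
      rcases hk k with ⟨h0, h⟩ | ⟨h0, h⟩ <;> rw [h, h0]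
      · simp
      · rw [hPT, hPR, neg_one_smul]
  -- An element over `Ω = -1` would conjugate the Yukawa matrix to its negative and force an even
  -- spectrum, so the scalar part is trivial.
  · have hbot : ∀ g ∈ symmetryGroup N R, g.2 = 1 := by
      intro g hg
      rw [mem_symmetryGroup_iff, intertwines_fin_one] at hg
      rcases g.2.fin_one_cases with h | h
      · exact O.fin_one_eq_one h
      · rw [h, neg_one_smul] at hg
        exact (hev (hasEvenSpectrum_of_conj hN g.1 hg)).elim
    have hs : scalarGroup R = ⊥ := by
      rw [scalarGroup, if_neg]
      push Not
      exact ⟨le_rfl, 0, hev⟩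
    refine isSplit_of_section hR (fun g hg => hbot g hg ▸ one_mem _) 1 continuous_const ?_
    rintro ⟨k, hk⟩
    rw [hs, Subgroup.mem_bot] at hk
    subst hk
    exact one_mem _

end SingleScalar
end GNY

/-! ### Equivalence of Yukawa matrices and lifts to the fermions -/

namespace GNY
open Matrix
open scoped Kronecker

section Lifts

variable {M : ℕ} {ι ι' ι'' κ κ' : Type} [Fintype ι] [DecidableEq ι] [Fintype ι'] [DecidableEq ι']
  [Fintype ι''] [DecidableEq ι''] [Fintype κ] [DecidableEq κ] [Fintype κ'] [DecidableEq κ']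

/-- Yukawa matrices that are related by an orthogonal change of basis of the fermions. -/
def Equivalent (R : Fin M → Matrix ι ι ℝ) (R' : Fin M → Matrix ι' ι' ℝ) : Prop :=
  ∃ A : Matrix ι ι' ℝ, Aᵀ * A = 1 ∧ A * Aᵀ = 1 ∧ ∀ m, R m = A * R' m * Aᵀ

theorem Equivalent.trans {R : Fin M → Matrix ι ι ℝ} {R' : Fin M → Matrix ι' ι' ℝ}
    {R'' : Fin M → Matrix ι'' ι'' ℝ} (h : Equivalent R R') (h' : Equivalent R' R'') :
    Equivalent R R'' := by
  obtain ⟨A, hA, hA', hR⟩ := h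
  obtain ⟨B, hB, hB', hR'⟩ := h'
  refine ⟨A * B, ?_, ?_, fun m => ?_⟩
  · rw [transpose_mul, Matrix.mul_assoc, ← Matrix.mul_assoc Aᵀ, hA, Matrix.one_mul, hB]
  · rw [transpose_mul, Matrix.mul_assoc, ← Matrix.mul_assoc B, hB', Matrix.one_mul, hA']
  · rw [hR, hR', transpose_mul]
    simp only [Matrix.mul_assoc]

theorem Equivalent.flavors {R : Fin M → Matrix ι ι ℝ} {R' : Fin M → Matrix ι' ι' ℝ}
    (h : Equivalent R R') : Equivalent (flavors κ R) (flavors κ R') := by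
  obtain ⟨A, hA, hA', hR⟩ := h
  refine ⟨(1 : Matrix κ κ ℝ) ⊗ₖ A, ?_, ?_, fun m => ?_⟩
  · rw [← kroneckerMap_transpose, ← mul_kronecker_mul, hA, transpose_one, Matrix.mul_one,
      one_kronecker_one]
  · rw [← kroneckerMap_transpose, ← mul_kronecker_mul, hA', transpose_one, Matrix.mul_one,
      one_kronecker_one]
  · rw [GNY.flavors, GNY.flavors, hR, ← kroneckerMap_transpose, ← mul_kronecker_mul,
      ← mul_kronecker_mul, transpose_one, Matrix.mul_one, Matrix.mul_one]

theorem Equivalent.of_conj {R : Fin M → Matrix ι ι ℝ} {A : Matrix ι ι' ℝ} (hA' : A * Aᵀ = 1)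
    (hA : Aᵀ * A = 1) : Equivalent R (fun m => Aᵀ * R m * A) :=
  ⟨A, hA, hA', fun m => by
    change R m = A * (Aᵀ * R m * A) * Aᵀ
    rw [Matrix.mul_assoc Aᵀ, ← Matrix.mul_assoc A, hA', Matrix.one_mul, Matrix.mul_assoc, hA',
      Matrix.mul_one]⟩

theorem Equivalent.isSymm {R : Fin M → Matrix ι ι ℝ} {R' : Fin M → Matrix ι' ι' ℝ}
    (h : Equivalent R R') (hR : ∀ m, (R m).IsSymm) (m : Fin M) : (R' m).IsSymm := by
  obtain ⟨A, hA, -, hR'⟩ := h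
  have h1 : R' m = Aᵀ * R m * A := by
    rw [hR', ← Matrix.mul_assoc, ← Matrix.mul_assoc, hA, Matrix.one_mul, Matrix.mul_assoc, hA,
      Matrix.mul_one]
  rw [h1, Matrix.IsSymm, transpose_mul, transpose_mul, (hR m).eq, transpose_transpose,
    Matrix.mul_assoc]

theorem equivalent_reindex (R : Fin M → Matrix ι ι ℝ) (e : ι ≃ ι') :
    Equivalent R (fun m => (R m).submatrix e.symm e.symm) := by
  have h : ∀ A : Matrix ι ι ℝ, A.submatrix id e.symm * (A.submatrix id e.symm)ᵀ = A * Aᵀ := by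
    intro A
    rw [transpose_submatrix, submatrix_mul_equiv, submatrix_id_id]
  refine ⟨(1 : Matrix ι ι ℝ).submatrix id e.symm, ?_, ?_, fun m => ?_⟩
  · rw [transpose_submatrix, ← submatrix_mul _ _ _ id _ Function.bijective_id]
    simp
  · rw [h]; simp
  · rw [transpose_submatrix, submatrix_mul_equiv, submatrix_mul_equiv]
    simp

variable {L : Type} [Group L] [TopologicalSpace L]

/-- A lift of transformations of the scalars to transformations of the fermions; the nontrivial
elements of the kernel act by `ε`. -/
def HasLift (p : L →* O (Fin M)) (R : Fin M → Matrix ι ι ℝ) (ε : ℝ) : Prop :=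
  ∃ s : L →* O ι, Continuous s ∧ (∀ l, Intertwines R (s l).1 (p l).1) ∧
    ∀ l, p l = 1 → l ≠ 1 → (s l).1 = ε • (1 : Matrix ι ι ℝ)

variable {p : L →* O (Fin M)}

theorem HasLift.of_equivalent {R : Fin M → Matrix ι ι ℝ} {R' : Fin M → Matrix ι' ι' ℝ} {ε : ℝ}
    (h : Equivalent R R') (h' : HasLift p R' ε) : HasLift p R ε := by
  obtain ⟨A, hA, hA', hR⟩ := h
  obtain ⟨s, hs, hsi, hsk⟩ := h'
  refine ⟨O.hom (fun l => A * (s l).1 * Aᵀ) ?_ ?_ ?_, O.continuous_hom (by fun_prop), ?_, ?_⟩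
  · rw [map_one]; simp [hA']
  · intro a b
    rw [map_mul]
    calc A * ((s a).1 * (s b).1) * Aᵀ = A * (s a).1 * (Aᵀ * A) * (s b).1 * Aᵀ := by
          rw [hA, Matrix.mul_one]; simp only [Matrix.mul_assoc]
      _ = _ := by simp only [Matrix.mul_assoc]
  · intro a
    rw [transpose_mul, transpose_mul, transpose_transpose]
    calc A * ((s a).1ᵀ * Aᵀ) * (A * (s a).1 * Aᵀ) = A * ((s a).1ᵀ * (Aᵀ * A) * (s a).1) * Aᵀ := by
          simp only [Matrix.mul_assoc]
      _ = 1 := by rw [hA, Matrix.mul_one, (s a).transpose_mul_self, Matrix.mul_one, hA']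
  · intro l φ
    have hc : ∀ φ, comb R φ = A * comb R' φ * Aᵀ := fun φ => by
      rw [← comb_conj]; exact congrArg (comb · φ) (funext hR)
    rw [hc, hc, ← hsi l φ, O.hom_coe, transpose_mul, transpose_mul, transpose_transpose]
    calc A * (s l).1 * Aᵀ * (A * comb R' φ * Aᵀ) * (A * ((s l).1ᵀ * Aᵀ))
        = A * (s l).1 * (Aᵀ * A) * comb R' φ * (Aᵀ * A) * (s l).1ᵀ * Aᵀ := by
          simp only [Matrix.mul_assoc]
      _ = _ := by
          rw [hA, Matrix.mul_one, Matrix.mul_one]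
          simp only [Matrix.mul_assoc]
  · intro l hl hl1
    rw [O.hom_coe, hsk l hl hl1, Matrix.mul_smul, Matrix.mul_one, Matrix.smul_mul, hA']

/-- Transformations of the flavor index commute with the Yukawa matrices, so a lift may be tensored
with any orthogonal representation `τ`. The scalars by which the kernel acts multiply, and this is
how a sign can be cancelled. -/
theorem HasLift.flavors {R : Fin M → Matrix ι ι ℝ} {ε ε' : ℝ} (h : HasLift p R ε)
    (τ : L →* O κ) (hτ : Continuous τ) (hτk : ∀ l, p l = 1 → l ≠ 1 → (τ l).1 = ε' • 1) :
    HasLift p (flavors κ R) (ε' * ε) := by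
  obtain ⟨s, hs, hsi, hsk⟩ := h
  refine ⟨O.hom (fun l => (τ l).1 ⊗ₖ (s l).1) ?_ ?_ ?_, O.continuous_hom ?_, ?_, ?_⟩
  · rw [map_one, map_one]
    exact one_kronecker_one
  · intro a b
    rw [map_mul, map_mul]
    exact mul_kronecker_mul _ _ _ _
  · intro a
    rw [← kroneckerMap_transpose, ← mul_kronecker_mul, (s a).transpose_mul_self,
      (τ a).transpose_mul_self, one_kronecker_one]
  · refine continuous_matrix fun i j => ?_
    exact ((continuous_subtype_val.comp hτ).matrix_elem _ _).mul
      ((continuous_subtype_val.comp hs).matrix_elem _ _)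
  · intro l φ
    rw [comb_flavors, comb_flavors, O.hom_coe, ← kroneckerMap_transpose, ← mul_kronecker_mul,
      ← mul_kronecker_mul, hsi l φ, Matrix.mul_one, (τ l).mul_transpose_self]
  · intro l hl hl1
    rw [O.hom_coe, hsk l hl hl1, hτk l hl hl1, smul_kronecker, kronecker_smul, smul_smul,
      one_kronecker_one]

theorem HasLift.flavors_of_untwisted {R : Fin M → Matrix ι ι ℝ} {ε : ℝ} (h : HasLift p R ε) :
    HasLift p (GNY.flavors κ R) ε := by
  have h1 := h.flavors (κ := κ) (ε' := 1) 1 continuous_const fun l _ _ => by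
    rw [one_smul]; rfl
  rwa [one_mul] at h1

/-- A lift that is trivial on the kernel descends. -/
theorem HasLift.descend [CompactSpace L] {R : Fin M → Matrix ι ι ℝ} (h : HasLift p R 1)
    (hpc : Continuous p) (hp : Function.Surjective p) :
    HasLift (MonoidHom.id (O (Fin M))) R 1 := by
  obtain ⟨s, hs, hsi, hsk⟩ := h
  have hker : p.ker ≤ s.ker := by
    intro l hl
    by_cases h1 : l = 1
    · rw [h1]; exact one_mem _
    · exact Subtype.ext ((hsk l hl h1).trans (one_smul _ _))
  let t : O (Fin M) →* O ι := p.liftOfSurjective hp ⟨s, hker⟩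
  have ht : ∀ l, t (p l) = s l := fun l =>
    MonoidHom.liftOfRightInverse_comp_apply p _ (Function.rightInverse_surjInv hp) ⟨s, hker⟩ l
  refine ⟨t, ?_, ?_, fun l hl hl1 => (hl1 hl).elim⟩
  · rw [(Topology.IsQuotientMap.of_surjective_continuous hp hpc).continuous_iff]
    exact hs.congr fun l => (ht l).symm
  · intro Ω
    obtain ⟨l, rfl⟩ := hp Ω
    rw [ht]
    exact hsi l

end Lifts

section Conclusions

variable {N M : ℕ} {R : Yukawa M}

theorem scalarGroup_eq_top (hM : 1 < M) : scalarGroup R = ⊤ := by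
  rw [scalarGroup, if_pos (Or.inl hM)]

theorem isSplit_of_hasLift (hM : 1 < M) (hR : ∀ m, (R m).IsSymm)
    (h : HasLift (MonoidHom.id (O (Fin M))) (flavors (Fin N) R) 1) : IsSplit N R := by
  obtain ⟨s, hs, hsi, -⟩ := h
  refine isSplit_of_section hR (fun g _ => scalarGroup_eq_top (R := R) hM ▸ Subgroup.mem_top _)
    (s.comp (scalarGroup R).subtype) (hs.comp continuous_subtype_val) fun k => ?_
  rw [mem_symmetryGroup_iff]
  exact hsi k.1

/-- The kernel of `p` acts on the fermions by a scalar, hence centrally, as the extension argument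
requires. -/
theorem isSplitUpToDoubleCover_of_hasLift (hM : 1 < M) (hR : ∀ m, (R m).IsSymm)
    {L : Type} [Group L] [TopologicalSpace L] [IsTopologicalGroup L] [CompactSpace L] [T2Space L]
    {p : L →* O (Fin M)} (hpc : Continuous p) (hp : Function.Surjective p)
    (hcard : Nat.card p.ker = 2) {ε : ℝ} (h : HasLift p (flavors (Fin N) R) ε) :
    IsSplitUpToDoubleCover N R := by
  obtain ⟨s, hs, hsi, hsk⟩ := h
  have htop := scalarGroup_eq_top (R := R) hM
  let p' : L →* scalarGroup R := p.codRestrict _ fun l => htop ▸ Subgroup.mem_top _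
  have hker : p'.ker = p.ker := by
    ext l
    rw [MonoidHom.mem_ker, MonoidHom.mem_ker, ← Subtype.coe_inj]
    rfl
  refine isSplitUpToDoubleCover_of_lift hR (fun g _ => htop ▸ Subgroup.mem_top _) p'
    (hpc.subtype_mk _) ?_ (by rw [hker, hcard]) s hs ?_ ?_
  · rintro ⟨Ω, hΩ⟩
    obtain ⟨l, rfl⟩ := hp Ω
    exact ⟨l, rfl⟩
  · intro l
    rw [mem_symmetryGroup_iff]
    exact hsi l
  · intro l hl Q
    by_cases h1 : l = 1
    · rw [h1, map_one, one_mul, mul_one]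
    · have h2 := hsk l (congrArg Subtype.val hl) h1
      refine Subtype.ext ?_
      change (s l).1 * Q.1 = Q.1 * (s l).1
      rw [h2]
      simp

end Conclusions

/-! ### Coordinate rotations and the invariance of traces -/

section Rotations

variable {M : ℕ} {ι ι' κ : Type} [Fintype ι] [DecidableEq ι] [Fintype ι'] [DecidableEq ι']
  [Fintype κ] [DecidableEq κ]

/-- The rotation of the Yukawa matrices with indices `i` and `j`. -/
def rotate {α : Type} (i j : Fin M) (c s : ℝ) (R : Fin M → Matrix α α ℝ) (m : Fin M) :
    Matrix α α ℝ :=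
  if m = i then c • R i + s • R j else if m = j then c • R j - s • R i else R m

variable (κ) in
/-- The rotations of the scalars in coordinate planes are compensated by orthogonal transformations
of `κ` flavors of fermions. -/
def Rotatable (R : Fin M → Matrix ι ι ℝ) : Prop :=
  ∀ i j, i ≠ j → ∀ c s : ℝ, c ^ 2 + s ^ 2 = 1 → ∃ Q : Matrix (κ × ι) (κ × ι) ℝ, Qᵀ * Q = 1 ∧
    ∀ m, Q * ((1 : Matrix κ κ ℝ) ⊗ₖ R m) * Qᵀ = (1 : Matrix κ κ ℝ) ⊗ₖ rotate i j c s R m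

theorem exists_half_angle {c s : ℝ} (h : c ^ 2 + s ^ 2 = 1) :
    ∃ x y : ℝ, x ^ 2 + y ^ 2 = 1 ∧ c = x ^ 2 - y ^ 2 ∧ s = 2 * x * y := by
  obtain ⟨z, hz⟩ := IsAlgClosed.exists_pow_nat_eq (⟨c, s⟩ : ℂ) (n := 2) (by norm_num)
  have h1 := congrArg Complex.re hz
  have h2 := congrArg Complex.im hz
  simp only [pow_two, Complex.mul_re, Complex.mul_im] at h1 h2
  refine ⟨z.re, z.im, ?_, by rw [← h1]; ring, by rw [← h2]; ring⟩
  have h3 : (z.re ^ 2 + z.im ^ 2) ^ 2 = 1 := by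
    rw [← h, ← h1, ← h2]; ring
  nlinarith [sq_nonneg z.re, sq_nonneg z.im]

/-- The rotation in a coordinate plane. -/
def planeRotation (i j : Fin M) (c s : ℝ) : Matrix (Fin M) (Fin M) ℝ :=
  1 + (c - 1) • (Matrix.single i i 1 + Matrix.single j j 1) +
    s • (Matrix.single j i 1 - Matrix.single i j 1)

theorem planeRotation_mul {i j : Fin M} (hij : i ≠ j) (c s c' s' : ℝ) :
    planeRotation i j c s * planeRotation i j c' s' =
      planeRotation i j (c * c' - s * s') (c * s' + s * c') := by
  simp only [planeRotation, Matrix.mul_add, Matrix.add_mul, Matrix.mul_sub, Matrix.sub_mul,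
    Matrix.smul_mul, Matrix.mul_smul, Matrix.one_mul, Matrix.single_mul_single_same, _root_.mul_one,
    Matrix.single_mul_single_of_ne _ _ _ _ hij, Matrix.single_mul_single_of_ne _ _ _ _ hij.symm]
  module

theorem planeRotation_transpose (i j : Fin M) (c s : ℝ) :
    (planeRotation i j c s)ᵀ = planeRotation i j c (-s) := by
  simp only [planeRotation, transpose_add, transpose_smul, transpose_sub, transpose_one,
    transpose_single]
  module

theorem planeRotation_orthogonal {i j : Fin M} (hij : i ≠ j) {c s : ℝ} (h : c ^ 2 + s ^ 2 = 1) :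
    (planeRotation i j c s)ᵀ * planeRotation i j c s = 1 := by
  rw [planeRotation_transpose, planeRotation_mul hij,
    show c * c - -s * s = 1 by linear_combination h, show c * s + -s * c = 0 by ring]
  simp [planeRotation]

/-- A rotation is the square of the rotation by half the angle, so its determinant is the square of
a sign. -/
theorem planeRotation_det {i j : Fin M} (hij : i ≠ j) {c s : ℝ} (h : c ^ 2 + s ^ 2 = 1) :
    (planeRotation i j c s).det = 1 := by
  obtain ⟨x, y, hxy, rfl, rfl⟩ := exists_half_angle h
  have h1 : planeRotation i j (x ^ 2 - y ^ 2) (2 * x * y) =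
      planeRotation i j x y * planeRotation i j x y := by
    rw [planeRotation_mul hij]
    congr 1 <;> ring
  have h2 := congrArg Matrix.det (planeRotation_orthogonal hij hxy)
  rw [det_mul, det_transpose, det_one] at h2
  rw [h1, det_mul, h2]

theorem comb_planeRotation {α : Type} {i j : Fin M} (hij : i ≠ j) (c s : ℝ)
    (R : Fin M → Matrix α α ℝ)
    (m : Fin M) : comb R (planeRotation i j c s *ᵥ Pi.single m 1) = rotate i j c s R m := by
  have h1 : ∀ a b k : Fin M, (Matrix.single a b (1 : ℝ)) *ᵥ Pi.single k 1 =
      if b = k then Pi.single a 1 else 0 := by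
    intro a b k
    rw [Matrix.mulVec_single_one]
    ext x
    by_cases h : b = k <;> simp [h, Matrix.single_apply, Pi.single_apply, eq_comm, Matrix.col_apply]
  rw [planeRotation, Matrix.add_mulVec, Matrix.add_mulVec, Matrix.one_mulVec, Matrix.smul_mulVec,
    Matrix.smul_mulVec, Matrix.add_mulVec, Matrix.sub_mulVec, h1, h1, h1, h1, rotate]
  have h0 : comb R 0 = 0 := by simp [comb]
  have hneg : ∀ φ, comb R (-φ) = -comb R φ := fun φ => by
    rw [← neg_one_smul ℝ φ, comb_smul, neg_one_smul]
  by_cases h2 : m = i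
  · subst h2
    simp only [hij.symm, if_true, if_false, add_zero, sub_zero, comb_add, comb_smul, comb_single]
    module
  · by_cases h3 : m = j
    · subst h3
      simp only [hij, hij.symm, if_true, if_false, zero_add, zero_sub, comb_add, comb_smul,
        comb_single, hneg]
      module
    · simp only [Ne.symm h2, Ne.symm h3, h2, h3, if_false, comb_single,
        add_zero, sub_zero, smul_zero]

/-- Rotations in coordinate planes are all that the classification needs from unbroken `SO(M)`. -/
theorem IsValid.rotatable {N : ℕ} {R : Yukawa M} (h : IsValid N R) : Rotatable (Fin N) R := by
  intro i j hij c s hcs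
  obtain ⟨Q, hQ⟩ := h.unbroken (O.mk _ (planeRotation_orthogonal hij hcs)) (planeRotation_det hij hcs)
  rw [mem_symmetryGroup_iff] at hQ
  refine ⟨Q.1, Q.transpose_mul_self, fun m => ?_⟩
  have h1 := hQ (Pi.single m 1)
  change _ = comb _ (planeRotation i j c s *ᵥ _) at h1
  rw [comb_single, comb_flavors, comb_planeRotation hij] at h1
  exact h1

theorem Rotatable.comp {M' : ℕ} {R : Fin M → Matrix ι ι ℝ} (h : Rotatable κ R) {e : Fin M' → Fin M}
    (he : Function.Injective e) : Rotatable κ (R ∘ e) := by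
  intro i j hij c s hcs
  obtain ⟨Q, hQ, hQ'⟩ := h (e i) (e j) (he.ne hij) c s hcs
  refine ⟨Q, hQ, fun m => ?_⟩
  have h1 : rotate i j c s (R ∘ e) m = rotate (e i) (e j) c s R (e m) := by
    simp [rotate, he.eq_iff]
  rw [h1]
  exact hQ' (e m)

theorem rotate_conj {α β : Type} [Fintype α] (A : Matrix β α ℝ) (i j : Fin M) (c s : ℝ)
    (R : Fin M → Matrix α α ℝ) (m : Fin M) : rotate i j c s (fun k => A * R k * Aᵀ) m = A * rotate i j c s R m * Aᵀ := by
  unfold rotate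
  split_ifs <;> simp [Matrix.mul_add, Matrix.add_mul, Matrix.mul_sub, Matrix.sub_mul]

theorem Rotatable.of_equivalent {R : Fin M → Matrix ι ι ℝ} {R' : Fin M → Matrix ι' ι' ℝ}
    (h : Equivalent R R') (hR : Rotatable κ R) : Rotatable κ R' := by
  obtain ⟨A, hA, hA', hRR⟩ := h
  obtain rfl : R = fun m => A * R' m * Aᵀ := funext hRR
  intro i j hij c s hcs
  obtain ⟨Q, hQ, hQ'⟩ := hR i j hij c s hcs
  set B : Matrix (κ × ι) (κ × ι') ℝ := (1 : Matrix κ κ ℝ) ⊗ₖ A with hB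
  have hBT : Bᵀ = (1 : Matrix κ κ ℝ) ⊗ₖ Aᵀ := by rw [hB, ← kroneckerMap_transpose, transpose_one]
  have hBB : Bᵀ * B = 1 := by
    rw [hBT, hB, ← mul_kronecker_mul, hA, Matrix.mul_one, one_kronecker_one]
  have hBB' : B * Bᵀ = 1 := by
    rw [hBT, hB, ← mul_kronecker_mul, hA', Matrix.mul_one, one_kronecker_one]
  have hconj : ∀ X : Matrix ι' ι' ℝ, (1 : Matrix κ κ ℝ) ⊗ₖ (A * X * Aᵀ) = B * ((1 : Matrix κ κ ℝ) ⊗ₖ X) * Bᵀ := by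
    intro X
    rw [hBT, hB, ← mul_kronecker_mul, ← mul_kronecker_mul, Matrix.mul_one, Matrix.mul_one]
  refine ⟨Bᵀ * Q * B, ?_, fun m => ?_⟩
  · calc (Bᵀ * Q * B)ᵀ * (Bᵀ * Q * B) = Bᵀ * (Qᵀ * (B * Bᵀ) * Q) * B := by
          simp only [transpose_mul, transpose_transpose, Matrix.mul_assoc]
      _ = 1 := by rw [hBB', Matrix.mul_one, hQ, Matrix.mul_one, hBB]
  · have h1 := hQ' m
    rw [rotate_conj, hconj, hconj] at h1
    calc Bᵀ * Q * B * ((1 : Matrix κ κ ℝ) ⊗ₖ R' m) * (Bᵀ * Q * B)ᵀ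
        = Bᵀ * (Q * (B * ((1 : Matrix κ κ ℝ) ⊗ₖ R' m) * Bᵀ) * Qᵀ) * B := by
          simp only [transpose_mul, transpose_transpose, Matrix.mul_assoc]
      _ = (Bᵀ * B) * ((1 : Matrix κ κ ℝ) ⊗ₖ rotate i j c s R' m) * (Bᵀ * B) := by
          rw [h1]; simp only [Matrix.mul_assoc]
      _ = _ := by rw [hBB, Matrix.one_mul, Matrix.mul_one]

/-- Conjugation by `Q` carries words to words, and a trace over `κ` flavors is `card κ` times the
trace over one. Dividing by this number removes `N` and `Q` from the problem, leaving polynomial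
identities for the original matrices. -/
theorem trace_prod_eq_of_conj [Nonempty κ] {X : Type} {f g : X → Matrix ι ι ℝ}
    {Q : Matrix (κ × ι) (κ × ι) ℝ} (hQ : Qᵀ * Q = 1)
    (h : ∀ x, Q * ((1 : Matrix κ κ ℝ) ⊗ₖ f x) * Qᵀ = (1 : Matrix κ κ ℝ) ⊗ₖ g x) (l : List X) :
    ((l.map g).prod).trace = ((l.map f).prod).trace := by
  have h1 : ∀ l : List X, Q * ((1 : Matrix κ κ ℝ) ⊗ₖ (l.map f).prod) * Qᵀ =
      (1 : Matrix κ κ ℝ) ⊗ₖ (l.map g).prod := by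
    intro l
    induction l with
    | nil => simp [mul_eq_one_comm.1 hQ]
    | cons x l ih =>
      have hk : ∀ Y Z : Matrix ι ι ℝ, (1 : Matrix κ κ ℝ) ⊗ₖ (Y * Z) =
          ((1 : Matrix κ κ ℝ) ⊗ₖ Y) * ((1 : Matrix κ κ ℝ) ⊗ₖ Z) := fun Y Z => by
        rw [← mul_kronecker_mul, Matrix.mul_one]
      rw [List.map_cons, List.map_cons, List.prod_cons, List.prod_cons, hk, hk, ← ih, ← h]
      calc Q * (((1 : Matrix κ κ ℝ) ⊗ₖ f x) * ((1 : Matrix κ κ ℝ) ⊗ₖ (l.map f).prod)) * Qᵀ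
          = Q * ((1 : Matrix κ κ ℝ) ⊗ₖ f x) * (Qᵀ * Q) * ((1 : Matrix κ κ ℝ) ⊗ₖ (l.map f).prod) * Qᵀ := by
            rw [hQ, Matrix.mul_one]; simp only [Matrix.mul_assoc]
        _ = _ := by simp only [Matrix.mul_assoc]
  have h2 := congrArg Matrix.trace (h1 l)
  rw [Matrix.trace_mul_comm, ← Matrix.mul_assoc, hQ, Matrix.one_mul, trace_kronecker,
    trace_kronecker, trace_one] at h2
  have h3 : (Fintype.card κ : ℝ) ≠ 0 := Nat.cast_ne_zero.2 Fintype.card_ne_zero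
  exact (mul_left_cancel₀ h3 h2).symm

theorem Rotatable.trace_rotate [Nonempty κ] {R : Fin M → Matrix ι ι ℝ} (h : Rotatable κ R)
    {i j : Fin M} (hij : i ≠ j) {c s : ℝ} (hcs : c ^ 2 + s ^ 2 = 1) (l : List (Fin M)) :
    ((l.map (rotate i j c s R)).prod).trace = ((l.map R).prod).trace := by
  obtain ⟨Q, hQ, hQ'⟩ := h i j hij c s hcs
  exact trace_prod_eq_of_conj hQ hQ' l

end Rotations
end GNY

/-! ### Nilpotency of `R 0 + i R 1` and isotropic kernel vectors -/

namespace GNY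
open Matrix
open scoped Kronecker

section Isotropic

variable {κ : Type} [Fintype κ] [DecidableEq κ]

/-- The complex combination `R₀ + i R₁`. -/
noncomputable def complexPair {ι : Type} (R : Fin 2 → Matrix ι ι ℝ) : Matrix ι ι ℂ :=
  (R 0).map Complex.ofReal + Complex.I • (R 1).map Complex.ofReal

/-- Rotating the pair multiplies `R 0 + i R 1` by the phase `c - i s`, while on the flavors it is a
conjugation. Each flavor contributes one factor of the characteristic polynomial. -/
theorem Rotatable.charpoly_complexPair {ι : Type} [Fintype ι] [DecidableEq ι]
    {R : Fin 2 → Matrix ι ι ℝ} (h : Rotatable κ R) {c s : ℝ} (hcs : c ^ 2 + s ^ 2 = 1) :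
    (((c : ℂ) - s * Complex.I) • complexPair R).charpoly ^ Fintype.card κ =
      (complexPair R).charpoly ^ Fintype.card κ := by
  obtain ⟨Q, hQ, hQ'⟩ := h 0 1 (by decide) c s hcs
  set Q' := Q.map Complex.ofReal with hQ'def
  have hmul : ∀ X Y : Matrix (κ × ι) (κ × ι) ℝ,
      (X * Y).map Complex.ofReal = X.map Complex.ofReal * Y.map Complex.ofReal := fun X Y =>
    Matrix.map_mul (f := Complex.ofRealHom)
  have hk : ∀ X : Matrix ι ι ℝ, ((1 : Matrix κ κ ℝ) ⊗ₖ X).map Complex.ofReal =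
      (1 : Matrix κ κ ℂ) ⊗ₖ X.map Complex.ofReal := by
    intro X
    ext ⟨a, i⟩ ⟨b, j⟩
    by_cases h : a = b <;> simp [h]
  have hQQ : Q'ᵀ * Q' = 1 := by
    have h1 := congrArg (fun X => X.map Complex.ofReal) hQ
    simp only [hmul] at h1
    rw [Matrix.map_one _ Complex.ofReal_zero Complex.ofReal_one] at h1
    exact h1
  have h0 := congrArg (fun X => X.map Complex.ofReal) (hQ' 0)
  have h1 := congrArg (fun X => X.map Complex.ofReal) (hQ' 1)
  simp only [hmul, hk] at h0 h1
  have h2 : Q' * ((1 : Matrix κ κ ℂ) ⊗ₖ complexPair R) * Q'ᵀ =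
      (1 : Matrix κ κ ℂ) ⊗ₖ (((c : ℂ) - s * Complex.I) • complexPair R) := by
    rw [complexPair, kronecker_add, kronecker_smul, Matrix.mul_add, Matrix.add_mul,
      Matrix.mul_smul, Matrix.smul_mul]
    refine (congrArg₂ (fun X Y => X + Complex.I • Y) h0 h1).trans ?_
    rw [← kronecker_smul, ← kronecker_add]
    congr 1
    ext i j
    simp only [rotate, Matrix.add_apply, Matrix.smul_apply, Matrix.map_apply, if_true, smul_eq_mul,
      Complex.ofReal_add, Complex.ofReal_mul, Complex.ofReal_sub, one_ne_zero, if_false,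
      Matrix.sub_apply]
    linear_combination ((s : ℂ) * (R 1 i j)) * Complex.I_sq
  rw [← charpoly_one_kronecker, ← charpoly_one_kronecker, ← h2, Matrix.charpoly_mul_comm,
    ← Matrix.mul_assoc, hQQ, Matrix.one_mul]

/-- With a nonzero eigenvalue all its multiples by phases would be eigenvalues. So the
characteristic polynomial is a pure power, and Cayley-Hamilton applies. -/
theorem Rotatable.complexPair_pow [Nonempty κ] {n : ℕ} {R : Fin 2 → Matrix (Fin n) (Fin n) ℝ}
    (h : Rotatable κ R) : complexPair R ^ n = 0 := by
  have hroot : ∀ μ ∈ (complexPair R).charpoly.roots, μ = 0 := by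
    intro μ hμ
    by_contra hμ0
    -- The rational parametrization of the circle supplies infinitely many distinct phases without
    -- trigonometric functions.
    have hmem : ∀ t : ℝ, μ * (((1 - t ^ 2) / (1 + t ^ 2) : ℝ) + (2 * t / (1 + t ^ 2) : ℝ) * Complex.I) ∈
        (complexPair R).charpoly.roots.toFinset := by
      intro t
      have ht : (1 : ℝ) + t ^ 2 ≠ 0 := by positivity
      set c := (1 - t ^ 2) / (1 + t ^ 2) with hc
      set s := 2 * t / (1 + t ^ 2) with hs
      have hcs : c ^ 2 + s ^ 2 = 1 := by rw [hc, hs]; field_simp; ring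
      have hcs' : ((c : ℂ) - s * Complex.I) * (c + s * Complex.I) = 1 := by
        have := congrArg Complex.ofReal hcs
        push_cast at this
        linear_combination this - s ^ 2 * Complex.I_sq
      have h1 := congrArg (Polynomial.eval μ) (h.charpoly_complexPair hcs)
      rw [Polynomial.eval_pow, Polynomial.eval_pow,
        (Polynomial.mem_roots (charpoly_monic _).ne_zero).1 hμ, zero_pow Fintype.card_ne_zero] at h1
      have h2 := eq_zero_of_pow_eq_zero h1
      rw [Multiset.mem_toFinset, Polynomial.mem_roots (charpoly_monic _).ne_zero,
        Polynomial.IsRoot, eval_charpoly]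
      rw [eval_charpoly] at h2
      have h3 : scalar (Fin n) μ - ((c : ℂ) - s * Complex.I) • complexPair R =
          ((c : ℂ) - s * Complex.I) • (scalar (Fin n) (μ * (c + s * Complex.I)) - complexPair R) := by
        rw [smul_sub]
        congr 1
        ext i j
        simp only [scalar_apply, Matrix.smul_apply, Matrix.diagonal_apply, smul_eq_mul]
        split_ifs
        · linear_combination (-μ) * hcs'
        · simp
      rw [h3, det_smul] at h2
      exact (mul_eq_zero.1 h2).resolve_left (pow_ne_zero _ (left_ne_zero_of_mul_eq_one hcs'))
    refine Set.infinite_range_of_injective (f := fun t : ℝ =>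
      μ * (((1 - t ^ 2) / (1 + t ^ 2) : ℝ) + (2 * t / (1 + t ^ 2) : ℝ) * Complex.I)) ?_
      ((Finset.finite_toSet _).subset (Set.range_subset_iff.2 hmem))
    intro t t' htt
    have h1 := mul_left_cancel₀ hμ0 htt
    have hre := congrArg Complex.re h1
    have him := congrArg Complex.im h1
    simp only [Complex.add_re, Complex.ofReal_re, Complex.mul_re, Complex.I_re, Complex.ofReal_im,
      Complex.I_im, Complex.add_im, Complex.mul_im, mul_zero, mul_one, add_zero,
      zero_add, sub_self] at hre him
    have ht : (0 : ℝ) < 1 + t ^ 2 := by positivity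
    have ht' : (0 : ℝ) < 1 + t' ^ 2 := by positivity
    rw [div_eq_div_iff ht.ne' ht'.ne'] at hre him
    have h2 : t ^ 2 = t' ^ 2 := by linarith
    rw [← h2] at him
    have h3 := mul_right_cancel₀ ht.ne' him
    linarith
  have hX : (complexPair R).charpoly = Polynomial.X ^ n := by
    have h1 := (IsAlgClosed.splits (complexPair R).charpoly).eq_prod_roots_of_monic (charpoly_monic _)
    have h2 := Multiset.eq_replicate_card.2 hroot
    have h3 := (IsAlgClosed.splits (complexPair R).charpoly).natDegree_eq_card_roots
    rw [charpoly_natDegree_eq_dim, Fintype.card_fin] at h3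
    rw [← h3] at h2
    rw [h1, h2]
    simp
  have h4 := Matrix.aeval_self_charpoly (complexPair R)
  rwa [hX, map_pow, Polynomial.aeval_X] at h4

/-- A symmetric nilpotent matrix has an isotropic vector in its kernel. -/
theorem exists_isotropic_ker {n : ℕ} {E : Matrix (Fin n) (Fin n) ℂ} (hE : E.IsSymm) (h0 : E ≠ 0)
    (hn : E ^ n = 0) : ∃ k : Fin n → ℂ, k ≠ 0 ∧ E *ᵥ k = 0 ∧ k ⬝ᵥ k = 0 := by
  have hex : ∃ m, E ^ m = 0 := ⟨n, hn⟩
  classical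
  -- The nilpotency index is written as `m + 2`, since `E ≠ 0`. For `k = E ^ (m + 1) *ᵥ x ≠ 0`,
  -- symmetry gives `k ⬝ k = x ⬝ E ^ (2m + 2) x = 0`.
  obtain ⟨m, hm⟩ : ∃ m, Nat.find hex = m + 2 := by
    refine Nat.exists_eq_add_of_le' ?_
    by_contra hlt
    have h1 := Nat.find_spec hex
    interval_cases hf : Nat.find hex
    · rw [pow_zero] at h1
      exact h0 (by rw [← Matrix.mul_one E, h1, Matrix.mul_zero])
    · exact h0 (by rwa [pow_one] at h1)
  have hz : E ^ (m + 2) = 0 := hm ▸ Nat.find_spec hex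
  have hnz : E ^ (m + 1) ≠ 0 := Nat.find_min hex (by omega)
  obtain ⟨x, hx⟩ : ∃ x, E ^ (m + 1) *ᵥ x ≠ 0 := by
    by_contra hcon
    push Not at hcon
    exact hnz (Matrix.ext_of_mulVec_single fun i => by rw [hcon, Matrix.zero_mulVec])
  refine ⟨_, hx, ?_, ?_⟩
  · rw [mulVec_mulVec, ← pow_succ', hz, zero_mulVec]
  · have hsymm : (E ^ (m + 1))ᵀ = E ^ (m + 1) := by rw [transpose_pow, hE.eq]
    rw [dotProduct_mulVec, ← mulVec_transpose, hsymm, mulVec_mulVec, ← pow_add,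
      show m + 1 + (m + 1) = m + 2 + m by omega, pow_add, hz, Matrix.zero_mul, zero_mulVec,
      zero_dotProduct]

/-- Take the real and imaginary parts of an isotropic vector `k` in the kernel of `R 0 + i R 1`. The
two parts of `k ⬝ k = 0` say that they are orthogonal and of equal length, and those of `E k = 0`
are the two relations. -/
theorem Rotatable.exists_isotropic [Nonempty κ] {n : ℕ} {R : Fin 2 → Matrix (Fin n) (Fin n) ℝ}
    (h : Rotatable κ R) (hR : ∀ m, (R m).IsSymm) (h0 : R ≠ 0) :
    ∃ u v : Fin n → ℝ, u ⬝ᵥ u = 1 ∧ v ⬝ᵥ v = 1 ∧ u ⬝ᵥ v = 0 ∧ R 0 *ᵥ u = R 1 *ᵥ v ∧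
      R 1 *ᵥ u = -(R 0 *ᵥ v) := by
  have hre : ∀ i j, (complexPair R i j).re = R 0 i j := by simp [complexPair]
  have him : ∀ i j, (complexPair R i j).im = R 1 i j := by simp [complexPair]
  obtain ⟨k, hk, hEk, hkk⟩ := exists_isotropic_ker (E := complexPair R) (by
      ext i j
      refine Complex.ext ?_ ?_
      · rw [transpose_apply, hre, hre, (hR 0).apply]
      · rw [transpose_apply, him, him, (hR 1).apply]) (by
      intro hE
      refine h0 (funext fun m => ?_)
      ext i j
      fin_cases m
      · exact (hre i j).symm.trans (by rw [hE]; rfl)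
      · exact (him i j).symm.trans (by rw [hE]; rfl)) h.complexPair_pow
  set u : Fin n → ℝ := fun i => (k i).re with hu
  set v : Fin n → ℝ := fun i => (k i).im with hv
  have h1 : u ⬝ᵥ u = v ⬝ᵥ v := by
    have := congrArg Complex.re hkk
    simp only [dotProduct, Complex.re_sum, Complex.mul_re, Finset.sum_sub_distrib, Complex.zero_re]
      at this
    exact sub_eq_zero.1 this
  have h2 : u ⬝ᵥ v = 0 := by
    have := congrArg Complex.im hkk
    simp only [dotProduct, Complex.im_sum, Complex.mul_im, Finset.sum_add_distrib, Complex.zero_im]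
      at this
    rw [Finset.sum_congr rfl fun i _ => mul_comm (k i).im (k i).re] at this
    simp only [dotProduct, hu, hv]
    linarith
  have h3 : R 0 *ᵥ u = R 1 *ᵥ v := by
    ext i
    have := congrArg Complex.re (congrFun hEk i)
    simp only [mulVec, dotProduct, Complex.re_sum, Complex.mul_re, Finset.sum_sub_distrib, hre, him,
      Pi.zero_apply, Complex.zero_re] at this
    exact sub_eq_zero.1 this
  have h4 : R 1 *ᵥ u = -(R 0 *ᵥ v) := by
    ext i
    have := congrArg Complex.im (congrFun hEk i)
    simp only [mulVec, dotProduct, Complex.im_sum, Complex.mul_im, Finset.sum_add_distrib, hre, him,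
      Pi.zero_apply, Complex.zero_im] at this
    rw [Pi.neg_apply]
    exact eq_neg_of_add_eq_zero_right this
  have hpos : 0 < u ⬝ᵥ u := by
    have hnn : 0 ≤ u ⬝ᵥ u := Finset.sum_nonneg fun i _ => mul_self_nonneg _
    refine hnn.lt_of_ne fun hz => hk (funext fun i => Complex.ext ?_ ?_)
    · exact congrFun (dotProduct_self_eq_zero.1 hz.symm) i
    · exact congrFun (dotProduct_self_eq_zero.1 (h1 ▸ hz.symm)) i
  set t := (Real.sqrt (u ⬝ᵥ u))⁻¹ with ht
  have htt : t * t * (u ⬝ᵥ u) = 1 := by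
    rw [ht, ← mul_inv, Real.mul_self_sqrt hpos.le, inv_mul_cancel₀ hpos.ne']
  refine ⟨t • u, t • v, ?_, ?_, ?_, ?_, ?_⟩
  · rw [smul_dotProduct, dotProduct_smul, smul_eq_mul, smul_eq_mul, ← mul_assoc, htt]
  · rw [smul_dotProduct, dotProduct_smul, smul_eq_mul, smul_eq_mul, ← mul_assoc, ← h1, htt]
  · rw [smul_dotProduct, dotProduct_smul, h2, smul_zero, smul_zero]
  · rw [mulVec_smul, mulVec_smul, h3]
  · rw [mulVec_smul, mulVec_smul, h4, smul_neg]

/-- Two orthonormal vectors are the first columns of an orthogonal matrix. -/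
theorem exists_orthogonal_columns {u v : Fin 4 → ℝ} (hu : u ⬝ᵥ u = 1) (hv : v ⬝ᵥ v = 1)
    (huv : u ⬝ᵥ v = 0) : ∃ A : Matrix (Fin 4) (Fin 4) ℝ, Aᵀ * A = 1 ∧ A * Aᵀ = 1 ∧
      (∀ i, A i 0 = u i) ∧ ∀ i, A i 1 = v i := by
  let w : Fin 4 → EuclideanSpace ℝ (Fin 4) := ![WithLp.toLp 2 u, WithLp.toLp 2 v, 0, 0]
  have hw : Orthonormal ℝ (({0, 1} : Set (Fin 4)).domRestrict w) := by
    rw [orthonormal_iff_ite]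
    rintro ⟨i, rfl | rfl⟩ ⟨j, rfl | rfl⟩
    · exact (EuclideanSpace.inner_toLp_toLp u u).trans hu
    · exact (EuclideanSpace.inner_toLp_toLp u v).trans ((dotProduct_comm _ _).trans huv)
    · exact (EuclideanSpace.inner_toLp_toLp v u).trans huv
    · exact (EuclideanSpace.inner_toLp_toLp v v).trans hv
  obtain ⟨b, hb⟩ := hw.exists_orthonormalBasis_extension_of_card_eq (by simp)
  have hA : (Matrix.of fun i j => b j i)ᵀ * (Matrix.of fun i j => b j i) =
      (1 : Matrix (Fin 4) (Fin 4) ℝ) := by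
    ext i j
    have h1 := orthonormal_iff_ite.1 b.orthonormal i j
    rw [Matrix.one_apply, ← h1, PiLp.inner_apply, Matrix.mul_apply]
    exact Finset.sum_congr rfl fun k _ => mul_comm _ _
  refine ⟨_, hA, mul_eq_one_comm.1 hA, fun i => ?_, fun i => ?_⟩
  · rw [of_apply, hb 0 (by simp)]; rfl
  · rw [of_apply, hb 1 (by simp)]; rfl

end Isotropic
end GNY

/-! ### Trace identities and normal forms of Pauli type -/

namespace GNY
open Matrix
open scoped Kronecker

theorem transpose_fin_four (a b c d e f g h i j k l m n o p : ℝ) :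
    !![a, b, c, d; e, f, g, h; i, j, k, l; m, n, o, p]ᵀ =
      !![a, e, i, m; b, f, j, n; c, g, k, o; d, h, l, p] := by
  ext x y
  fin_cases x <;> fin_cases y <;> rfl

theorem one_fin_four : (1 : Matrix (Fin 4) (Fin 4) ℝ) =
    !![1, 0, 0, 0; 0, 1, 0, 0; 0, 0, 1, 0; 0, 0, 0, 1] := by
  ext i j
  fin_cases i <;> fin_cases j <;> rfl

section Traces

variable {M : ℕ} {ι κ : Type} [Fintype ι] [DecidableEq ι] [Fintype κ] [DecidableEq κ] [Nonempty κ]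
  {R : Fin M → Matrix ι ι ℝ} {i j : Fin M}

/-- Words of odd degree in two Yukawa matrices are traceless. -/
theorem Rotatable.trace_halfTurn (h : Rotatable κ R) (hij : i ≠ j) (l : List (Fin M)) :
    ((l.map fun m => if m = i ∨ m = j then -R m else R m).prod).trace = ((l.map R).prod).trace := by
  have h1 := h.trace_rotate hij (c := -1) (s := 0) (by norm_num) l
  rw [← h1]
  congr 3
  funext m
  unfold rotate
  by_cases h2 : m = i
  · subst h2; simp
  · by_cases h3 : m = j
    · subst h3; simp [h2]
    · simp [h2, h3]

/-- The substitution `R i ↦ R j`, `R j ↦ -R i`. Together with the half turn it yields all the trace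
identities used in the classification. -/
theorem Rotatable.trace_quarterTurn (h : Rotatable κ R) (hij : i ≠ j) (l : List (Fin M)) :
    ((l.map fun m => if m = i then R j else if m = j then -R i else R m).prod).trace =
      ((l.map R).prod).trace := by
  have h1 := h.trace_rotate hij (c := 0) (s := 1) (by norm_num) l
  rw [← h1]
  congr 3
  funext m
  unfold rotate
  split_ifs <;> simp

theorem Rotatable.trace_eq_zero (h : Rotatable κ R) (hij : i ≠ j) : (R i).trace = 0 := by
  have h1 := h.trace_halfTurn hij [i]
  simp at h1
  linarith

theorem Rotatable.trace_cube (h : Rotatable κ R) (hij : i ≠ j) : (R i * R i * R i).trace = 0 := by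
  have h1 := h.trace_halfTurn hij [i, i, i]
  simp [← Matrix.mul_assoc] at h1
  linarith

theorem Rotatable.trace_sq (h : Rotatable κ R) (hij : i ≠ j) :
    (R i * R i).trace = (R j * R j).trace := by
  have h1 := h.trace_quarterTurn hij [i, i]
  simp at h1
  exact h1.symm

theorem Rotatable.trace_mul (h : Rotatable κ R) (hij : i ≠ j) : (R i * R j).trace = 0 := by
  have h1 := h.trace_quarterTurn hij [i, j]
  simp [hij.symm] at h1
  rw [Matrix.trace_mul_comm] at h1
  linarith

theorem Rotatable.trace_pow_four (h : Rotatable κ R) (hij : i ≠ j) :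
    (R i * R i * (R i * R i)).trace = (R j * R j * (R j * R j)).trace := by
  have h1 := h.trace_quarterTurn hij [i, i, i, i]
  simp [← Matrix.mul_assoc] at h1
  simp only [← Matrix.mul_assoc]
  exact h1.symm

theorem Rotatable.trace_mixed_four (h : Rotatable κ R) (hij : i ≠ j) :
    (R i * R i * (R i * R j)).trace + (R i * R j * (R j * R j)).trace = 0 := by
  have h1 := h.trace_quarterTurn hij [i, j, j, j]
  simp [hij.symm, ← Matrix.mul_assoc] at h1
  have h2 : (R j * R i * R i * R i).trace = (R i * R i * (R i * R j)).trace := by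
    rw [← Matrix.mul_assoc, Matrix.mul_assoc (R j), Matrix.mul_assoc (R j), Matrix.trace_mul_comm]
  rw [h2] at h1
  rw [← Matrix.mul_assoc (R i * R j), ← h1]
  ring

end Traces

section NormalForms

/-- The pair of Yukawa matrices `diag(a, b) ⊗ (σ_z, σ_x)`. -/
def pauliPair (a b : ℝ) : Fin 2 → Matrix (Fin 4) (Fin 4) ℝ :=
  ![!![a, 0, 0, 0; 0, -a, 0, 0; 0, 0, b, 0; 0, 0, 0, -b],
    !![0, a, 0, 0; a, 0, 0, 0; 0, 0, 0, b; 0, 0, b, 0]]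

/-- The pair of Yukawa matrices with off-diagonal blocks `diag(p, q)` and `ε diag(p, q)`. -/
def vectorPair (p q : ℝ) : Fin 2 → Matrix (Fin 4) (Fin 4) ℝ :=
  ![!![0, 0, p, 0; 0, 0, 0, q; p, 0, 0, 0; 0, q, 0, 0],
    !![0, 0, 0, -q; 0, 0, p, 0; 0, p, 0, 0; -q, 0, 0, 0]]

/-- The pair of Yukawa matrices with off-diagonal blocks `w` and `w ε` and with lower diagonal blocks
`d σ_z` and `d σ_x`. -/
def cubicPair (w d : ℝ) : Fin 2 → Matrix (Fin 4) (Fin 4) ℝ :=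
  ![!![0, 0, w, 0; 0, 0, 0, w; w, 0, d, 0; 0, w, 0, -d],
    !![0, 0, 0, -w; 0, 0, w, 0; 0, w, 0, d; -w, 0, d, 0]]

theorem exists_angle {x y r : ℝ} (hr : 0 ≤ r) (h : x ^ 2 + y ^ 2 = r ^ 2) :
    ∃ X Y : ℝ, X ^ 2 + Y ^ 2 = 1 ∧ x = r * (X ^ 2 - Y ^ 2) ∧ y = r * (2 * X * Y) := by
  rcases hr.eq_or_lt with rfl | hr
  · refine ⟨1, 0, by norm_num, ?_, ?_⟩ <;> nlinarith [sq_nonneg x, sq_nonneg y]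
  · obtain ⟨X, Y, hXY, h1, h2⟩ := exists_half_angle (c := x / r) (s := y / r) (by
      field_simp; exact h)
    refine ⟨X, Y, hXY, ?_, ?_⟩
    · rw [← h1]; field_simp
    · rw [← h2]; field_simp

/-- A pair of traceless symmetric `2 × 2` matrices of equal length that are orthogonal to each other
is `d (σ_z, σ_x)` in an orthonormal basis. -/
theorem exists_pauli_angle {x y x' y' : ℝ} (h : x ^ 2 + y ^ 2 = x' ^ 2 + y' ^ 2)
    (h' : x * x' + y * y' = 0) : ∃ d X Y τ : ℝ, 0 ≤ d ∧ X ^ 2 + Y ^ 2 = 1 ∧ (τ = 1 ∨ τ = -1) ∧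
      x = d * (X ^ 2 - Y ^ 2) ∧ y = d * (2 * X * Y) ∧
      x' = -(τ * d * (2 * X * Y)) ∧ y' = τ * d * (X ^ 2 - Y ^ 2) := by
  have hd : 0 ≤ x ^ 2 + y ^ 2 := by positivity
  obtain ⟨X, Y, hXY, h1, h2⟩ := exists_angle (Real.sqrt_nonneg _) (Real.sq_sqrt hd).symm
  set d := Real.sqrt (x ^ 2 + y ^ 2)
  -- Two orthogonal plane vectors of equal length differ by a quarter turn in one of two directions.
  -- The sign `τ` records which one, and is arbitrary if both vanish.
  have hτ : ∃ τ : ℝ, (τ = 1 ∨ τ = -1) ∧ x' = -(τ * y) ∧ y' = τ * x := by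
    have h3 : (x' + y) * (x' - y) * (x ^ 2 + y ^ 2) = 0 ∧ (y' - x) * (y' + x) * (x ^ 2 + y ^ 2) = 0 ∧
        (x' + y) * (y' + x) * (x ^ 2 + y ^ 2) = 0 ∧ (x' - y) * (y' - x) * (x ^ 2 + y ^ 2) = 0 := by
      refine ⟨?_, ?_, ?_, ?_⟩
      · linear_combination (x * x' - y * y') * h' - y ^ 2 * h
      · linear_combination (y * y' - x * x') * h' - x ^ 2 * h
      · linear_combination (x * y' + y * x' + x ^ 2 + y ^ 2) * h' + x * y * h
      · linear_combination (x * y' + y * x' - x ^ 2 - y ^ 2) * h' + x * y * h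
    rcases hd.eq_or_lt with h0 | h0
    · have hx : x = 0 := by nlinarith [sq_nonneg x, sq_nonneg y]
      have hy : y = 0 := by nlinarith [sq_nonneg x, sq_nonneg y]
      have hx' : x' = 0 := by nlinarith [sq_nonneg x', sq_nonneg y']
      have hy' : y' = 0 := by nlinarith [sq_nonneg x', sq_nonneg y']
      exact ⟨1, Or.inl rfl, by rw [hx', hy]; norm_num, by rw [hy', hx]; norm_num⟩
    · obtain ⟨e1, e2, e3, e4⟩ := h3
      have e1 := (mul_eq_zero.1 e1).resolve_right h0.ne'
      have e2 := (mul_eq_zero.1 e2).resolve_right h0.ne'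
      have e3 := (mul_eq_zero.1 e3).resolve_right h0.ne'
      have e4 := (mul_eq_zero.1 e4).resolve_right h0.ne'
      by_cases hc : x' + y = 0 ∧ y' - x = 0
      · exact ⟨1, Or.inl rfl, by linarith [hc.1], by linarith [hc.2]⟩
      · refine ⟨-1, Or.inr rfl, ?_, ?_⟩
        · by_contra hne
          have e5 : x' - y ≠ 0 := fun h => hne (by linarith)
          exact hc ⟨(mul_eq_zero.1 e1).resolve_right e5, (mul_eq_zero.1 e4).resolve_left e5⟩
        · by_contra hne
          have e5 : y' + x ≠ 0 := fun h => hne (by linarith)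
          exact hc ⟨(mul_eq_zero.1 e3).resolve_right e5, (mul_eq_zero.1 e2).resolve_right e5⟩
  obtain ⟨τ, hτ, h3, h4⟩ := hτ
  refine ⟨d, X, Y, τ, Real.sqrt_nonneg _, hXY, hτ, h1, h2, ?_, ?_⟩
  · rw [h3, h2]; ring
  · rw [h4, h1]; ring

theorem conj_apply_of_mulVec {n : ℕ} {A R : Matrix (Fin n) (Fin n) ℝ} (hA : Aᵀ * A = 1) {u : Fin n → ℝ}
    {k : Fin n} (hu : ∀ i, A i k = u i) {w : Fin n → ℝ} (h : R *ᵥ u = A *ᵥ w) (i : Fin n) :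
    (Aᵀ * R * A) i k = w i := by
  have h1 : A *ᵥ Pi.single k 1 = u := by
    rw [Matrix.mulVec_single_one]; exact funext hu
  have h2 : (Aᵀ * R * A) *ᵥ Pi.single k 1 = w := by
    rw [← mulVec_mulVec, h1, ← mulVec_mulVec, h, mulVec_mulVec, hA, one_mulVec]
  rw [← h2, Matrix.mulVec_single_one]
  rfl

/-- The orthogonal matrix acting in the last two coordinates. -/
def lowerRotation (X Y τ : ℝ) : Matrix (Fin 4) (Fin 4) ℝ :=
  !![1, 0, 0, 0; 0, 1, 0, 0; 0, 0, X, -(τ * Y); 0, 0, Y, τ * X]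

theorem lowerRotation_orthogonal {X Y τ : ℝ} (h : X ^ 2 + Y ^ 2 = 1) (hτ : τ = 1 ∨ τ = -1) :
    (lowerRotation X Y τ)ᵀ * lowerRotation X Y τ = 1 := by
  rw [lowerRotation, transpose_fin_four, one_fin_four]
  rcases hτ with rfl | rfl <;> simp <;> grind

/-- The orthogonal matrix acting in the first two coordinates. -/
def upperRotation (X Y : ℝ) : Matrix (Fin 4) (Fin 4) ℝ :=
  !![X, -Y, 0, 0; Y, X, 0, 0; 0, 0, 1, 0; 0, 0, 0, 1]

theorem upperRotation_orthogonal {X Y : ℝ} (h : X ^ 2 + Y ^ 2 = 1) :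
    (upperRotation X Y)ᵀ * upperRotation X Y = 1 := by
  rw [upperRotation, transpose_fin_four, one_fin_four]
  simp
  grind

/-- Anticommuting symmetric matrices with equal squares are equivalent to a pair of Pauli type. -/
theorem exists_equivalent_pauliPair {R : Fin 2 → Matrix (Fin 4) (Fin 4) ℝ}
    (hR : ∀ m, (R m).IsSymm) (h0 : R ≠ 0) (ht : ∀ m, (R m).trace = 0)
    (hsq : R 0 * R 0 = R 1 * R 1) (hanti : R 0 * R 1 = -(R 1 * R 0)) :
    ∃ a b, 0 < a ∧ 0 ≤ b ∧ Equivalent R (pauliPair a b) := by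
  have hR0 : R 0 ≠ 0 := by
    intro hz
    refine h0 (funext fun m => ?_)
    fin_cases m
    · exact hz
    · refine eq_zero_of_transpose_mul_self ?_
      change (R 1)ᵀ * R 1 = 0
      rw [(hR 1).eq, ← hsq, hz, Matrix.mul_zero]
  have hH : (R 0).IsHermitian := by
    rw [Matrix.IsHermitian, conjTranspose_eq_transpose_of_trivial]; exact hR 0
  -- A nonzero traceless symmetric matrix has a positive eigenvalue.
  obtain ⟨k, -, ha⟩ : ∃ k ∈ Finset.univ, 0 < hH.eigenvalues k := by
    refine Finset.exists_pos_of_sum_zero_of_exists_nonzero _ ?_ ?_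
    · have h1 := hH.trace_eq_sum_eigenvalues
      rw [ht 0] at h1
      exact h1.symm
    · by_contra hcon
      push Not at hcon
      exact hR0 (hH.eigenvalues_eq_zero_iff.1 (funext fun i => hcon i (Finset.mem_univ i)))
  set a := hH.eigenvalues k with hadef
  set u : Fin 4 → ℝ := ⇑(hH.eigenvectorBasis k) with hu
  have hRu : R 0 *ᵥ u = a • u := hH.mulVec_eigenvectorBasis k
  have huu : u ⬝ᵥ u = 1 := by
    have h1 := hH.eigenvectorBasis.orthonormal.1 k
    have h2 : inner ℝ (hH.eigenvectorBasis k) (hH.eigenvectorBasis k) = 1 := by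
      rw [real_inner_self_eq_norm_sq, h1, one_pow]
    exact (EuclideanSpace.inner_toLp_toLp u u).symm.trans h2
  have hdot : ∀ m (x y : Fin 4 → ℝ), x ⬝ᵥ (R m *ᵥ y) = (R m *ᵥ x) ⬝ᵥ y := by
    intro m x y
    rw [dotProduct_mulVec, ← mulVec_transpose, (hR m).eq]
  -- By anticommutation `R 1` maps the eigenspace of `a` to that of `-a`. So `u` and `v` span a
  -- common invariant plane on which the pair is `a (σ_z, σ_x)`.
  set v : Fin 4 → ℝ := a⁻¹ • (R 1 *ᵥ u) with hv
  have hav : R 1 *ᵥ u = a • v := by rw [hv, smul_smul, mul_inv_cancel₀ ha.ne', one_smul]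
  have hR1v : R 1 *ᵥ v = a • u := by
    rw [hv, mulVec_smul, mulVec_mulVec, ← hsq, ← mulVec_mulVec, hRu, mulVec_smul, hRu, smul_smul,
      inv_mul_cancel₀ ha.ne', one_smul]
  have hR0v : R 0 *ᵥ v = -(a • v) := by
    rw [← hav, hv, mulVec_smul, mulVec_mulVec, hanti, neg_mulVec, ← mulVec_mulVec, hRu, mulVec_smul,
      smul_neg, smul_smul, inv_mul_cancel₀ ha.ne', one_smul]
  have hvv : v ⬝ᵥ v = 1 := by
    have h1 : a * (v ⬝ᵥ v) = a * (u ⬝ᵥ u) := by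
      rw [← smul_eq_mul, ← dotProduct_smul, ← hav, hdot, hR1v, smul_dotProduct, smul_eq_mul]
    rw [huu] at h1
    exact mul_left_cancel₀ ha.ne' h1
  have huv : u ⬝ᵥ v = 0 := by
    have h1 : a * (u ⬝ᵥ v) = -(a * (u ⬝ᵥ v)) := by
      calc a * (u ⬝ᵥ v) = (R 0 *ᵥ u) ⬝ᵥ v := by rw [hRu, smul_dotProduct, smul_eq_mul]
        _ = u ⬝ᵥ (R 0 *ᵥ v) := (hdot 0 _ _).symm
        _ = _ := by rw [hR0v, dotProduct_neg, dotProduct_smul, smul_eq_mul]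
    have h2 : a * (u ⬝ᵥ v) = 0 := by linarith
    exact (mul_eq_zero.1 h2).resolve_left ha.ne'
  obtain ⟨A, hA, hA', hAu, hAv⟩ := exists_orthogonal_columns huu hvv huv
  have hAe0 : A *ᵥ Pi.single 0 1 = u := by rw [Matrix.mulVec_single_one]; exact funext hAu
  have hAe1 : A *ᵥ Pi.single 1 1 = v := by rw [Matrix.mulVec_single_one]; exact funext hAv
  have heq := Equivalent.of_conj (R := R) hA' hA
  set S : Fin 2 → Matrix (Fin 4) (Fin 4) ℝ := fun m => Aᵀ * R m * A with hS
  have hSs := heq.isSymm hR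
  have c00 : ∀ i, S 0 i 0 = (a • Pi.single 0 1 : Fin 4 → ℝ) i :=
    conj_apply_of_mulVec hA hAu (by rw [hRu, mulVec_smul, hAe0])
  have c01 : ∀ i, S 0 i 1 = (-(a • Pi.single 1 1) : Fin 4 → ℝ) i :=
    conj_apply_of_mulVec hA hAv (by rw [hR0v, mulVec_neg, mulVec_smul, hAe1])
  have c10 : ∀ i, S 1 i 0 = (a • Pi.single 1 1 : Fin 4 → ℝ) i :=
    conj_apply_of_mulVec hA hAu (by rw [hav, mulVec_smul, hAe1])
  have c11 : ∀ i, S 1 i 1 = (a • Pi.single 0 1 : Fin 4 → ℝ) i :=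
    conj_apply_of_mulVec hA hAv (by rw [hR1v, mulVec_smul, hAe0])
  have hmul : ∀ m m', S m * S m' = Aᵀ * (R m * R m') * A := by
    intro m m'
    simp only [hS]
    calc Aᵀ * R m * A * (Aᵀ * R m' * A) = Aᵀ * R m * (A * Aᵀ) * R m' * A := by
          simp only [Matrix.mul_assoc]
      _ = _ := by rw [hA', Matrix.mul_one]; simp only [Matrix.mul_assoc]
  have hSt : ∀ m, (S m).trace = 0 := fun m => by
    rw [hS]; simp only
    rw [Matrix.trace_mul_comm, ← Matrix.mul_assoc, hA', Matrix.one_mul, ht]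
  have hSsq : S 0 * S 0 = S 1 * S 1 := by rw [hmul, hmul, hsq]
  have hSanti : S 0 * S 1 = -(S 1 * S 0) := by rw [hmul, hmul, hanti, Matrix.mul_neg, Matrix.neg_mul]
  have hS0 : S 0 = !![a, 0, 0, 0; 0, -a, 0, 0; 0, 0, S 0 2 2, S 0 2 3; 0, 0, S 0 2 3, -S 0 2 2] := by
    have h1 := hSt 0
    simp only [Matrix.trace, Fin.sum_univ_four, Matrix.diag_apply, c00, c01] at h1
    simp at h1
    ext i j
    fin_cases i <;> fin_cases j <;> simp [c00, c01]
    · rw [(hSs 0).apply]; simp [c00]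
    · rw [(hSs 0).apply]; simp [c00]
    · rw [(hSs 0).apply]; simp [c01]
    · rw [(hSs 0).apply]; simp [c01]
    · rw [(hSs 0).apply]
    · linarith
  have hS1 : S 1 = !![0, a, 0, 0; a, 0, 0, 0; 0, 0, S 1 2 2, S 1 2 3; 0, 0, S 1 2 3, -S 1 2 2] := by
    have h1 := hSt 1
    simp only [Matrix.trace, Fin.sum_univ_four, Matrix.diag_apply, c10, c11] at h1
    simp at h1
    ext i j
    fin_cases i <;> fin_cases j <;> simp [c10, c11]
    · rw [(hSs 1).apply]; simp [c10]
    · rw [(hSs 1).apply]; simp [c10]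
    · rw [(hSs 1).apply]; simp [c11]
    · rw [(hSs 1).apply]; simp [c11]
    · rw [(hSs 1).apply]
    · linarith
  -- On the orthogonal plane both blocks are traceless symmetric. One diagonal entry of each
  -- algebraic relation gives the equal lengths and the orthogonality needed for the Pauli form.
  obtain ⟨b, X, Y, τ, hb, hXY, hτ, e1, e2, e3, e4⟩ := exists_pauli_angle
    (x := S 0 2 2) (y := S 0 2 3) (x' := S 1 2 2) (y' := S 1 2 3) (by
      have h1 := congrFun (congrFun hSsq 2) 2
      rw [hS0, hS1] at h1
      simp [Matrix.mul_apply, Fin.sum_univ_four] at h1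
      linarith) (by
      have h1 := congrFun (congrFun hSanti 2) 2
      rw [hS0, hS1] at h1
      simp [Matrix.mul_apply, Fin.sum_univ_four] at h1
      linarith)
  refine ⟨a, b, ha, hb, heq.trans ⟨lowerRotation X Y τ, lowerRotation_orthogonal hXY hτ,
    mul_eq_one_comm.1 (lowerRotation_orthogonal hXY hτ), fun m => ?_⟩⟩
  fin_cases m
  · change S 0 = _
    rw [hS0, e1, e2, lowerRotation, transpose_fin_four]
    rcases hτ with rfl | rfl <;> simp [pauliPair] <;> grind
  · change S 1 = _
    rw [hS1, e3, e4, lowerRotation, transpose_fin_four]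
    simp [pauliPair]
    grind

end NormalForms
end GNY

/-! ### Classification of pairs -/

namespace GNY
open Matrix
open scoped Kronecker

section PairClassification

variable {κ : Type} [Fintype κ] [DecidableEq κ] [Nonempty κ]

/-- The pair of Yukawa matrices in a basis whose first two vectors are the real and imaginary parts
of an isotropic vector in the kernel of `R₀ + i R₁`. -/
def isotropicPair (a b p q r s x y x' y' : ℝ) : Fin 2 → Matrix (Fin 4) (Fin 4) ℝ :=
  ![!![a, b, p, q; b, -a, r, s; p, r, x, y; q, s, y, -x],
    !![-b, a, -r, -s; a, b, p, q; -r, p, x', y'; -s, q, y', -x']]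

/-- In a basis starting with `u` and `v`, the isotropy relations identify the first two columns of
`R 1` with those of `R 0`, exchanged and up to sign. Symmetry and tracelessness give the rest of the
shape. -/
theorem Rotatable.exists_isotropicPair {R : Fin 2 → Matrix (Fin 4) (Fin 4) ℝ} (h : Rotatable κ R)
    (hR : ∀ m, (R m).IsSymm) (h0 : R ≠ 0) :
    ∃ a b p q r s x y x' y', Equivalent R (isotropicPair a b p q r s x y x' y') := by
  obtain ⟨u, v, hu, hv, huv, h1, h2⟩ := h.exists_isotropic hR h0
  obtain ⟨A, hA, hA', hAu, hAv⟩ := exists_orthogonal_columns hu hv huv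
  have heq := Equivalent.of_conj (R := R) hA' hA
  set S : Fin 2 → Matrix (Fin 4) (Fin 4) ℝ := fun m => Aᵀ * R m * A with hS
  have hSs := heq.isSymm hR
  have hSr := h.of_equivalent heq
  have hcol : ∀ m k (w : Fin 4 → ℝ), (∀ i, A i k = w i) → ∀ i, S m i k = (Aᵀ *ᵥ (R m *ᵥ w)) i := by
    intro m k w hw
    refine conj_apply_of_mulVec hA hw ?_
    rw [mulVec_mulVec, hA', one_mulVec]
  have k1 : ∀ i, S 1 i 1 = S 0 i 0 := fun i => by rw [hcol 1 1 v hAv, hcol 0 0 u hAu, h1]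
  have k2 : ∀ i, S 1 i 0 = -S 0 i 1 := fun i => by
    rw [hcol 1 0 u hAu, hcol 0 1 v hAv, h2, mulVec_neg, Pi.neg_apply]
  have t0 := hSr.trace_eq_zero (i := 0) (j := 1) (by decide)
  have t1 := hSr.trace_eq_zero (i := 1) (j := 0) (by decide)
  simp only [Matrix.trace, Fin.sum_univ_four, Matrix.diag_apply] at t0 t1
  have hd : S 0 1 1 = -S 0 0 0 := by
    have e1 := (hSs 1).apply 0 1
    rw [k2, k1] at e1
    linarith
  refine ⟨S 0 0 0, S 0 0 1, S 0 0 2, S 0 0 3, S 0 1 2, S 0 1 3, S 0 2 2, S 0 2 3, S 1 2 2, S 1 2 3,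
    heq.trans ⟨1, by simp, by simp, fun m => ?_⟩⟩
  rw [Matrix.one_mul, transpose_one, Matrix.mul_one]
  have s0 := fun i j => (hSs 0).apply i j
  have s1 := fun i j => (hSs 1).apply i j
  have e10 := s0 1 0
  have e20 := s0 2 0
  have e30 := s0 3 0
  have e21 := s0 2 1
  have e31 := s0 3 1
  have e32 := s0 3 2
  fin_cases m
  · change S 0 = _
    ext i j
    fin_cases i <;> fin_cases j <;> simp [isotropicPair] <;> linarith
  · change S 1 = _
    have f02 := s1 0 2
    have f03 := s1 0 3
    have f12 := s1 1 2
    have f13 := s1 1 3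
    have f32 := s1 3 2
    rw [k2] at f02 f03
    rw [k1] at f12 f13
    rw [k1, k2] at t1
    ext i j
    fin_cases i <;> fin_cases j <;> simp [isotropicPair, k1, k2] <;> linarith

theorem equivalent_lowerRotation (a b p q r s d : ℝ) {X Y τ : ℝ} (h : X ^ 2 + Y ^ 2 = 1)
    (hτ : τ = 1 ∨ τ = -1) :
    Equivalent (isotropicPair a b p q r s (d * (X ^ 2 - Y ^ 2)) (d * (2 * X * Y))
        (-(τ * d * (2 * X * Y))) (τ * d * (X ^ 2 - Y ^ 2)))
      (isotropicPair a b (p * X + q * Y) (τ * (q * X - p * Y)) (r * X + s * Y) (τ * (s * X - r * Y))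
        d 0 0 d) := by
  have hAA := lowerRotation_orthogonal h hτ
  have hAA' := mul_eq_one_comm.1 hAA
  set A := lowerRotation X Y τ with hA
  refine Equivalent.trans (Equivalent.of_conj hAA' hAA) ⟨1, by simp, by simp, fun m => ?_⟩
  rw [Matrix.one_mul, transpose_one, Matrix.mul_one]
  have h2 : (X ^ 2 + Y ^ 2) ^ 2 = 1 := by rw [h]; norm_num
  rw [hA, lowerRotation, transpose_fin_four]
  rcases hτ with rfl | rfl <;> fin_cases m <;> simp [isotropicPair] <;> grind

theorem equivalent_upperRotation (a b p q r s d : ℝ) {X Y : ℝ} (h : X ^ 2 + Y ^ 2 = 1) :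
    Equivalent (isotropicPair (a * (X ^ 2 - Y ^ 2) - 2 * X * Y * b)
        (b * (X ^ 2 - Y ^ 2) + 2 * X * Y * a) p q r s d 0 0 d)
      (isotropicPair a b (X * p + Y * r) (X * q + Y * s) (X * r - Y * p) (X * s - Y * q) d 0 0 d) := by
  have hAA := upperRotation_orthogonal h
  have hAA' := mul_eq_one_comm.1 hAA
  set A := upperRotation X Y with hA
  refine Equivalent.trans (Equivalent.of_conj hAA' hAA) ⟨1, by simp, by simp, fun m => ?_⟩
  rw [Matrix.one_mul, transpose_one, Matrix.mul_one]
  have h2 : (X ^ 2 + Y ^ 2) ^ 2 = 1 := by rw [h]; norm_num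
  rw [hA, upperRotation, transpose_fin_four]
  fin_cases m <;> simp [isotropicPair] <;> grind

theorem Equivalent.ne_zero {M : ℕ} {ι ι' : Type} [Fintype ι] [DecidableEq ι] [Fintype ι']
    [DecidableEq ι'] {R : Fin M → Matrix ι ι ℝ} {R' : Fin M → Matrix ι' ι' ℝ} (h : Equivalent R R')
    (h0 : R ≠ 0) : R' ≠ 0 := by
  rintro rfl
  obtain ⟨A, -, -, hR⟩ := h
  exact h0 (funext fun m => by simp [hR])

/-- A singular value decomposition of the block with rows `(p, q)` and `(r, s)`: a rotation of the
isotropic plane makes the rows orthogonal with the longer one first, and a rotation of the other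
plane makes the block diagonal. The hypothesis is that the discriminant of its Gram matrix is
positive, so the singular values differ. -/
theorem exists_equivalent_vectorPair {p q r s : ℝ}
    (h : 0 < (r ^ 2 + s ^ 2 - p ^ 2 - q ^ 2) ^ 2 + 4 * (p * r + q * s) ^ 2) :
    ∃ p' q', q' ^ 2 < p' ^ 2 ∧ Equivalent (isotropicPair 0 0 p q r s 0 0 0 0) (vectorPair p' q') := by
  set m := r ^ 2 + s ^ 2 - p ^ 2 - q ^ 2 with hm
  set n := p * r + q * s with hn
  obtain ⟨X, Y, hXY, h1, h2⟩ := exists_angle (x := -m) (y := 2 * n)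
    (Real.sqrt_nonneg (m ^ 2 + 4 * n ^ 2)) (by rw [Real.sq_sqrt h.le]; ring)
  have hh := Real.sqrt_pos.2 h
  set e := Real.sqrt (m ^ 2 + 4 * n ^ 2)
  have heq := equivalent_upperRotation 0 0 p q r s 0 hXY
  simp only [zero_mul, mul_zero, sub_zero, add_zero] at heq
  set p₁ := X * p + Y * r with hp₁
  set q₁ := X * q + Y * s with hq₁
  set r₁ := X * r - Y * p with hr₁
  set s₁ := X * s - Y * q with hs₁
  have horth : p₁ * r₁ + q₁ * s₁ = 0 := by
    have : p₁ * r₁ + q₁ * s₁ = (X ^ 2 - Y ^ 2) * n + X * Y * m := by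
      rw [hm, hn]; simp only [hp₁, hq₁, hr₁, hs₁]; ring
    rw [this]
    linear_combination ((X ^ 2 - Y ^ 2) / 2) * h2 - (X * Y) * h1
  have hlt : p₁ ^ 2 + q₁ ^ 2 - (r₁ ^ 2 + s₁ ^ 2) = e := by
    have : p₁ ^ 2 + q₁ ^ 2 - (r₁ ^ 2 + s₁ ^ 2) = -(X ^ 2 - Y ^ 2) * m + 4 * X * Y * n := by
      rw [hm, hn]; simp only [hp₁, hq₁, hr₁, hs₁]; ring
    rw [this]
    linear_combination (X ^ 2 - Y ^ 2) * h1 + (2 * X * Y) * h2 + e * (X ^ 2 + Y ^ 2 + 1) * hXY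
  have hP : 0 < p₁ ^ 2 + q₁ ^ 2 := by nlinarith [sq_nonneg r₁, sq_nonneg s₁]
  set P := Real.sqrt (p₁ ^ 2 + q₁ ^ 2) with hPdef
  have hP0 : 0 < P := Real.sqrt_pos.2 hP
  have hPP : P ^ 2 = p₁ ^ 2 + q₁ ^ 2 := Real.sq_sqrt hP.le
  have hXY' : (p₁ / P) ^ 2 + (q₁ / P) ^ 2 = 1 := by field_simp; exact hPP.symm
  have heq' := equivalent_lowerRotation 0 0 p₁ q₁ r₁ s₁ 0 hXY' (Or.inl rfl)
  simp only [zero_mul, mul_zero, one_mul, neg_zero] at heq'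
  have e1 : p₁ * (p₁ / P) + q₁ * (q₁ / P) = P := by field_simp; exact hPP.symm
  have e2 : q₁ * (p₁ / P) - p₁ * (q₁ / P) = 0 := by ring
  have e3 : r₁ * (p₁ / P) + s₁ * (q₁ / P) = 0 := by
    rw [← mul_div_assoc, ← mul_div_assoc, ← add_div, mul_comm r₁, mul_comm s₁, horth, zero_div]
  rw [e1, e2, e3] at heq'
  set Q := s₁ * (p₁ / P) - r₁ * (q₁ / P) with hQ
  have hQQ : Q ^ 2 = r₁ ^ 2 + s₁ ^ 2 := by
    have : Q ^ 2 + (r₁ * (p₁ / P) + s₁ * (q₁ / P)) ^ 2 =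
        (r₁ ^ 2 + s₁ ^ 2) * ((p₁ / P) ^ 2 + (q₁ / P) ^ 2) := by rw [hQ]; ring
    rw [e3, hXY'] at this
    linarith
  refine ⟨P, Q, by rw [hPP, hQQ]; linarith, heq.trans (heq'.trans ⟨1, by simp, by simp, fun m => ?_⟩)⟩
  rw [Matrix.one_mul, transpose_one, Matrix.mul_one]
  fin_cases m <;> simp [isotropicPair, vectorPair]

/-- The off-diagonal block is `w` times a rotation, which is undone in the isotropic plane. -/
theorem exists_equivalent_cubicPair {p q d : ℝ} (h : 0 < p ^ 2 + q ^ 2) :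
    ∃ w, w ≠ 0 ∧ Equivalent (isotropicPair 0 0 p q (-q) p d 0 0 d) (cubicPair w d) := by
  set w := Real.sqrt (p ^ 2 + q ^ 2) with hw
  have hw0 : 0 < w := Real.sqrt_pos.2 h
  have hww : w ^ 2 = p ^ 2 + q ^ 2 := Real.sq_sqrt h.le
  have heq := equivalent_upperRotation 0 0 p q (-q) p d (X := p / w) (Y := -q / w) (by
    field_simp; linarith)
  simp only [zero_mul, mul_zero, sub_zero, add_zero] at heq
  have e1 : p / w * p + -q / w * -q = w := by field_simp; linarith
  have e2 : p / w * q + -q / w * p = 0 := by ring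
  have e3 : p / w * -q - -q / w * p = 0 := by ring
  have e4 : p / w * p - -q / w * q = w := by field_simp; linarith
  rw [e1, e2, e3, e4] at heq
  refine ⟨w, hw0.ne', heq.trans ⟨1, by simp, by simp, fun m => ?_⟩⟩
  rw [Matrix.one_mul, transpose_one, Matrix.mul_one]
  fin_cases m <;> simp [isotropicPair, cubicPair]

/-- Put `α = (p + s) + i (q - r)`, `ρ = (p - s) - i (q + r)` and `β = a + i b`. The cubic traces are
the real and imaginary parts of `α (d ρ̄ + ρ β) = 0`, and the quartic ones those of `d α² β = 0`. -/
theorem isotropicPair_constraints {a b p q r s d : ℝ}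
    (hr : Rotatable κ (isotropicPair a b p q r s d 0 0 d)) :
    d * (p ^ 2 + r ^ 2 - q ^ 2 - s ^ 2) + a * (p ^ 2 + q ^ 2 - r ^ 2 - s ^ 2) +
      2 * b * (p * r + q * s) = 0 ∧
    2 * d * (p * q + r * s) + b * (p ^ 2 + q ^ 2 - r ^ 2 - s ^ 2) - 2 * a * (p * r + q * s) = 0 ∧
    d * (a * ((p + s) ^ 2 - (q - r) ^ 2) - 2 * b * (p + s) * (q - r)) = 0 ∧
    d * (b * ((p + s) ^ 2 - (q - r) ^ 2) + 2 * a * (p + s) * (q - r)) = 0 := by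
  refine ⟨?_, ?_, ?_, ?_⟩
  · have h1 := hr.trace_cube (i := 0) (j := 1) (by decide)
    simp [isotropicPair, Matrix.trace, Fin.sum_univ_four] at h1
    linarith
  · have h1 := hr.trace_cube (i := 1) (j := 0) (by decide)
    simp [isotropicPair, Matrix.trace, Fin.sum_univ_four] at h1
    linarith
  · have h1 := hr.trace_pow_four (i := 0) (j := 1) (by decide)
    simp [isotropicPair, Matrix.trace, Fin.sum_univ_four] at h1
    linarith
  · have h1 := hr.trace_mixed_four (i := 0) (j := 1) (by decide)
    simp [isotropicPair, Matrix.trace, Fin.sum_univ_four] at h1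
    linarith

/-- In complex notation the two alternatives are `α = 0`, and `d = 0` with `ρ = 0`. In both, `R 0 +
i R 1` squares to zero, which is what the two relations say. -/
theorem isotropicPair_clifford {a b p q r s d : ℝ} (h : (s = -p ∧ r = q) ∨ (d = 0 ∧ s = p ∧ r = -q)) :
    let S := isotropicPair a b p q r s d 0 0 d
    S 0 * S 0 = S 1 * S 1 ∧ S 0 * S 1 = -(S 1 * S 0) := by
  have h1 : ∀ r s d, isotropicPair a b p q r s d 0 0 d 0 =
    !![a, b, p, q; b, -a, r, s; p, r, d, 0; q, s, 0, -d] := fun r s d => rfl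
  have h2 : ∀ r s d, isotropicPair a b p q r s d 0 0 d 1 =
    !![-b, a, -r, -s; a, b, p, q; -r, p, 0, d; -s, q, d, 0] := fun r s d => by
      simp [isotropicPair]
  simp only [h1, h2]
  have h3 : ∀ A B : Matrix (Fin 4) (Fin 4) ℝ, (∀ i, A i 0 = B i 0 ∧ A i 1 = B i 1 ∧ A i 2 = B i 2 ∧
      A i 3 = B i 3) → A = B := by
    intro A B h
    ext i j
    fin_cases j
    exacts [(h i).1, (h i).2.1, (h i).2.2.1, (h i).2.2.2]
  rcases h with ⟨rfl, rfl⟩ | ⟨rfl, rfl, rfl⟩ <;> refine ⟨h3 _ _ fun i => ?_, h3 _ _ fun i => ?_⟩ <;>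
    simp only [Matrix.neg_apply, Matrix.mul_apply, Fin.sum_univ_four] <;> fin_cases i <;>
    refine ⟨?_, ?_, ?_, ?_⟩ <;> simp <;> ring

/-- The classification of pairs of Yukawa matrices with unbroken rotations. -/
theorem Rotatable.pair_classification {R : Fin 2 → Matrix (Fin 4) (Fin 4) ℝ} (h : Rotatable κ R)
    (hR : ∀ m, (R m).IsSymm) (h0 : R ≠ 0) :
    (∃ a b, 0 < a ∧ 0 ≤ b ∧ Equivalent R (pauliPair a b)) ∨
      (∃ p q, q ^ 2 < p ^ 2 ∧ Equivalent R (vectorPair p q)) ∨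
      ∃ w d, w ≠ 0 ∧ d ≠ 0 ∧ Equivalent R (cubicPair w d) := by
  obtain ⟨a, b, p, q, r, s, x, y, x', y', heq⟩ := h.exists_isotropicPair hR h0
  have hr := h.of_equivalent heq
  obtain ⟨d, X, Y, τ, -, hXY, hτ, rfl, rfl, rfl, rfl⟩ := exists_pauli_angle (x := x) (y := y)
    (x' := x') (y' := y') (by
      have h1 := hr.trace_sq (i := 0) (j := 1) (by decide)
      simp [isotropicPair, Matrix.trace, Fin.sum_univ_four] at h1
      linarith) (by
      have h1 := hr.trace_mul (i := 0) (j := 1) (by decide)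
      simp [isotropicPair, Matrix.trace, Fin.sum_univ_four] at h1
      linarith)
  clear hr
  replace heq := heq.trans (equivalent_lowerRotation a b p q r s d hXY hτ)
  generalize p * X + q * Y = p at heq
  generalize τ * (q * X - _) = q at heq
  generalize r * X + s * Y = r at heq
  generalize τ * (s * X - _) = s at heq
  have hr := h.of_equivalent heq
  have hs := heq.isSymm hR
  obtain ⟨c0, c1, f0, f1⟩ := isotropicPair_constraints hr
  have hpauli : (s = -p ∧ r = q) ∨ (d = 0 ∧ s = p ∧ r = -q) →
      ∃ a b, 0 < a ∧ 0 ≤ b ∧ Equivalent R (pauliPair a b) := by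
    intro hcase
    have hcl := isotropicPair_clifford (a := a) (b := b) hcase
    obtain ⟨a', b', ha', hb', heq'⟩ := exists_equivalent_pauliPair hs (heq.ne_zero h0) (fun m => by
      fin_cases m
      · exact hr.trace_eq_zero (i := 0) (j := 1) (by decide)
      · exact hr.trace_eq_zero (i := 1) (j := 0) (by decide)) hcl.1 hcl.2
    exact ⟨a', b', ha', hb', heq.trans heq'⟩
  -- The constraints become two complex equations that factor. A Pauli pair results if `α = 0`, or
  -- if `ρ = 0` and `d = 0`; a cubic pair if `ρ = 0` but `α, d ≠ 0`, which forces `β = 0`; and a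
  -- vector pair if `α, ρ ≠ 0`, which forces `d = β = 0`.
  let α : ℂ := ⟨p + s, q - r⟩
  let ρ : ℂ := ⟨p - s, -(q + r)⟩
  let β : ℂ := ⟨a, b⟩
  have hC : α * (d * (starRingEnd ℂ) ρ + ρ * β) = 0 := by
    refine Complex.ext ?_ ?_ <;> simp [α, ρ, β] <;> linarith
  have hQ : α * α * d * β = 0 := by
    refine Complex.ext ?_ ?_ <;> simp [α, β] <;> linarith
  by_cases hα : α = 0
  · left
    have e1 := congrArg Complex.re hα
    have e2 := congrArg Complex.im hα
    simp only [α, Complex.zero_re, Complex.zero_im] at e1 e2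
    exact hpauli (Or.inl ⟨by linarith, by linarith⟩)
  have hC' := (mul_eq_zero.1 hC).resolve_left hα
  have hQ' : (d : ℂ) * β = 0 := by
    rw [mul_assoc] at hQ
    exact (mul_eq_zero.1 hQ).resolve_left (mul_ne_zero hα hα)
  by_cases hρ : ρ = 0
  · have e1 := congrArg Complex.re hρ
    have e2 := congrArg Complex.im hρ
    simp only [ρ, Complex.zero_re, Complex.zero_im] at e1 e2
    by_cases hd : d = 0
    · left
      exact hpauli (Or.inr ⟨hd, by linarith, by linarith⟩)
    · right; right
      have hβ := (mul_eq_zero.1 hQ').resolve_left (Complex.ofReal_ne_zero.2 hd)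
      have e3 := congrArg Complex.re hβ
      have e4 := congrArg Complex.im hβ
      simp only [β, Complex.zero_re, Complex.zero_im] at e3 e4
      obtain rfl : p = s := by linarith
      obtain rfl : r = -q := by linarith
      subst e3 e4
      obtain ⟨w, hw, heq'⟩ := exists_equivalent_cubicPair (p := p) (q := q) (d := d) (by
        by_contra hle
        refine hα (Complex.ext ?_ ?_) <;> simp only [α, Complex.zero_re, Complex.zero_im] <;>
          nlinarith [sq_nonneg p, sq_nonneg q])
      exact ⟨w, d, hw, hd, heq.trans heq'⟩
  · right; left
    have hd : d = 0 ∧ β = 0 := by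
      rcases mul_eq_zero.1 hQ' with hd | hβ
      · rw [hd, zero_mul, zero_add] at hC'
        exact ⟨Complex.ofReal_eq_zero.1 hd, (mul_eq_zero.1 hC').resolve_left hρ⟩
      · rw [hβ, mul_zero, add_zero] at hC'
        exact ⟨Complex.ofReal_eq_zero.1 ((mul_eq_zero.1 hC').resolve_right
          ((map_ne_zero _).2 hρ)), hβ⟩
    obtain ⟨rfl, hβ⟩ := hd
    have e3 := congrArg Complex.re hβ
    have e4 := congrArg Complex.im hβ
    simp only [β, Complex.zero_re, Complex.zero_im] at e3 e4
    subst e3 e4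
    obtain ⟨p', q', hpq, heq'⟩ := exists_equivalent_vectorPair (p := p) (q := q) (r := r) (s := s) (by
      -- The discriminant of the Gram matrix of the block is the squared modulus of `α ρ`.
      have h1 : (r ^ 2 + s ^ 2 - p ^ 2 - q ^ 2) ^ 2 + 4 * (p * r + q * s) ^ 2 =
          Complex.normSq (α * ρ) := by
        simp only [α, ρ, Complex.normSq_apply, Complex.mul_re, Complex.mul_im]
        ring
      rw [h1]
      exact Complex.normSq_pos.2 (mul_ne_zero hα hρ))
    exact ⟨p', q', hpq, heq.trans heq'⟩

end PairClassification
end GNY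

/-! ### Representations of `O(2)` and its double cover by itself -/

namespace GNY
open Matrix
open scoped Kronecker

section PlaneGroup

theorem O.fin_two_entries (g : O (Fin 2)) :
    (g.1.det = 1 ∨ g.1.det = -1) ∧ g.1 0 1 = -(g.1 1 0 * g.1.det) ∧ g.1 1 1 = g.1 0 0 * g.1.det ∧
      g.1 0 0 ^ 2 + g.1 1 0 ^ 2 = 1 := by
  have h := g.transpose_mul_self
  have h00 := congrFun (congrFun h 0) 0
  have h01 := congrFun (congrFun h 0) 1
  have h11 := congrFun (congrFun h 1) 1
  simp only [Matrix.mul_apply, Fin.sum_univ_two, transpose_apply, Matrix.one_apply, if_true,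
    zero_ne_one, if_false] at h00 h01 h11
  have hd := congrArg Matrix.det h
  rw [det_mul, det_transpose, det_one] at hd
  refine ⟨mul_self_eq_one_iff.1 hd, ?_, ?_, by linarith⟩
  · rw [det_fin_two]
    linear_combination g.1 0 0 * h01 - g.1 0 1 * h00
  · rw [det_fin_two]
    linear_combination g.1 1 0 * h01 - g.1 1 1 * h00

/-- The first column of a `2 × 2` matrix as a complex number. -/
def columnComplex (g : O (Fin 2)) : ℂ := ⟨g.1 0 0, g.1 1 0⟩

/-- The representation of `O(2)` of angular momentum `n`, in which reflections with determinant `-1`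
fix the first basis vector. -/
noncomputable def angularMatrix (n : ℕ) (g : O (Fin 2)) : Matrix (Fin 2) (Fin 2) ℝ :=
  !![(columnComplex g ^ n).re, -((columnComplex g ^ n).im * g.1.det);
    (columnComplex g ^ n).im, (columnComplex g ^ n).re * g.1.det]

theorem columnComplex_mul_conj (g : O (Fin 2)) :
    columnComplex g * (starRingEnd ℂ) (columnComplex g) = 1 := by
  have h := g.fin_two_entries.2.2.2
  refine Complex.ext ?_ ?_ <;> simp [columnComplex]
  · linarith
  · ring

/-- An element of `O(2)` is its first column `z` together with its determinant, and a reflection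
conjugates the column of the factor to its right. Both rules survive `z ↦ z ^ n`, which makes
`angular` a homomorphism. -/
theorem columnComplex_mul (g h : O (Fin 2)) :
    (g.1.det = 1 → columnComplex (g * h) = columnComplex g * columnComplex h) ∧
      (g.1.det = -1 → columnComplex (g * h) = columnComplex g * (starRingEnd ℂ) (columnComplex h)) := by
  obtain ⟨-, h1, h2, -⟩ := g.fin_two_entries
  have e : ∀ i, (g * h).1 i 0 = g.1 i 0 * h.1 0 0 + g.1 i 1 * h.1 1 0 := fun i => by
    change (g.1 * h.1) i 0 = _
    rw [Matrix.mul_apply, Fin.sum_univ_two]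
  constructor <;> intro hd <;> rw [hd] at h1 h2 <;>
    refine Complex.ext ?_ ?_ <;> simp [columnComplex, e, h1, h2] <;> ring

/-- The representation of `O(2)` of angular momentum `n`. -/
noncomputable def angular (n : ℕ) : O (Fin 2) →* O (Fin 2) :=
  O.hom (angularMatrix n) (by
    have h : columnComplex 1 = 1 := by
      refine Complex.ext ?_ ?_ <;> simp [columnComplex]
    rw [angularMatrix, h, one_pow]
    ext i j
    fin_cases i <;> fin_cases j <;> simp) (by
    intro g h
    have hd : (g * h).1.det = g.1.det * h.1.det := det_mul _ _
    have hc : ∀ u v : ℂ, (u * (starRingEnd ℂ) v) ^ n = u ^ n * (starRingEnd ℂ) (v ^ n) := fun u v => by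
      rw [mul_pow, map_pow]
    rcases g.fin_two_entries.1 with h1 | h1
    · have h2 := (columnComplex_mul g h).1 h1
      simp only [angularMatrix, hd, h1, h2, mul_pow]
      generalize columnComplex h ^ n = v
      generalize columnComplex g ^ n = u
      ext i j
      fin_cases i <;> fin_cases j <;> simp [Matrix.mul_apply, Fin.sum_univ_two] <;> ring
    · have h2 := (columnComplex_mul g h).2 h1
      simp only [angularMatrix, hd, h1, h2, hc]
      generalize columnComplex h ^ n = v
      generalize columnComplex g ^ n = u
      ext i j
      fin_cases i <;> fin_cases j <;> simp [Matrix.mul_apply, Fin.sum_univ_two] <;> ring) (by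
    intro g
    have h0 : columnComplex g ^ n * (starRingEnd ℂ) (columnComplex g ^ n) = 1 := by
      rw [map_pow, ← mul_pow, columnComplex_mul_conj, one_pow]
    have h1 := congrArg Complex.re h0
    simp only [Complex.mul_re, Complex.conj_re, Complex.conj_im, Complex.one_re] at h1
    rcases g.fin_two_entries.1 with hd | hd <;> ext i j <;> fin_cases i <;> fin_cases j <;>
      simp [angularMatrix, Matrix.mul_apply, Fin.sum_univ_two, hd, -map_pow] <;>
      first | ring1 | linear_combination h1)

theorem angular_coe (n : ℕ) (g : O (Fin 2)) : (angular n g).1 = angularMatrix n g := rfl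

theorem continuous_angular (n : ℕ) : Continuous (angular n) := by
  refine O.continuous_hom ?_
  have h0 : ∀ i j, Continuous fun g : O (Fin 2) => g.1 i j := fun i j =>
    continuous_subtype_val.matrix_elem i j
  have hz : Continuous columnComplex := by
    have : columnComplex = fun g => (g.1 0 0 : ℂ) + g.1 1 0 * Complex.I := by
      funext g
      exact Complex.mk_eq_add_mul_I _ _
    rw [this]
    exact (Complex.continuous_ofReal.comp (h0 0 0)).add
      ((Complex.continuous_ofReal.comp (h0 1 0)).mul continuous_const)
  have hd : Continuous fun g : O (Fin 2) => g.1.det := continuous_subtype_val.matrix_det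
  have hre := Complex.continuous_re.comp (hz.pow n)
  have him := Complex.continuous_im.comp (hz.pow n)
  refine continuous_matrix fun i j => ?_
  fin_cases i <;> fin_cases j
  · exact hre
  · exact (him.mul hd).neg
  · exact him
  · exact hre.mul hd

theorem angularMatrix_two (g : O (Fin 2)) : angularMatrix 2 g =
    !![g.1 0 0 ^ 2 - g.1 1 0 ^ 2, -(2 * g.1 0 0 * g.1 1 0 * g.1.det);
      2 * g.1 0 0 * g.1 1 0, (g.1 0 0 ^ 2 - g.1 1 0 ^ 2) * g.1.det] := by
  have h1 : (columnComplex g ^ 2).re = g.1 0 0 ^ 2 - g.1 1 0 ^ 2 := by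
    simp [columnComplex, pow_two]
  have h2 : (columnComplex g ^ 2).im = 2 * g.1 0 0 * g.1 1 0 := by
    simp [columnComplex, pow_two]; ring
  rw [angularMatrix, h1, h2]

theorem angularMatrix_three (g : O (Fin 2)) : angularMatrix 3 g =
    !![g.1 0 0 ^ 3 - 3 * g.1 0 0 * g.1 1 0 ^ 2, -((3 * g.1 0 0 ^ 2 * g.1 1 0 - g.1 1 0 ^ 3) * g.1.det);
      3 * g.1 0 0 ^ 2 * g.1 1 0 - g.1 1 0 ^ 3, (g.1 0 0 ^ 3 - 3 * g.1 0 0 * g.1 1 0 ^ 2) * g.1.det] := by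
  have h1 : (columnComplex g ^ 3).re = g.1 0 0 ^ 3 - 3 * g.1 0 0 * g.1 1 0 ^ 2 := by
    simp [columnComplex, pow_succ]; ring
  have h2 : (columnComplex g ^ 3).im = 3 * g.1 0 0 ^ 2 * g.1 1 0 - g.1 1 0 ^ 3 := by
    simp [columnComplex, pow_succ]; ring
  rw [angularMatrix, h1, h2]

theorem O.fin_two_ext {g h : O (Fin 2)} (h0 : g.1 0 0 = h.1 0 0) (h1 : g.1 1 0 = h.1 1 0)
    (hd : g.1.det = h.1.det) : g = h := by
  obtain ⟨-, a1, a2, -⟩ := g.fin_two_entries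
  obtain ⟨-, b1, b2, -⟩ := h.fin_two_entries
  ext i j
  fin_cases i <;> fin_cases j
  · exact h0
  · exact (by rw [a1, b1, h1, hd] : g.1 0 1 = h.1 0 1)
  · exact h1
  · exact (by rw [a2, b2, h0, hd] : g.1 1 1 = h.1 1 1)

/-- A preimage is obtained by halving the angle of the first column and keeping the determinant. -/
theorem angular_two_surjective : Function.Surjective (angular 2) := by
  intro h
  obtain ⟨hd, h1, h2, h3⟩ := h.fin_two_entries
  obtain ⟨X, Y, hXY, e1, e2⟩ := exists_half_angle h3
  have hdd : h.1.det * h.1.det = 1 := mul_self_eq_one_iff.2 hd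
  let g : O (Fin 2) := O.mk !![X, -(Y * h.1.det); Y, X * h.1.det] (by
    ext i j
    fin_cases i <;> fin_cases j <;> simp [Matrix.mul_apply, Fin.sum_univ_two]
    · linarith
    · ring
    · ring
    · linear_combination hXY + (X ^ 2 + Y ^ 2) * hdd)
  have hg : g.1.det = h.1.det := by
    change (!![X, -(Y * h.1.det); Y, X * h.1.det]).det = _
    rw [det_fin_two_of]
    linear_combination h.1.det * hXY
  have hg2 : (angular 2 g).1 = !![X ^ 2 - Y ^ 2, -(2 * X * Y * h.1.det);
      2 * X * Y, (X ^ 2 - Y ^ 2) * h.1.det] := by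
    rw [angular_coe, angularMatrix_two, hg]
    rfl
  refine ⟨g, O.fin_two_ext ?_ ?_ ?_⟩
  · rw [hg2, e1]; rfl
  · rw [hg2, e2]; rfl
  · rw [hg2, det_fin_two_of]
    linear_combination h.1.det * (X ^ 2 + Y ^ 2 + 1) * hXY

theorem angular_two_eq_one {g : O (Fin 2)} (h : angular 2 g = 1) (hg : g ≠ 1) :
    g.1 = -1 := by
  have h' := congrArg Subtype.val h
  rw [angular_coe, angularMatrix_two] at h'
  obtain ⟨-, h1, h2, h3⟩ := g.fin_two_entries
  have h00 := congrFun (congrFun h' 0) 0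
  have h11 := congrFun (congrFun h' 1) 1
  simp at h00 h11
  rw [h00, one_mul] at h11
  have hz : g.1 1 0 = 0 := by
    have : g.1 1 0 ^ 2 = 0 := by linarith
    exact pow_eq_zero_iff (two_ne_zero) |>.1 this
  rw [hz] at h00
  have hx : (g.1 0 0 - 1) * (g.1 0 0 + 1) = 0 := by linear_combination h00
  rcases mul_eq_zero.1 hx with hx | hx
  · refine (hg (O.fin_two_ext ?_ ?_ ?_)).elim
    · rw [sub_eq_zero.1 hx]; rfl
    · rw [hz]; rfl
    · rw [h11]; exact det_one.symm
  · have hx' : g.1 0 0 = -1 := by linarith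
    rw [hz, h11] at h1
    rw [hx', h11] at h2
    ext i j
    fin_cases i <;> fin_cases j <;> simp [hx', hz, h1, h2]

theorem card_ker_angular_two : Nat.card (angular 2).ker = 2 := by
  let n : O (Fin 2) := O.mk (-1) (by simp)
  have hn : angular 2 n = 1 := by
    refine Subtype.ext ?_
    rw [angular_coe, angularMatrix_two]
    have h0 : n.1 = -1 := rfl
    ext i j
    fin_cases i <;> fin_cases j <;> simp [h0, det_fin_two]
  have hn1 : n ≠ 1 := by
    intro h
    have := congrFun (congrFun (congrArg Subtype.val h) 0) 0
    change (-1 : Matrix (Fin 2) (Fin 2) ℝ) 0 0 = (1 : Matrix (Fin 2) (Fin 2) ℝ) 0 0 at this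
    norm_num at this
  rw [Nat.card_eq_two_iff]
  refine ⟨⟨1, one_mem _⟩, ⟨n, hn⟩, fun h => hn1 (congrArg Subtype.val h).symm, ?_⟩
  ext ⟨g, hg⟩
  simp only [Set.mem_insert_iff, Set.mem_singleton_iff, Set.mem_univ, iff_true, Subtype.mk.injEq]
  by_cases h1 : g = 1
  · exact Or.inl h1
  · exact Or.inr (Subtype.ext (Subtype.ext (angular_two_eq_one hg h1)))

end PlaneGroup

/-! ### Lifts for the normal forms of pairs -/

section PairLifts

theorem intertwines_of_mul {M : ℕ} {ι : Type} [Fintype ι] [DecidableEq ι]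
    {R : Fin M → Matrix ι ι ℝ} {Q : Matrix ι ι ℝ} {Ω : Matrix (Fin M) (Fin M) ℝ} (hQ : Qᵀ * Q = 1)
    (h : ∀ n, Q * R n = (∑ m, Ω m n • R m) * Q) : Intertwines R Q Ω := by
  intro φ
  have h1 : ∀ n, Q * R n * Qᵀ = ∑ m, Ω m n • R m := fun n => by
    rw [h, Matrix.mul_assoc, mul_eq_one_comm.1 hQ, Matrix.mul_one]
  simp only [comb, Matrix.mul_sum, Matrix.sum_mul, Matrix.mul_smul, Matrix.smul_mul, h1, mulVec,
    dotProduct, Finset.smul_sum, Finset.sum_smul]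
  rw [Finset.sum_comm]
  refine Finset.sum_congr rfl fun m _ => Finset.sum_congr rfl fun n _ => ?_
  rw [smul_smul, mul_comm]

/-- The block sum of two orthogonal representations of dimension `2`. -/
def blockHom {L : Type} [Group L] (f g : L →* O (Fin 2)) : L →* O (Fin 4) :=
  O.hom (fun l => !![(f l).1 0 0, (f l).1 0 1, 0, 0; (f l).1 1 0, (f l).1 1 1, 0, 0;
      0, 0, (g l).1 0 0, (g l).1 0 1; 0, 0, (g l).1 1 0, (g l).1 1 1]) (by
    simp [one_fin_four]) (by
    intro a b
    have hf : ∀ i j, (f (a * b)).1 i j = (f a).1 i 0 * (f b).1 0 j + (f a).1 i 1 * (f b).1 1 j :=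
      fun i j => by
        rw [map_mul]
        change ((f a).1 * (f b).1) i j = _
        rw [Matrix.mul_apply, Fin.sum_univ_two]
    have hg : ∀ i j, (g (a * b)).1 i j = (g a).1 i 0 * (g b).1 0 j + (g a).1 i 1 * (g b).1 1 j :=
      fun i j => by
        rw [map_mul]
        change ((g a).1 * (g b).1) i j = _
        rw [Matrix.mul_apply, Fin.sum_univ_two]
    simp only [hf, hg]
    simp) (by
    intro a
    have hf : ∀ i j, (f a).1 0 i * (f a).1 0 j + (f a).1 1 i * (f a).1 1 j =
        (1 : Matrix (Fin 2) (Fin 2) ℝ) i j := fun i j => by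
      rw [← (f a).transpose_mul_self, Matrix.mul_apply, Fin.sum_univ_two]
      rfl
    have hg : ∀ i j, (g a).1 0 i * (g a).1 0 j + (g a).1 1 i * (g a).1 1 j =
        (1 : Matrix (Fin 2) (Fin 2) ℝ) i j := fun i j => by
      rw [← (g a).transpose_mul_self, Matrix.mul_apply, Fin.sum_univ_two]
      rfl
    rw [transpose_fin_four, one_fin_four]
    simp [hf, hg])

theorem blockHom_coe {L : Type} [Group L] (f g : L →* O (Fin 2)) (l : L) :
    (blockHom f g l).1 = !![(f l).1 0 0, (f l).1 0 1, 0, 0; (f l).1 1 0, (f l).1 1 1, 0, 0;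
      0, 0, (g l).1 0 0, (g l).1 0 1; 0, 0, (g l).1 1 0, (g l).1 1 1] := rfl

theorem continuous_blockHom {L : Type} [Group L] [TopologicalSpace L] {f g : L →* O (Fin 2)}
    (hf : Continuous f) (hg : Continuous g) : Continuous (blockHom f g) := by
  have hf' : ∀ i j, Continuous fun l => (f l).1 i j := fun i j =>
    (continuous_subtype_val.comp hf).matrix_elem i j
  have hg' : ∀ i j, Continuous fun l => (g l).1 i j := fun i j =>
    (continuous_subtype_val.comp hg).matrix_elem i j
  refine O.continuous_hom (continuous_matrix fun i j => ?_)
  fin_cases i <;> fin_cases j <;>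
    first | exact continuous_const | exact hf' _ _ | exact hg' _ _

theorem blockHom_eq_neg_one {L : Type} [Group L] {f g : L →* O (Fin 2)} {l : L}
    (hf : (f l).1 = -1) (hg : (g l).1 = -1) : (blockHom f g l).1 = (-1 : ℝ) • 1 := by
  rw [blockHom_coe, hf, hg]
  simp [one_fin_four]

/-- Each block couples angular momentum 1 to itself and transforms with angular momentum 2. So the
fermions carry the defining representation of the double cover, in which the kernel element is `-1`.
-/
theorem hasLift_pauliPair (a b : ℝ) : HasLift (angular 2) (pauliPair a b) (-1) := by
  refine ⟨blockHom (MonoidHom.id _) (MonoidHom.id _), continuous_blockHom continuous_id continuous_id,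
    fun g => intertwines_of_mul (O.transpose_mul_self _) fun n => ?_,
    fun g hg hg1 => blockHom_eq_neg_one (angular_two_eq_one hg hg1) (angular_two_eq_one hg hg1)⟩
  obtain ⟨hd, h1, h2, h3⟩ := g.fin_two_entries
  rw [Fin.sum_univ_two, angular_coe, angularMatrix_two, blockHom_coe]
  simp only [MonoidHom.id_apply, h1, h2]
  generalize g.1.det = d' at *
  generalize g.1 0 0 = x at *
  generalize g.1 1 0 = z at *
  rcases hd with rfl | rfl <;> fin_cases n <;> simp [pauliPair] <;> grind

/-- The off-diagonal blocks couple angular momentum 3 to 1 and the lower block couples 1 to 1, both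
with result 2. The kernel element acts by `-1` on both summands, since 3 and 1 are odd. -/
theorem hasLift_cubicPair (w d : ℝ) : HasLift (angular 2) (cubicPair w d) (-1) := by
  refine ⟨blockHom (angular 3) (MonoidHom.id _),
    continuous_blockHom (continuous_angular 3) continuous_id,
    fun g => intertwines_of_mul (O.transpose_mul_self _) fun n => ?_,
    fun g hg hg1 => blockHom_eq_neg_one ?_ (angular_two_eq_one hg hg1)⟩
  · obtain ⟨hd, h1, h2, h3⟩ := g.fin_two_entries
    rw [Fin.sum_univ_two, angular_coe, angularMatrix_two, blockHom_coe, angular_coe,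
      angularMatrix_three]
    simp only [MonoidHom.id_apply, h1, h2]
    generalize g.1.det = d' at *
    generalize g.1 0 0 = x at *
    generalize g.1 1 0 = z at *
    rcases hd with rfl | rfl <;> fin_cases n <;> simp [cubicPair] <;> grind
  · have h := angular_two_eq_one hg hg1
    rw [angular_coe, angularMatrix_three, h]
    ext i j
    fin_cases i <;> fin_cases j <;> simp [det_fin_two] <;> norm_num

/-- The blocks couple angular momentum 1 to 0 and transform as a vector, so `O(2)` itself acts and
no cover is needed. The second summand is the identity plus the determinant. -/
theorem hasLift_vectorPair (p q : ℝ) :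
    HasLift (MonoidHom.id (O (Fin 2))) (vectorPair p q) 1 := by
  refine ⟨blockHom (MonoidHom.id _) (angular 0), continuous_blockHom continuous_id (continuous_angular 0),
    fun g => intertwines_of_mul (O.transpose_mul_self _) fun n => ?_, fun g hg hg1 => (hg1 hg).elim⟩
  obtain ⟨hd, h1, h2, h3⟩ := g.fin_two_entries
  have hg : g.1 = !![g.1 0 0, -(g.1 1 0 * g.1.det); g.1 1 0, g.1 0 0 * g.1.det] := by
    ext i j
    fin_cases i <;> fin_cases j <;> simp [h1, h2]
  rw [Fin.sum_univ_two, blockHom_coe, angular_coe, angularMatrix]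
  simp only [MonoidHom.id_apply, pow_zero, Complex.one_re, Complex.one_im]
  generalize g.1.det = d at *
  generalize g.1 0 0 = x at *
  generalize g.1 1 0 = z at *
  rw [hg]
  rcases hd with rfl | rfl <;> fin_cases n <;> simp [vectorPair] <;> grind

theorem hasLift_zero {M : ℕ} {ι : Type} [Fintype ι] [DecidableEq ι] :
    HasLift (MonoidHom.id (O (Fin M))) (0 : Fin M → Matrix ι ι ℝ) 1 := by
  refine ⟨1, continuous_const, fun g φ => ?_, fun g hg hg1 => (hg1 hg).elim⟩
  simp [comb]

end PairLifts
end GNY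

/-! ### Multiplicity one for odd `N`, and splitting for even `N` -/

namespace GNY
open Matrix
open scoped Kronecker

section Multiplicity

variable {M : ℕ} {R : Yukawa M}

/-- If the commutant of the Yukawa matrices is commutative on the range of one of them, then a simple
module on which this matrix is nonzero has multiplicity one. -/
theorem exists_multiplicity_one (m₀ : Fin M) (h0 : R m₀ ≠ 0)
    (hcomm : ∀ X Y : Matrix (Fin 4) (Fin 4) ℝ, (∀ m, X * R m = R m * X) → (∀ m, Y * R m = R m * Y) →
      R m₀ * (X * Y) = R m₀ * (Y * X)) : ∃ c : SimpleType R, multiplicity c = 1 := by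
  have hA := transpose_mem_closureAlgebra (R := R)
  have hss := isSemisimpleModule_of_transpose_mem hA
  -- The simple submodules span, so the nonzero matrix `R m₀` is nonzero on one of them.
  obtain ⟨S, hS, v, hv, hv0⟩ : ∃ S : Submodule (closureAlgebra R) (Fin 4 → ℝ),
      IsSimpleModule (closureAlgebra R) S ∧ ∃ v ∈ S, R m₀ *ᵥ v ≠ 0 := by
    by_contra! hcon
    refine h0 (Matrix.ext_of_mulVec_single fun i => ?_)
    rw [Matrix.zero_mulVec]
    have h1 : (Pi.single i 1 : Fin 4 → ℝ) ∈
        sSup {S : Submodule (closureAlgebra R) (Fin 4 → ℝ) | IsSimpleModule (closureAlgebra R) S} := by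
      rw [IsSemisimpleModule.sSup_simples_eq_top]
      exact Submodule.mem_top
    rw [sSup_eq_iSup'] at h1
    refine Submodule.iSup_induction _ (motive := fun v => R m₀ *ᵥ v = 0) h1
      (fun S v hv => hcon S.1 S.2 v hv) (Matrix.mulVec_zero _) fun x y hx hy => ?_
    rw [Matrix.mulVec_add, hx, hy, add_zero]
  let c : SimpleType R := ⟨isotypicComponent _ _ S, S, hS, rfl⟩
  have hSc : S ≤ c.1 := S.le_isotypicComponent
  obtain ⟨d, B, hB⟩ := exists_frame S
  obtain ⟨J, hJ⟩ := exists_isIsotypicFrame hA hB hS c.2 hSc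
  obtain ⟨y0⟩ := hB.exists_pos hS
  refine ⟨c, ?_⟩
  change (Module.length (closureAlgebra R) c.1).toNat = 1
  generalize (Module.length (closureAlgebra R) c.1).toNat = m at J hJ
  have hm0 : m ≠ 0 := by
    rintro rfl
    have h1 := hJ.sum (B *ᵥ Pi.single y0 1) (hSc (hB.mulVec_mem _))
    rw [Finset.univ_eq_empty, Finset.sum_empty] at h1
    have h2 := hB.mulVec_injective (h1.symm.trans (Matrix.mulVec_zero B).symm)
    simpa using congrFun h2 y0
  -- With two copies of `S`, the partial isometries between them lie in the commutant, and their two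
  -- products are different projections. Commutativity after multiplication by `R m₀` would make `R
  -- m₀` vanish on `S`.
  by_contra hm1
  have hm : 2 ≤ m := by omega
  let i : Fin m := ⟨0, by omega⟩
  let j : Fin m := ⟨1, by omega⟩
  have hij : i ≠ j := by simp [i, j]
  have hJt : ∀ i, ∀ X ∈ closureAlgebra R, (J i)ᵀ * X = compress B X * (J i)ᵀ := by
    intro i X hX
    have := congrArg Matrix.transpose (hJ.mul_eq i _ (hA X hX))
    simpa [Matrix.transpose_mul, Matrix.mul_assoc] using this
  have hc : ∀ i j m, (J i * (J j)ᵀ) * R m = R m * (J i * (J j)ᵀ) := by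
    intro i j m
    have hm := mem_closureAlgebra (R := R) m
    rw [Matrix.mul_assoc, hJt j _ hm, ← Matrix.mul_assoc (R m), hJ.mul_eq i _ hm]
    simp only [Matrix.mul_assoc]
  have h1 := hcomm _ _ (hc i j) (hc j i)
  have e1 : J i * (J j)ᵀ * (J j * (J i)ᵀ) = J i * (J i)ᵀ := by
    rw [Matrix.mul_assoc, ← Matrix.mul_assoc (J j)ᵀ, hJ.orth, if_pos rfl, Matrix.one_mul]
  have e2 : J j * (J i)ᵀ * (J i * (J j)ᵀ) = J j * (J j)ᵀ := by
    rw [Matrix.mul_assoc, ← Matrix.mul_assoc (J i)ᵀ, hJ.orth, if_pos rfl, Matrix.one_mul]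
  rw [e1, e2] at h1
  have h2 := congrArg (· * J i) h1
  simp only [Matrix.mul_assoc] at h2
  rw [hJ.orth, hJ.orth, if_pos rfl, if_neg hij.symm, Matrix.mul_one, Matrix.mul_zero,
    Matrix.mul_zero, hJ.mul_eq i _ (mem_closureAlgebra m₀)] at h2
  have h3 : compress B (R m₀) = 0 := by
    have h4 := congrArg ((J i)ᵀ * ·) h2
    simp only [← Matrix.mul_assoc] at h4
    rw [hJ.orth, if_pos rfl, Matrix.one_mul, Matrix.mul_zero] at h4
    simpa [Matrix.mul_assoc] using h4
  rw [← (hB.mem_iff v).1 hv, Matrix.mulVec_mulVec, ← hB.mul_compress (mem_closureAlgebra m₀), h3] at hv0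
  simp at hv0

theorem exists_multiplicity_one_of_equivalent {R' : Yukawa M} (h : Equivalent R R') (m₀ : Fin M)
    (h0 : R' m₀ ≠ 0)
    (hcomm : ∀ X Y : Matrix (Fin 4) (Fin 4) ℝ, (∀ m, X * R' m = R' m * X) →
      (∀ m, Y * R' m = R' m * Y) → R' m₀ * (X * Y) = R' m₀ * (Y * X)) :
    ∃ c : SimpleType R, multiplicity c = 1 := by
  obtain ⟨A, hA, hA', hR⟩ := h
  have hc : ∀ X Y : Matrix (Fin 4) (Fin 4) ℝ, Aᵀ * (X * Y) * A = Aᵀ * X * A * (Aᵀ * Y * A) := by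
    intro X Y
    calc Aᵀ * (X * Y) * A = Aᵀ * X * 1 * Y * A := by simp only [Matrix.mul_assoc, Matrix.one_mul]
      _ = _ := by rw [← hA']; simp only [Matrix.mul_assoc]
  have hc' : ∀ X : Matrix (Fin 4) (Fin 4) ℝ, A * (Aᵀ * X * A) * Aᵀ = X := by
    intro X
    calc A * (Aᵀ * X * A) * Aᵀ = (A * Aᵀ) * X * (A * Aᵀ) := by simp only [Matrix.mul_assoc]
      _ = X := by rw [hA', Matrix.one_mul, Matrix.mul_one]
  have hR' : ∀ m, Aᵀ * R m * A = R' m := by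
    intro m
    calc Aᵀ * R m * A = (Aᵀ * A) * R' m * (Aᵀ * A) := by rw [hR]; simp only [Matrix.mul_assoc]
      _ = R' m := by rw [hA, Matrix.one_mul, Matrix.mul_one]
  have hcc : ∀ X : Matrix (Fin 4) (Fin 4) ℝ, (∀ m, X * R m = R m * X) →
      ∀ m, (Aᵀ * X * A) * R' m = R' m * (Aᵀ * X * A) := by
    intro X hX m
    rw [← hR', ← hc, ← hc, hX]
  refine exists_multiplicity_one m₀ (fun hz => h0 ?_) fun X Y hX hY => ?_
  · rw [← hR', hz, Matrix.mul_zero, Matrix.zero_mul]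
  · have h1 := hcomm _ _ (hcc X hX) (hcc Y hY)
    rw [← hR', ← hc, ← hc, ← hc, ← hc] at h1
    rw [← hc' (R m₀ * (X * Y)), h1, hc']

end Multiplicity

section EvenFlavors

variable {M : ℕ} {ι ι' : Type} [Fintype ι] [DecidableEq ι] [Fintype ι'] [DecidableEq ι']

theorem Equivalent.symm {R : Fin M → Matrix ι ι ℝ} {R' : Fin M → Matrix ι' ι' ℝ}
    (h : Equivalent R R') : Equivalent R' R := by
  obtain ⟨A, hA, hA', hR⟩ := h
  refine ⟨Aᵀ, by rwa [transpose_transpose], by rwa [transpose_transpose], fun m => ?_⟩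
  rw [transpose_transpose, hR]
  calc R' m = (Aᵀ * A) * R' m * (Aᵀ * A) := by rw [hA, Matrix.one_mul, Matrix.mul_one]
    _ = _ := by simp only [Matrix.mul_assoc]

theorem equivalent_flavors_equiv {κ κ' : Type} [Fintype κ] [DecidableEq κ] [Fintype κ']
    [DecidableEq κ'] (e : κ ≃ κ') (R : Fin M → Matrix ι ι ℝ) :
    Equivalent (flavors κ R) (flavors κ' R) := by
  have h := equivalent_reindex (flavors κ R) (e.prodCongr (Equiv.refl ι))
  have h1 : (fun m => (flavors κ R m).submatrix (e.prodCongr (Equiv.refl ι)).symm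
      (e.prodCongr (Equiv.refl ι)).symm) = flavors κ' R := by
    funext m
    ext ⟨a, i⟩ ⟨b, j⟩
    simp [flavors, Matrix.one_apply]
  rwa [h1] at h

theorem equivalent_flavors_flavors {κ κ' : Type} [Fintype κ] [DecidableEq κ] [Fintype κ']
    [DecidableEq κ'] (R : Fin M → Matrix ι ι ℝ) :
    Equivalent (flavors (κ × κ') R) (flavors κ (flavors κ' R)) := by
  have h := equivalent_reindex (flavors (κ × κ') R) (Equiv.prodAssoc κ κ' ι)
  have h1 : (fun m => (flavors (κ × κ') R m).submatrix (Equiv.prodAssoc κ κ' ι).symm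
      (Equiv.prodAssoc κ κ' ι).symm) = flavors κ (flavors κ' R) := by
    funext m
    ext ⟨a, b, i⟩ ⟨c, d, j⟩
    simp only [flavors, submatrix_apply, kroneckerMap_apply, Matrix.one_apply, Prod.mk.injEq,
      Equiv.prodAssoc_symm_apply]
    by_cases h2 : a = c <;> by_cases h3 : b = d <;> simp [h2, h3]
  rwa [h1] at h

theorem hasLift_flavors_of_even {L : Type} [Group L] [TopologicalSpace L] {p : L →* O (Fin M)} {ε : ℝ}
    {N : ℕ} (hN : Even N) {R : Fin M → Matrix ι ι ℝ} (h : HasLift p (flavors (Fin 2) R) ε) :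
    HasLift p (flavors (Fin N) R) ε := by
  obtain ⟨k, rfl⟩ := hN
  have e : Fin (k + k) ≃ Fin k × Fin 2 := (finCongr (by ring)).trans finProdFinEquiv.symm
  exact HasLift.of_equivalent ((equivalent_flavors_equiv e R).trans (equivalent_flavors_flavors R))
    h.flavors_of_untwisted

/-- The double cover is again `O(2)`, and its kernel element acts by `-1` on a flavor doublet
carrying the defining representation. The two signs cancel and the lift descends. -/
theorem HasLift.flavors_two {ι : Type} [Fintype ι] [DecidableEq ι] {R : Fin 2 → Matrix ι ι ℝ}
    (h : HasLift (angular 2) R (-1)) :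
    HasLift (MonoidHom.id (O (Fin 2))) (GNY.flavors (Fin 2) R) 1 := by
  have h1 := h.flavors (κ := Fin 2) (ε' := -1) (MonoidHom.id _) continuous_id fun g hg hg1 => by
    rw [neg_one_smul]
    exact angular_two_eq_one hg hg1
  rw [neg_one_mul, neg_neg] at h1
  exact h1.descend (continuous_angular 2) angular_two_surjective

end EvenFlavors

section PairSymmetry

/-- The pair of Yukawa matrices `a (σ_z, σ_x)`. -/
def smallPauliPair (a : ℝ) : Fin 2 → Matrix (Fin 2) (Fin 2) ℝ :=
  ![!![a, 0; 0, -a], !![0, a; a, 0]]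

theorem hasLift_smallPauliPair (a : ℝ) : HasLift (angular 2) (smallPauliPair a) (-1) := by
  refine ⟨MonoidHom.id _, continuous_id,
    fun g => intertwines_of_mul (O.transpose_mul_self _) fun n => ?_, fun g hg hg1 => by
      rw [neg_one_smul]
      exact angular_two_eq_one hg hg1⟩
  obtain ⟨hd, h1, h2, h3⟩ := g.fin_two_entries
  have hg : g.1 = !![g.1 0 0, -(g.1 1 0 * g.1.det); g.1 1 0, g.1 0 0 * g.1.det] := by
    ext i j
    fin_cases i <;> fin_cases j <;> simp [h1, h2]
  rw [Fin.sum_univ_two, angular_coe, angularMatrix_two, MonoidHom.id_apply]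
  generalize g.1.det = d at *
  generalize g.1 0 0 = x at *
  generalize g.1 1 0 = z at *
  rw [hg]
  rcases hd with rfl | rfl <;> fin_cases n <;> ext i j <;> fin_cases i <;> fin_cases j <;>
    simp [smallPauliPair, Matrix.mul_apply, Fin.sum_univ_two] <;>
    first | ring1 | linear_combination (a * x) * h3 | linear_combination (-a * x) * h3 |
      linear_combination (a * z) * h3 | linear_combination (-a * z) * h3

/-- For `a = b` the doublet needed to cancel the sign is already present within a single flavor, so
this pair splits for every `N`. -/
theorem equivalent_pauliPair_self (a : ℝ) :
    Equivalent (pauliPair a a) (flavors (Fin 2) (smallPauliPair a)) := by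
  have h := equivalent_reindex (flavors (Fin 2) (smallPauliPair a)) finProdFinEquiv
  have h1 : (fun m => (flavors (Fin 2) (smallPauliPair a) m).submatrix
      (finProdFinEquiv (m := 2) (n := 2)).symm (finProdFinEquiv (m := 2) (n := 2)).symm) =
        pauliPair a a := by
    funext m
    ext i j
    fin_cases m <;> fin_cases i <;> fin_cases j <;>
      simp [flavors, pauliPair, smallPauliPair, finProdFinEquiv, Fin.divNat, Fin.modNat]
  rw [h1] at h
  exact h.symm

theorem pauliPair_commutant {a b : ℝ} (ha : 0 < a) (hb : 0 ≤ b) (hab : a ≠ b)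
    {X : Matrix (Fin 4) (Fin 4) ℝ} (hX : ∀ m, X * pauliPair a b m = pauliPair a b m * X) :
    X = !![X 0 0, 0, 0, 0; 0, X 0 0, 0, 0; 0, 0, X 2 2, X 2 3; 0, 0, X 3 2, X 3 3] ∧
      (b ≠ 0 → X 2 3 = 0 ∧ X 3 2 = 0 ∧ X 3 3 = X 2 2) := by
  have h0 := hX 0
  have h1 := hX 1
  simp [← Matrix.ext_iff, Fin.forall_fin_succ, Matrix.mul_apply, Fin.sum_univ_four, pauliPair, Matrix.vecMul,
    dotProduct] at h0 h1
  have hs : a + b ≠ 0 := by positivity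
  have hd : a - b ≠ 0 := sub_ne_zero.2 hab
  constructor
  · ext i j
    fin_cases i <;> fin_cases j <;> simp <;> grind
  · intro hb0
    grind

theorem cubicPair_commutant {w d : ℝ} (hw : w ≠ 0) (hd : d ≠ 0)
    {X : Matrix (Fin 4) (Fin 4) ℝ} (hX : ∀ m, X * cubicPair w d m = cubicPair w d m * X) :
    X = X 0 0 • 1 := by
  have h0 := hX 0
  have h1 := hX 1
  simp [← Matrix.ext_iff, Fin.forall_fin_succ, Matrix.mul_apply, Fin.sum_univ_four, cubicPair, Matrix.vecMul,
    dotProduct] at h0 h1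
  ext i j
  fin_cases i <;> fin_cases j <;> simp <;> grind

variable {N : ℕ} {R : Yukawa 2}

theorem exists_multiplicity_one_of_pauliPair {a b : ℝ} (ha : 0 < a) (hb : 0 ≤ b) (hab : a ≠ b)
    (h : Equivalent R (pauliPair a b)) : ∃ c : SimpleType R, multiplicity c = 1 := by
  refine exists_multiplicity_one_of_equivalent h 0 (fun hz => ?_) fun X Y hX hY => ?_
  · have := congrFun (congrFun hz 0) 0
    simp [pauliPair] at this
    exact ha.ne' this
  · obtain ⟨hX, hX'⟩ := pauliPair_commutant ha hb hab hX
    obtain ⟨hY, hY'⟩ := pauliPair_commutant ha hb hab hY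
    generalize X 0 0 = x at hX
    generalize Y 0 0 = y at hY
    generalize X 2 2 = x1 at hX hX'
    generalize X 2 3 = x2 at hX hX'
    generalize X 3 2 = x3 at hX hX'
    generalize X 3 3 = x4 at hX hX'
    generalize Y 2 2 = y1 at hY hY'
    generalize Y 2 3 = y2 at hY hY'
    generalize Y 3 2 = y3 at hY hY'
    generalize Y 3 3 = y4 at hY hY'
    subst hX hY
    -- For `b = 0` the lower block is a common null space on which the commutant is not commutative.
    -- It is annihilated by the factor of the Yukawa matrix.
    by_cases hb0 : b = 0
    · subst hb0
      ext i j
      fin_cases i <;> fin_cases j <;> simp [pauliPair, Matrix.mul_apply, Fin.sum_univ_four] <;>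
        first | ring1 | exact Or.inl (mul_comm _ _)
    · obtain ⟨rfl, rfl, rfl⟩ := hX' hb0
      obtain ⟨rfl, rfl, rfl⟩ := hY' hb0
      ext i j
      fin_cases i <;> fin_cases j <;> simp [pauliPair, Matrix.mul_apply, Fin.sum_univ_four] <;>
        first | ring1 | exact Or.inl (mul_comm _ _)

theorem exists_multiplicity_one_of_cubicPair {w d : ℝ} (hw : w ≠ 0) (hd : d ≠ 0)
    (h : Equivalent R (cubicPair w d)) : ∃ c : SimpleType R, multiplicity c = 1 := by
  refine exists_multiplicity_one_of_equivalent h 0 (fun hz => ?_) fun X Y hX hY => ?_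
  · have := congrFun (congrFun hz 0) 2
    simp [cubicPair] at this
    exact hw this
  · have h1 : X * Y = Y * X := by
      rw [cubicPair_commutant hw hd hX]
      simp
    rw [h1]

/-- For even `N` the sign cancels over pairs of flavors; for odd `N` the multiplicity one exhibits
an odd `N m`, as the second alternative demands. -/
theorem dichotomy_of_hasLift_angular (hR : ∀ m, (R m).IsSymm) (h : HasLift (angular 2) R (-1))
    (hm : ∃ c : SimpleType R, multiplicity c = 1) :
    IsSplit N R ∨ ((1 < 2 ∧ ∃ c : SimpleType R, Odd (N * multiplicity c)) ∧
      IsSplitUpToDoubleCover N R) := by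
  rcases Nat.even_or_odd N with hN | hN
  · exact Or.inl (isSplit_of_hasLift one_lt_two hR (hasLift_flavors_of_even hN h.flavors_two))
  · obtain ⟨c, hc⟩ := hm
    exact Or.inr ⟨⟨one_lt_two, c, by rwa [hc, mul_one]⟩,
      isSplitUpToDoubleCover_of_hasLift one_lt_two hR (continuous_angular 2) angular_two_surjective
        card_ker_angular_two h.flavors_of_untwisted⟩

theorem dichotomy_of_fin_two (hN : 1 ≤ N) (hR : IsValid N R) :
    IsSplit N R ∨ ((1 < 2 ∧ ∃ c : SimpleType R, Odd (N * multiplicity c)) ∧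
      IsSplitUpToDoubleCover N R) := by
  have : Nonempty (Fin N) := ⟨⟨0, hN⟩⟩
  by_cases h0 : R = 0
  · subst h0
    exact Or.inl (isSplit_of_hasLift one_lt_two hR.symm hasLift_zero.flavors_of_untwisted)
  rcases hR.rotatable.pair_classification hR.symm h0 with
    ⟨a, b, ha, hb, h⟩ | ⟨p, q, -, h⟩ | ⟨w, d, hw, hd, h⟩
  · by_cases hab : a = b
    · subst hab
      exact Or.inl (isSplit_of_hasLift one_lt_two hR.symm
        (HasLift.of_equivalent (h.trans (equivalent_pauliPair_self a))
          (hasLift_smallPauliPair a).flavors_two).flavors_of_untwisted)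
    · exact dichotomy_of_hasLift_angular hR.symm (HasLift.of_equivalent h (hasLift_pauliPair a b))
        (exists_multiplicity_one_of_pauliPair ha hb hab h)
  · exact Or.inl (isSplit_of_hasLift one_lt_two hR.symm
      (HasLift.of_equivalent h (hasLift_vectorPair p q)).flavors_of_untwisted)
  · exact dichotomy_of_hasLift_angular hR.symm (HasLift.of_equivalent h (hasLift_cubicPair w d))
      (exists_multiplicity_one_of_cubicPair hw hd h)

end PairSymmetry
end GNY

/-! ### Adding a third Yukawa matrix to a pair -/

namespace GNY
open Matrix
open scoped Kronecker

section ThirdMatrix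

variable {κ : Type} [Fintype κ] [DecidableEq κ] [Nonempty κ]

theorem eq_zero_of_isSymm_of_trace_mul_self {ι : Type} [Fintype ι] {X : Matrix ι ι ℝ}
    (hX : X.IsSymm) (h : (X * X).trace = 0) : X = 0 := by
  refine trace_conjTranspose_mul_self_eq_zero_iff.1 ?_
  rw [conjTranspose_eq_transpose_of_trivial, hX.eq, h]

/-- If two of the Yukawa matrices anticommute and have equal squares, so do all of them. -/
theorem Rotatable.clifford {M : ℕ} {ι : Type} [Fintype ι] [DecidableEq ι] {R : Fin M → Matrix ι ι ℝ}
    (h : Rotatable κ R) (hR : ∀ m, (R m).IsSymm) {i j k : Fin M} (hij : i ≠ j) (hik : i ≠ k)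
    (hjk : j ≠ k) (hsq : R i * R i = R j * R j) (hanti : R i * R j + R j * R i = 0) :
    R i * R i = R k * R k ∧ R i * R k + R k * R i = 0 := by
  have ht : ∀ m n, (R m * R n)ᵀ = R n * R m := fun m n => by
    rw [transpose_mul, (hR m).eq, (hR n).eq]
  constructor
  · rw [← sub_eq_zero]
    refine eq_zero_of_isSymm_of_trace_mul_self (by rw [IsSymm, transpose_sub, ht, ht]) ?_
    -- The squared norm of the defect is a combination of traces of words, which the quarter turn
    -- from `j` to `k` preserves. Since it vanishes for `j`, it vanishes for `k`; the anticommutator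
    -- below is treated alike.
    have e : ∀ m, ((R i * R i - R m * R m) * (R i * R i - R m * R m)).trace =
        (R i * R i * R i * R i).trace - 2 * (R i * R i * R m * R m).trace +
          (R m * R m * R m * R m).trace := by
      intro m
      simp only [Matrix.sub_mul, Matrix.mul_sub, trace_sub]
      rw [Matrix.trace_mul_comm (R m * R m) (R i * R i)]
      simp only [← Matrix.mul_assoc]
      ring
    have q1 := h.trace_quarterTurn hjk [i, i, j, j]
    have q2 := h.trace_quarterTurn hjk [j, j, j, j]
    simp [hij, hik, ← Matrix.mul_assoc] at q1 q2
    rw [e k, q1, q2, ← e j, hsq, sub_self, Matrix.zero_mul, trace_zero]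
  · refine eq_zero_of_isSymm_of_trace_mul_self
      (by rw [IsSymm, transpose_add, ht, ht, add_comm]) ?_
    have e : ∀ m, ((R i * R m + R m * R i) * (R i * R m + R m * R i)).trace =
        2 * (R i * R m * R i * R m).trace + 2 * (R i * R i * R m * R m).trace := by
      intro m
      simp only [Matrix.add_mul, Matrix.mul_add, trace_add]
      rw [Matrix.trace_mul_comm (R m * R i) (R m * R i), Matrix.trace_mul_comm (R m * R i) (R i * R m)]
      have e1 : (R m * R i * (R m * R i)).trace = (R i * R m * R i * R m).trace := by
        rw [Matrix.mul_assoc, Matrix.trace_mul_comm]; simp only [Matrix.mul_assoc]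
      have e2 : (R i * R m * (R m * R i)).trace = (R i * R i * R m * R m).trace := by
        rw [← Matrix.mul_assoc, Matrix.trace_mul_comm]; simp only [Matrix.mul_assoc]
      rw [e1, e2]
      simp only [← Matrix.mul_assoc]
      ring
    have q1 := h.trace_quarterTurn hjk [i, i, j, j]
    have q2 := h.trace_quarterTurn hjk [i, j, i, j]
    simp [hij, hik, ← Matrix.mul_assoc] at q1 q2
    rw [e k, q1, q2, ← e j, hanti, Matrix.zero_mul, trace_zero]

theorem IsSymm.eq_of_four {S : Matrix (Fin 4) (Fin 4) ℝ} (h : S.IsSymm) :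
    S = !![S 0 0, S 0 1, S 0 2, S 0 3; S 0 1, S 1 1, S 1 2, S 1 3;
      S 0 2, S 1 2, S 2 2, S 2 3; S 0 3, S 1 3, S 2 3, S 3 3] := by
  ext i j
  fin_cases i <;> fin_cases j <;> simp <;> exact h.apply _ _

/-- Traces of words that are linear in the third Yukawa matrix. -/
theorem Rotatable.trace_linear {ι : Type} [Fintype ι] [DecidableEq ι] {R : Fin 3 → Matrix ι ι ℝ}
    (h : Rotatable κ R) (hR : ∀ m, (R m).IsSymm) :
    ((R 2).trace = 0 ∧ (R 2 * (R 0 * R 0)).trace = 0 ∧ (R 2 * (R 1 * R 1)).trace = 0 ∧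
      (R 2 * (R 0 * R 0 * (R 1 * R 1))).trace = 0) ∧
    ((R 2 * R 0).trace = 0 ∧ (R 2 * (R 0 * R 0 * R 0)).trace = 0 ∧
      (R 2 * (R 0 * (R 1 * R 1))).trace = 0) ∧
    ((R 2 * R 1).trace = 0 ∧ (R 2 * (R 1 * R 1 * R 1)).trace = 0 ∧
      (R 2 * (R 1 * (R 0 * R 0))).trace = 0) ∧ (R 2 * (R 0 * R 1)).trace = 0 := by
  have h21 : (2 : Fin 3) ≠ 1 := by decide
  have h20 : (2 : Fin 3) ≠ 0 := by decide
  have a1 := h.trace_halfTurn h21 [2]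
  have a2 := h.trace_halfTurn h21 [2, 0, 0]
  have a3 := h.trace_halfTurn h21 [2, 1, 1]
  have a4 := h.trace_halfTurn h21 [2, 0, 0, 1, 1]
  have a5 := h.trace_halfTurn h21 [2, 0]
  have a6 := h.trace_halfTurn h21 [2, 0, 0, 0]
  have a7 := h.trace_halfTurn h21 [2, 0, 1, 1]
  have b5 := h.trace_halfTurn h20 [2, 1]
  have b6 := h.trace_halfTurn h20 [2, 1, 1, 1]
  have b7 := h.trace_halfTurn h20 [2, 1, 0, 0]
  have c := h.trace_quarterTurn (i := 0) (j := 1) (by decide) [2, 0, 1]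
  have c' : (R 2 * (R 1 * R 0)).trace = (R 2 * (R 0 * R 1)).trace := by
    rw [← trace_transpose, transpose_mul, transpose_mul, (hR 0).eq, (hR 1).eq, (hR 2).eq,
      Matrix.trace_mul_comm]
  simp at a1 a2 a3 a4 a5 a6 a7 b5 b6 b7 c
  simp only [← Matrix.mul_assoc] at *
  refine ⟨⟨?_, ?_, ?_, ?_⟩, ⟨?_, ?_, ?_⟩, ⟨?_, ?_, ?_⟩, ?_⟩ <;> linarith

/-- The third Yukawa matrix `ε ⊗ ε` that extends the pair `1 ⊗ (σ_z, σ_x)`. -/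
def pauliThird : Matrix (Fin 4) (Fin 4) ℝ :=
  !![0, 0, 0, 1; 0, 0, -1, 0; 0, -1, 0, 0; 1, 0, 0, 0]

/-- The third Yukawa matrix that completes a vector pair to a triplet. -/
def vectorThird : Matrix (Fin 4) (Fin 4) ℝ :=
  !![0, 0, 0, 0; 0, 0, 0, 0; 0, 0, 0, 1; 0, 0, 1, 0]

/-- By `Rotatable.clifford` the third matrix anticommutes with the first two and has the same
square. Anticommutation leaves one parameter in the off-diagonal block, annihilated by `a - b`, and
the square fixes its modulus to `a > 0`. -/
theorem Rotatable.third_of_pauliPair {R : Fin 3 → Matrix (Fin 4) (Fin 4) ℝ}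
    (h : Rotatable κ R) (hR : ∀ m, (R m).IsSymm) {a b : ℝ} (ha : 0 < a) (hb : 0 ≤ b)
    (h0 : R 0 = pauliPair a b 0) (h1 : R 1 = pauliPair a b 1) :
    a = b ∧ (R 2 = a • pauliThird ∨ R 2 = -(a • pauliThird)) := by
  have hsq : R 0 * R 0 = R 1 * R 1 := by
    rw [h0, h1]
    ext i j
    fin_cases i <;> fin_cases j <;> simp [pauliPair]
  have hanti : R 0 * R 1 + R 1 * R 0 = 0 := by
    rw [h0, h1]
    ext i j
    fin_cases i <;> fin_cases j <;> simp [pauliPair]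
  obtain ⟨e1, e2⟩ := h.clifford hR (i := 0) (j := 1) (k := 2) (by decide) (by decide) (by decide)
    hsq hanti
  obtain ⟨-, e3⟩ := h.clifford hR (i := 1) (j := 0) (k := 2) (by decide) (by decide) (by decide)
    hsq.symm (by rw [add_comm, hanti])
  have hs := IsSymm.eq_of_four (hR 2)
  rw [h0] at e1 e2
  rw [h1] at e3
  rw [hs] at e1 e2 e3 ⊢
  generalize R 2 0 0 = s00 at *
  generalize R 2 0 1 = s01 at *
  generalize R 2 0 2 = s02 at *
  generalize R 2 0 3 = s03 at *
  generalize R 2 1 1 = s11 at *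
  generalize R 2 1 2 = s12 at *
  generalize R 2 1 3 = s13 at *
  generalize R 2 2 2 = s22 at *
  generalize R 2 2 3 = s23 at *
  generalize R 2 3 3 = s33 at *
  clear hs h0 h1 hsq hanti hR h
  replace e1 := congrFun (congrFun e1 0) 0
  simp [pauliPair, Matrix.mul_apply, Fin.sum_univ_four] at e1
  simp [← Matrix.ext_iff, Fin.forall_fin_succ, pauliPair] at e2 e3
  have hs : a + b ≠ 0 := by positivity
  have f00 : s00 = 0 := by grind
  have f11 : s11 = 0 := by grind
  have f01 : s01 = 0 := by grind
  have f02 : s02 = 0 := by grind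
  have f13 : s13 = 0 := by grind
  subst f00 f11 f01 f02 f13
  have fab : (a - b) * s03 = 0 := by grind
  have fs : s12 = -s03 := by grind
  have fsq : s03 * s03 = a * a := by linarith
  have fs0 : s03 ≠ 0 := by
    rintro rfl
    rw [mul_zero] at fsq
    exact ha.ne' (mul_self_eq_zero.1 fsq.symm)
  have hab : a = b := sub_eq_zero.1 ((mul_eq_zero.1 fab).resolve_right fs0)
  subst hab fs
  have f22 : s22 = 0 := by grind
  have f33 : s33 = 0 := by grind
  have f23 : s23 = 0 := by grind
  subst f22 f33 f23
  rw [pauliThird]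
  rcases mul_self_eq_mul_self_iff.1 fsq with rfl | rfl <;> simp

/-- Traces linear in the third matrix remove most of its entries. If `q ≠ 0` they also remove two
more, and then `tr (R 0 R 1 R 0 R 1) = tr (R 0 R 2 R 0 R 2)` gives `p² q² = 0`. For `q = 0`, the
quadratic and quartic traces leave only the entry `±p`. -/
theorem Rotatable.third_of_vectorPair {R : Fin 3 → Matrix (Fin 4) (Fin 4) ℝ}
    (h : Rotatable κ R) (hR : ∀ m, (R m).IsSymm) {p q : ℝ} (hpq : q ^ 2 < p ^ 2)
    (h0 : R 0 = vectorPair p q 0) (h1 : R 1 = vectorPair p q 1) :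
    q = 0 ∧ (R 2 = p • vectorThird ∨ R 2 = -(p • vectorThird)) := by
  obtain ⟨⟨a1, a2, a3, a4⟩, ⟨b1, b2, -⟩, ⟨c1, c2, -⟩, d⟩ := h.trace_linear hR
  have q1 := h.trace_sq (i := 2) (j := 0) (by decide)
  have q2 := h.trace_quarterTurn (i := 1) (j := 2) (by decide) [0, 0, 1, 1]
  have q3 := h.trace_quarterTurn (i := 0) (j := 2) (by decide) [0, 0, 1, 1]
  have q4 := h.trace_quarterTurn (i := 1) (j := 2) (by decide) [0, 1, 0, 1]
  simp [← Matrix.mul_assoc] at q2 q3 q4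
  simp only [Matrix.mul_assoc (_ * _)] at q2 q3 q4
  have hs := IsSymm.eq_of_four (hR 2)
  have m00 : R 0 * R 0 = !![p ^ 2, 0, 0, 0; 0, q ^ 2, 0, 0; 0, 0, p ^ 2, 0; 0, 0, 0, q ^ 2] := by
    rw [h0]
    simp [vectorPair, sq]
  have m11 : R 1 * R 1 = !![q ^ 2, 0, 0, 0; 0, p ^ 2, 0, 0; 0, 0, p ^ 2, 0; 0, 0, 0, q ^ 2] := by
    rw [h1]
    simp [vectorPair, sq]
  have m01 : R 0 * R 1 = !![0, p ^ 2, 0, 0; -q ^ 2, 0, 0, 0; 0, 0, 0, -(p * q); 0, 0, p * q, 0] := by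
    rw [h0, h1]
    simp [vectorPair, sq]
    ring
  rw [m00, m11] at a4
  rw [m00] at a2 b2 q1
  rw [m11] at a3 c2
  rw [m00, m11] at q2
  rw [m00, m11] at q3
  rw [m01] at d q4
  rw [h0] at b1 b2 q4
  rw [h1] at c1 c2
  rw [hs] at a1 a2 a3 a4 b1 b2 c1 c2 d q1 q2 q3 q4 ⊢
  generalize R 2 0 0 = s00 at *
  generalize R 2 0 1 = s01 at *
  generalize R 2 0 2 = s02 at *
  generalize R 2 0 3 = s03 at *
  generalize R 2 1 1 = s11 at *
  generalize R 2 1 2 = s12 at *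
  generalize R 2 1 3 = s13 at *
  generalize R 2 2 2 = s22 at *
  generalize R 2 2 3 = s23 at *
  generalize R 2 3 3 = s33 at *
  clear hs h0 h1 hR h m00 m11 m01
  simp [Matrix.trace, Fin.sum_univ_four, vectorPair] at a1 a2 a3 a4 b1 b2 c1 c2 d
  have hp : p ≠ 0 := by
    rintro rfl
    nlinarith [sq_nonneg q]
  have hd : p ^ 2 - q ^ 2 ≠ 0 := by linarith
  obtain rfl : s11 = s00 := (mul_right_inj' hd).1 (by linear_combination a3 - a2)
  obtain rfl : s22 = -s11 := (mul_right_inj' hd).1 (by linear_combination a2 - q ^ 2 * a1)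
  obtain rfl : s33 = -s11 := by linarith
  obtain rfl : s11 = 0 := (mul_right_inj' (pow_ne_zero 2 hd)).1 (by linear_combination -a4)
  obtain rfl : s02 = 0 := (mul_right_inj' (mul_ne_zero hp hd)).1
    (by linear_combination (b2 - q ^ 2 * b1) / 2)
  obtain rfl : s12 = 0 := (mul_right_inj' (mul_ne_zero hp hd)).1
    (by linear_combination (c2 - q ^ 2 * c1) / 2)
  obtain rfl : s01 = 0 := (mul_right_inj' hd).1 (by linear_combination d)
  have hq : q = 0 := by
    by_contra hq
    obtain rfl : s13 = 0 := (mul_right_inj' hq).1 (by linarith)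
    obtain rfl : s03 = 0 := (mul_right_inj' hq).1 (by linarith)
    simp [Matrix.trace, Fin.sum_univ_four, vectorPair] at q4
    have h1 : p ^ 2 * q ^ 2 = 0 := by nlinarith
    exact mul_ne_zero (pow_ne_zero 2 hp) (pow_ne_zero 2 hq) h1
  subst hq
  refine ⟨rfl, ?_⟩
  clear q4 a1 a2 a3 a4 b1 b2 c1 c2 d
  simp [Matrix.trace, Fin.sum_univ_four] at q1 q2 q3
  have hp2 : p ^ 2 ≠ 0 := pow_ne_zero 2 hp
  have e2 : s03 ^ 2 + s23 ^ 2 = p ^ 2 := (mul_right_inj' hp2).1 (by linear_combination q2)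
  have e3 : s13 ^ 2 + s23 ^ 2 = p ^ 2 := (mul_right_inj' hp2).1 (by linear_combination q3)
  have f03 : s03 ^ 2 = 0 := by linarith
  have f13 : s13 ^ 2 = 0 := by linarith
  obtain rfl := pow_eq_zero_iff two_ne_zero |>.1 f03
  obtain rfl := pow_eq_zero_iff two_ne_zero |>.1 f13
  rw [vectorThird]
  rcases sq_eq_sq_iff_eq_or_eq_neg.1 (show s23 ^ 2 = p ^ 2 by linarith) with rfl | rfl <;> simp

/-- The traces linear in the third matrix already force it to vanish, although its squared norm must
equal that of the first. -/
theorem Rotatable.not_cubicPair {R : Fin 3 → Matrix (Fin 4) (Fin 4) ℝ}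
    (h : Rotatable κ R) (hR : ∀ m, (R m).IsSymm) {w d : ℝ} (hw : w ≠ 0) (hd : d ≠ 0)
    (h0 : R 0 = cubicPair w d 0) (h1 : R 1 = cubicPair w d 1) : False := by
  obtain ⟨⟨a1, a2, a3, -⟩, ⟨b1, b2, b3⟩, ⟨c1, c2, c3⟩, e⟩ := h.trace_linear hR
  have q1 := h.trace_sq (i := 2) (j := 0) (by decide)
  have hs := IsSymm.eq_of_four (hR 2)
  have m00 : R 0 * R 0 = !![w ^ 2, 0, w * d, 0; 0, w ^ 2, 0, -(w * d);
      w * d, 0, w ^ 2 + d ^ 2, 0; 0, -(w * d), 0, w ^ 2 + d ^ 2] := by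
    rw [h0]
    simp [cubicPair, sq, mul_comm]
  have m11 : R 1 * R 1 = !![w ^ 2, 0, -(w * d), 0; 0, w ^ 2, 0, w * d;
      -(w * d), 0, w ^ 2 + d ^ 2, 0; 0, w * d, 0, w ^ 2 + d ^ 2] := by
    rw [h1]
    simp [cubicPair, sq, mul_comm, add_comm]
  rw [m00] at a2 b2 q1 c3
  rw [m11] at a3 c2 b3
  rw [h0] at b1 b2 b3 e
  rw [h1] at c1 c2 c3 e
  rw [hs] at a1 a2 a3 b1 b2 b3 c1 c2 c3 e q1
  generalize R 2 0 0 = s00 at *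
  generalize R 2 0 1 = s01 at *
  generalize R 2 0 2 = s02 at *
  generalize R 2 0 3 = s03 at *
  generalize R 2 1 1 = s11 at *
  generalize R 2 1 2 = s12 at *
  generalize R 2 1 3 = s13 at *
  generalize R 2 2 2 = s22 at *
  generalize R 2 2 3 = s23 at *
  generalize R 2 3 3 = s33 at *
  clear hs h0 h1 hR h m00 m11
  simp [Matrix.trace, Fin.sum_univ_four, cubicPair] at a1 a2 a3 b1 b2 b3 c1 c2 c3 e
  have hwd : w * d ≠ 0 := mul_ne_zero hw hd
  have hwd2 : w * d * d ≠ 0 := mul_ne_zero hwd hd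
  obtain rfl : s33 = -s22 := (mul_right_inj' (mul_ne_zero hd hd)).1
    (by linear_combination (a2 + a3) / 2 - w ^ 2 * a1)
  obtain rfl : s11 = -s00 := by linarith
  obtain rfl : s13 = s02 := (mul_right_inj' hwd).1 (by linear_combination (a3 - a2) / 4)
  obtain rfl : s13 = 0 := (mul_right_inj' hwd2).1
    (by linear_combination -(b2 + b3 - (2 * w ^ 2 + 2 * d ^ 2) * b1) / 4)
  obtain rfl : s22 = 0 := (mul_right_inj' hd).1 (by linear_combination b1 / 2)
  obtain rfl : s00 = 0 := (mul_right_inj' (mul_ne_zero hwd hw)).1 (by linear_combination b2 / 2)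
  obtain rfl : s12 = -s03 := (mul_right_inj' hwd).1 (by linear_combination e / 2)
  obtain rfl : s03 = 0 := (mul_right_inj' hwd2).1
    (by linear_combination (c2 + c3 - (2 * w ^ 2 + 2 * d ^ 2) * c1) / 4)
  obtain rfl : s23 = 0 := (mul_right_inj' hd).1 (by linear_combination c1 / 2)
  obtain rfl : s01 = 0 := (mul_right_inj' (mul_ne_zero hwd hw)).1 (by linear_combination -c2 / 2)
  simp [Matrix.trace, Fin.sum_univ_four] at q1
  have hw2 : 0 < w ^ 2 := by positivity
  nlinarith [sq_nonneg d]

end ThirdMatrix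
end GNY

/-! ### Three or more Yukawa matrices -/

namespace GNY
open Matrix
open scoped Kronecker

section ManyMatrices

variable {κ : Type} [Fintype κ] [DecidableEq κ]

theorem exists_equivalent_of_comp {M M' : ℕ} {ι : Type} [Fintype ι] [DecidableEq ι]
    {R : Fin M → Matrix ι ι ℝ} {e : Fin M' → Fin M} {S : Fin M' → Matrix ι ι ℝ}
    (h : Equivalent (R ∘ e) S) : ∃ R', Equivalent R R' ∧ ∀ m, R' (e m) = S m := by
  obtain ⟨A, hA, hA', hR⟩ := h
  refine ⟨_, Equivalent.of_conj hA' hA, fun m => ?_⟩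
  have h1 : R (e m) = A * S m * Aᵀ := hR m
  change Aᵀ * R (e m) * A = S m
  calc Aᵀ * R (e m) * A = (Aᵀ * A) * S m * (Aᵀ * A) := by rw [h1]; simp only [Matrix.mul_assoc]
    _ = S m := by rw [hA, Matrix.one_mul, Matrix.mul_one]

variable [Nonempty κ]

/-- Normal forms of at least three Yukawa matrices: all of them but two agree up to sign. -/
theorem Rotatable.triple_classification {n : ℕ} {R : Fin (n + 3) → Matrix (Fin 4) (Fin 4) ℝ}
    (h : Rotatable κ R) (hR : ∀ m, (R m).IsSymm) (h0 : R ≠ 0) :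
    ∃ R', Equivalent R R' ∧
      ((∃ a, 0 < a ∧ R' 0 = pauliPair a a 0 ∧ R' 1 = pauliPair a a 1 ∧
        ∀ k, k ≠ 0 → k ≠ 1 → R' k = a • pauliThird ∨ R' k = -(a • pauliThird)) ∨
      (∃ p, R' 0 = vectorPair p 0 0 ∧ R' 1 = vectorPair p 0 1 ∧
        ∀ k, k ≠ 0 → k ≠ 1 → R' k = p • vectorThird ∨ R' k = -(p • vectorThird))) := by
  have h01 : (0 : Fin (n + 3)) ≠ 1 := by simp
  have hl : Fin.last (n + 2) ≠ 0 ∧ Fin.last (n + 2) ≠ 1 := by simp [Fin.ext_iff]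
  have hinj : Function.Injective ![(0 : Fin (n + 3)), 1] := by
    intro a b
    fin_cases a <;> fin_cases b <;> simp [h01, h01.symm]
  -- All the matrices have the same squared norm, so none of them vanishes alone.
  have hpair : R ∘ ![0, 1] ≠ 0 := by
    intro hz
    have hz0 : R 0 = 0 := congrFun hz 0
    refine h0 (funext fun m => ?_)
    by_cases hm : m = 0
    · rw [hm, hz0]; rfl
    · exact eq_zero_of_isSymm_of_trace_mul_self (hR m) (by
        rw [h.trace_sq hm, hz0, Matrix.mul_zero, trace_zero])
  have hc : ∀ R' : Fin (n + 3) → Matrix (Fin 4) (Fin 4) ℝ, Equivalent R R' →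
      ∀ k, k ≠ 0 → k ≠ 1 → Rotatable κ ![R' 0, R' 1, R' k] ∧ ∀ m, (![R' 0, R' 1, R' k] m).IsSymm := by
    intro R' he k hk0 hk1
    have h1 := (Rotatable.of_equivalent he h).comp (e := ![0, 1, k]) (by
      intro a b
      fin_cases a <;> fin_cases b <;> simp [h01, h01.symm, hk0, hk1, hk0.symm, hk1.symm])
    have h2 : R' ∘ ![0, 1, k] = ![R' 0, R' 1, R' k] := by
      funext m
      fin_cases m <;> rfl
    rw [h2] at h1
    refine ⟨h1, fun m => ?_⟩
    have := he.isSymm hR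
    fin_cases m <;> apply this
  rcases (h.comp hinj).pair_classification (fun m => hR _) hpair with
    ⟨a, b, ha, hb, he⟩ | ⟨p, q, hpq, he⟩ | ⟨w, d, hw, hd, he⟩ <;>
    obtain ⟨R', he', hR'⟩ := exists_equivalent_of_comp he <;>
    refine ⟨R', he', ?_⟩ <;>
    have hR0 := hR' 0 <;> have hR1 := hR' 1 <;>
    simp only [cons_val_zero, cons_val_one] at hR0 hR1
  · left
    have h3 : ∀ k : Fin (n + 3), k ≠ 0 → k ≠ 1 → _ := fun k hk0 hk1 =>
      (hc R' he' k hk0 hk1).1.third_of_pauliPair (hc R' he' k hk0 hk1).2 ha hb hR0 hR1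
    obtain ⟨rfl, -⟩ := h3 _ hl.1 hl.2
    exact ⟨a, ha, hR0, hR1, fun k hk0 hk1 => (h3 k hk0 hk1).2⟩
  · right
    have h3 : ∀ k : Fin (n + 3), k ≠ 0 → k ≠ 1 → _ := fun k hk0 hk1 =>
      (hc R' he' k hk0 hk1).1.third_of_vectorPair (hc R' he' k hk0 hk1).2 hpq hR0 hR1
    obtain ⟨rfl, -⟩ := h3 _ hl.1 hl.2
    exact ⟨p, hR0, hR1, fun k hk0 hk1 => (h3 k hk0 hk1).2⟩
  · exact ((hc R' he' _ hl.1 hl.2).1.not_cubicPair (hc R' he' _ hl.1 hl.2).2 hw hd hR0 hR1).elim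

/-- There are no four nonzero Yukawa matrices that rotate into each other. -/
theorem Rotatable.eq_zero {n : ℕ} {R : Fin (n + 4) → Matrix (Fin 4) (Fin 4) ℝ}
    (h : Rotatable κ R) (hR : ∀ m, (R m).IsSymm) : R = 0 := by
  by_contra h0
  obtain ⟨R', he, hf⟩ := h.triple_classification (n := n + 1) hR h0
  obtain ⟨k, hk2⟩ : ∃ k : Fin (n + 4), k.val = 2 := ⟨⟨2, by omega⟩, rfl⟩
  have h2 : k ≠ 0 ∧ k ≠ 1 := by simp [Fin.ext_iff, hk2]
  have h3 : Fin.last (n + 3) ≠ 0 ∧ Fin.last (n + 3) ≠ 1 := by simp [Fin.ext_iff]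
  have h23 : k ≠ Fin.last (n + 3) := by
    rw [ne_eq, Fin.ext_iff, hk2, Fin.val_last]
    omega
  have hr := Rotatable.of_equivalent he h
  -- Two distinct Yukawa matrices are trace-orthogonal. If both equal `±X` then `X = 0`, and with
  -- equal norms all of them vanish.
  have hX : ∀ X : Matrix (Fin 4) (Fin 4) ℝ, (R' k = X ∨ R' k = -X) →
      (R' (Fin.last _) = X ∨ R' (Fin.last _) = -X) → R' = 0 := by
    intro X e2 e3
    have e4 := hr.trace_mul h23
    have hz : R' k = 0 := by
      refine eq_zero_of_isSymm_of_trace_mul_self (he.isSymm hR k) ?_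
      rcases e2 with e2 | e2 <;> rcases e3 with e3 | e3 <;> rw [e2, e3] at e4 <;> rw [e2] <;>
        simpa using e4
    funext m
    by_cases hm : m = k
    · rw [hm, hz]; rfl
    · exact eq_zero_of_isSymm_of_trace_mul_self (he.isSymm hR m) (by
        rw [hr.trace_sq hm, hz, Matrix.mul_zero, trace_zero])
  refine he.ne_zero h0 ?_
  rcases hf with ⟨a, -, -, -, hf⟩ | ⟨p, -, -, hf⟩
  · exact hX _ (hf _ h2.1 h2.2) (hf _ h3.1 h3.2)
  · exact hX _ (hf _ h2.1 h2.2) (hf _ h3.1 h3.2)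

end ManyMatrices
end GNY

/-! ### Normal forms of triples and the vector representation of `O(3)` -/

namespace GNY
open Matrix
open scoped Kronecker

section TripleForms

/-- Three Yukawa matrices of Pauli type. -/
def pauliTriple (a : ℝ) : Fin 3 → Matrix (Fin 4) (Fin 4) ℝ :=
  ![pauliPair a a 0, pauliPair a a 1, a • pauliThird]

/-- Three Yukawa matrices that transform as a vector. -/
def vectorTriple : Fin 3 → Matrix (Fin 4) (Fin 4) ℝ :=
  ![!![0, 1, 0, 0; 1, 0, 0, 0; 0, 0, 0, 0; 0, 0, 0, 0],
    !![0, 0, 1, 0; 0, 0, 0, 0; 1, 0, 0, 0; 0, 0, 0, 0],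
    !![0, 0, 0, 1; 0, 0, 0, 0; 0, 0, 0, 0; 1, 0, 0, 0]]

variable {κ : Type} [Fintype κ] [DecidableEq κ] [Nonempty κ]

/-- The sign of the third matrix is absorbed by reflecting basis vectors. In the vector case the
basis is also permuted so that the invariant vector comes first. -/
theorem Rotatable.fin_three {R : Fin 3 → Matrix (Fin 4) (Fin 4) ℝ} (h : Rotatable κ R)
    (hR : ∀ m, (R m).IsSymm) (h0 : R ≠ 0) :
    (∃ a, 0 < a ∧ Equivalent R (pauliTriple a)) ∨
      ∃ p : ℝ, Equivalent R fun m => p • vectorTriple m := by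
  obtain ⟨R', he, hf⟩ := h.triple_classification (n := 0) hR h0
  have hR' : R' = ![R' 0, R' 1, R' 2] := by
    funext m
    fin_cases m <;> rfl
  rcases hf with ⟨a, ha, e0, e1, hk⟩ | ⟨p, e0, e1, hk⟩
  · refine Or.inl ⟨a, ha, ?_⟩
    rcases hk 2 (by decide) (by decide) with e2 | e2 <;> rw [e0, e1, e2] at hR'
    · rwa [hR'] at he
    · rw [hR'] at he
      refine he.trans ⟨!![1, 0, 0, 0; 0, 1, 0, 0; 0, 0, -1, 0; 0, 0, 0, -1], ?_, ?_, fun m => ?_⟩ <;>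
        rw [transpose_fin_four]
      · simp [one_fin_four]
      · simp [one_fin_four]
      · fin_cases m <;> simp [pauliTriple, pauliPair, pauliThird]
  · refine Or.inr ⟨p, ?_⟩
    rcases hk 2 (by decide) (by decide) with e2 | e2 <;> rw [e0, e1, e2] at hR' <;> rw [hR'] at he
    · refine he.trans ⟨!![0, 1, 0, 0; 0, 0, 1, 0; 1, 0, 0, 0; 0, 0, 0, 1], ?_, ?_, fun m => ?_⟩ <;>
        rw [transpose_fin_four]
      · simp [one_fin_four]
      · simp [one_fin_four]
      · fin_cases m <;> simp [vectorTriple, vectorPair, vectorThird]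
    · refine he.trans ⟨!![0, 1, 0, 0; 0, 0, 1, 0; 1, 0, 0, 0; 0, 0, 0, -1], ?_, ?_, fun m => ?_⟩ <;>
        rw [transpose_fin_four]
      · simp [one_fin_four]
      · simp [one_fin_four]
      · fin_cases m <;> simp [vectorTriple, vectorPair, vectorThird]

theorem pauliTriple_eq_smul (a : ℝ) : pauliTriple a = fun m => a • pauliTriple 1 m := by
  funext m
  fin_cases m <;> simp [pauliTriple, pauliPair, pauliThird]

theorem HasLift.smul {M : ℕ} {ι L : Type} [Fintype ι] [DecidableEq ι] [Group L] [TopologicalSpace L]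
    {p : L →* O (Fin M)} {R : Fin M → Matrix ι ι ℝ} {ε : ℝ} (h : HasLift p R ε) (c : ℝ) :
    HasLift p (fun m => c • R m) ε := by
  obtain ⟨s, hs, hsi, hsk⟩ := h
  refine ⟨s, hs, fun l φ => ?_, hsk⟩
  have hc : ∀ φ, comb (fun m => c • R m) φ = c • comb R φ := fun φ => by
    simp only [comb, Finset.smul_sum, smul_comm c]
  rw [hc, hc, Matrix.mul_smul, Matrix.smul_mul, hsi]

theorem O.fin_three_orth (Ω : O (Fin 3)) (i j : Fin 3) :
    Ω.1 0 i * Ω.1 0 j + Ω.1 1 i * Ω.1 1 j + Ω.1 2 i * Ω.1 2 j = (1 : Matrix (Fin 3) (Fin 3) ℝ) i j := by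
  rw [← Ω.transpose_mul_self, Matrix.mul_apply, Fin.sum_univ_three]
  rfl

/-- The action of a matrix on the imaginary quaternions. -/
def imaginaryBlock (P : Matrix (Fin 3) (Fin 3) ℝ) : Matrix (Fin 4) (Fin 4) ℝ :=
  !![1, 0, 0, 0; 0, P 0 0, P 0 1, P 0 2; 0, P 1 0, P 1 1, P 1 2; 0, P 2 0, P 2 1, P 2 2]

theorem imaginaryBlock_mul (P P' : Matrix (Fin 3) (Fin 3) ℝ) :
    imaginaryBlock (P * P') = imaginaryBlock P * imaginaryBlock P' := by
  simp only [imaginaryBlock, Matrix.mul_apply, Fin.sum_univ_three]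
  simp [add_assoc]

theorem imaginaryBlock_one : imaginaryBlock 1 = 1 := by
  simp [imaginaryBlock, one_fin_four]

theorem imaginaryBlock_transpose (P : Matrix (Fin 3) (Fin 3) ℝ) :
    (imaginaryBlock P)ᵀ = imaginaryBlock Pᵀ := by
  simp [imaginaryBlock, transpose_fin_four]

theorem continuous_imaginaryBlock : Continuous imaginaryBlock := by
  have h : ∀ i j, Continuous fun P : Matrix (Fin 3) (Fin 3) ℝ => P i j := fun i j =>
    continuous_id.matrix_elem i j
  refine continuous_matrix fun i j => ?_
  fin_cases i <;> fin_cases j <;> first | exact continuous_const | exact h _ _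

/-- The matrices couple one invariant fermion to three that form a vector, so `Ω` acts on the
fermions as `1 ⊕ Ω`. -/
theorem hasLift_vectorTriple : HasLift (MonoidHom.id (O (Fin 3))) vectorTriple 1 := by
  refine ⟨O.hom (fun Ω => imaginaryBlock Ω.1) imaginaryBlock_one
    (fun a b => imaginaryBlock_mul a.1 b.1) (fun Ω => ?_),
    O.continuous_hom (continuous_imaginaryBlock.comp continuous_subtype_val),
    fun Ω => intertwines_of_mul (O.transpose_mul_self _) fun n => ?_, fun g hg hg1 => (hg1 hg).elim⟩
  · rw [imaginaryBlock_transpose, ← imaginaryBlock_mul, Ω.transpose_mul_self, imaginaryBlock_one]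
  · rw [Fin.sum_univ_three, O.hom_coe, imaginaryBlock]
    have h00 := Ω.fin_three_orth 0 0
    have h11 := Ω.fin_three_orth 1 1
    have h22 := Ω.fin_three_orth 2 2
    have h01 := Ω.fin_three_orth 0 1
    have h02 := Ω.fin_three_orth 0 2
    have h12 := Ω.fin_three_orth 1 2
    simp at h00 h11 h22 h01 h02 h12
    change _ = (Ω.1 0 n • _ + Ω.1 1 n • _ + Ω.1 2 n • _) * _
    fin_cases n <;> simp [vectorTriple] <;> refine ⟨?_, ?_, ?_⟩ <;> linarith

end TripleForms

/-! ### Pauli triples with two flavors, via quaternions -/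

section EvenTriple

/-- Left multiplication by the imaginary units of the quaternions. -/
def quaternionLeft : Fin 3 → Matrix (Fin 4) (Fin 4) ℝ :=
  ![!![0, -1, 0, 0; 1, 0, 0, 0; 0, 0, 0, -1; 0, 0, 1, 0],
    !![0, 0, -1, 0; 0, 0, 0, 1; 1, 0, 0, 0; 0, -1, 0, 0],
    !![0, 0, 0, -1; 0, 0, -1, 0; 0, 1, 0, 0; 1, 0, 0, 0]]

/-- The block matrix with the given blocks. -/
def ofBlocks (W : Fin 2 → Fin 2 → Matrix (Fin 4) (Fin 4) ℝ) :
    Matrix (Fin 2 × Fin 4) (Fin 2 × Fin 4) ℝ := fun x y => W x.1 y.1 x.2 y.2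

theorem ofBlocks_mul (W V : Fin 2 → Fin 2 → Matrix (Fin 4) (Fin 4) ℝ) :
    ofBlocks W * ofBlocks V = ofBlocks fun a b => W a 0 * V 0 b + W a 1 * V 1 b := by
  ext ⟨a, i⟩ ⟨b, j⟩
  simp [ofBlocks, Matrix.mul_apply, Fintype.sum_prod_type]

theorem ofBlocks_transpose (W : Fin 2 → Fin 2 → Matrix (Fin 4) (Fin 4) ℝ) :
    (ofBlocks W)ᵀ = ofBlocks fun a b => (W b a)ᵀ := rfl

theorem kronecker_eq_ofBlocks (A : Matrix (Fin 2) (Fin 2) ℝ) (B : Matrix (Fin 4) (Fin 4) ℝ) :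
    A ⊗ₖ B = ofBlocks fun a b => A a b • B := rfl

/-- The blocks of twice the change of basis between two flavors of Pauli type and complexified
quaternions. -/
def quaternionBlocks : Fin 2 → Fin 2 → Matrix (Fin 4) (Fin 4) ℝ :=
  ![![!![1, 1, 0, 0; 0, 0, 1, 1; 1, -1, 0, 0; 0, 0, -1, 1],
      !![1, -1, 0, 0; 0, 0, -1, 1; -1, -1, 0, 0; 0, 0, -1, -1]],
    ![!![0, 0, 1, 1; -1, -1, 0, 0; 0, 0, 1, -1; 1, -1, 0, 0],
      !![0, 0, 1, -1; 1, -1, 0, 0; 0, 0, -1, -1; 1, 1, 0, 0]]]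

theorem quaternionBlocks_transpose_mul (b c : Fin 2) :
    (quaternionBlocks 0 b)ᵀ * quaternionBlocks 0 c + (quaternionBlocks 1 b)ᵀ * quaternionBlocks 1 c =
      (4 * (1 : Matrix (Fin 2) (Fin 2) ℝ) b c) • 1 := by
  fin_cases b <;> fin_cases c <;> simp [quaternionBlocks, transpose_fin_four, one_fin_four]
  · norm_num
  · simp [← Matrix.ext_iff, Fin.forall_fin_succ]
  · simp [← Matrix.ext_iff, Fin.forall_fin_succ]
  · norm_num

theorem pauliTriple_mul_quaternionBlocks (m : Fin 3) (a : Fin 2) :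
    pauliTriple 1 m * quaternionBlocks a 0 = -(quaternionBlocks a 1 * quaternionLeft m) ∧
      pauliTriple 1 m * quaternionBlocks a 1 = quaternionBlocks a 0 * quaternionLeft m := by
  fin_cases m <;> fin_cases a <;>
    simp [pauliTriple, pauliPair, pauliThird, quaternionBlocks, quaternionLeft]

/-- Two flavors of Pauli type are the complexified quaternions. -/
theorem equivalent_flavors_pauliTriple : Equivalent (flavors (Fin 2) (pauliTriple 1))
    (fun m => (!![0, 1; -1, 0] : Matrix (Fin 2) (Fin 2) ℝ) ⊗ₖ quaternionLeft m) := by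
  have h1 : (ofBlocks quaternionBlocks)ᵀ * ofBlocks quaternionBlocks = (4 : ℝ) • 1 := by
    rw [ofBlocks_transpose, ofBlocks_mul]
    simp only [quaternionBlocks_transpose_mul]
    rw [← one_kronecker_one, ← smul_kronecker]
    rfl
  have h2 : ((1 / 2 : ℝ) • ofBlocks quaternionBlocks)ᵀ * ((1 / 2 : ℝ) • ofBlocks quaternionBlocks) = 1 := by
    rw [transpose_smul, Matrix.smul_mul, Matrix.mul_smul, h1, smul_smul, smul_smul]
    norm_num
  refine ⟨(1 / 2 : ℝ) • ofBlocks quaternionBlocks, h2, mul_eq_one_comm.1 h2, fun m => ?_⟩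
  have h3 : flavors (Fin 2) (pauliTriple 1) m * ofBlocks quaternionBlocks =
      ofBlocks quaternionBlocks * ((!![0, 1; -1, 0] : Matrix (Fin 2) (Fin 2) ℝ) ⊗ₖ quaternionLeft m) := by
    rw [flavors, kronecker_eq_ofBlocks, kronecker_eq_ofBlocks, ofBlocks_mul, ofBlocks_mul]
    congr 1
    funext a b
    obtain ⟨h0, h1⟩ := pauliTriple_mul_quaternionBlocks m a
    have h3 : (1 : Matrix (Fin 2) (Fin 2) ℝ) a 0 • pauliTriple 1 m * quaternionBlocks 0 b +
        (1 : Matrix (Fin 2) (Fin 2) ℝ) a 1 • pauliTriple 1 m * quaternionBlocks 1 b =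
          pauliTriple 1 m * quaternionBlocks a b := by
      fin_cases a <;> simp [Matrix.one_apply]
    refine h3.trans ?_
    fin_cases b
    · simpa using h0
    · simpa using h1
  have h4 : flavors (Fin 2) (pauliTriple 1) m * ((1 / 2 : ℝ) • ofBlocks quaternionBlocks) =
      (1 / 2 : ℝ) • ofBlocks quaternionBlocks *
        ((!![0, 1; -1, 0] : Matrix (Fin 2) (Fin 2) ℝ) ⊗ₖ quaternionLeft m) := by
    rw [Matrix.mul_smul, h3, Matrix.smul_mul]
  rw [← h4, Matrix.mul_assoc, mul_eq_one_comm.1 h2, Matrix.mul_one]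

theorem O.fin_three_cofactor {P : O (Fin 3)} (h : P.1.det = 1) : P.1.adjugate = P.1ᵀ := by
  calc P.1.adjugate = P.1.adjugate * (P.1 * P.1ᵀ) := by rw [P.mul_transpose_self, Matrix.mul_one]
    _ = P.1ᵀ := by rw [← Matrix.mul_assoc, adjugate_mul, h, one_smul, Matrix.one_mul]

/-- A rotation preserves the cross product, which is expressed by the equality of cofactors and
entries. So `1 ⊕ P` is an automorphism of the quaternions and carries left multiplications to left
multiplications. -/
theorem imaginaryBlock_mul_quaternionLeft {P : O (Fin 3)} (h : P.1.det = 1) (n : Fin 3) :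
    imaginaryBlock P.1 * quaternionLeft n = (∑ m, P.1 m n • quaternionLeft m) * imaginaryBlock P.1 := by
  have h00 := P.fin_three_orth 0 0
  have h11 := P.fin_three_orth 1 1
  have h22 := P.fin_three_orth 2 2
  have h01 := P.fin_three_orth 0 1
  have h02 := P.fin_three_orth 0 2
  have h12 := P.fin_three_orth 1 2
  have hc := O.fin_three_cofactor h
  rw [adjugate_fin_three] at hc
  simp [← Matrix.ext_iff, Fin.forall_fin_succ] at h00 h11 h22 h01 h02 h12 hc
  obtain ⟨⟨c1, c2, c3⟩, ⟨c4, c5, c6⟩, c7, c8, c9⟩ := hc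
  rw [Fin.sum_univ_three]
  fin_cases n <;> simp [imaginaryBlock, quaternionLeft] <;> constructorm* _ ∧ _ <;> linarith

theorem hasLift_quaternionLeft : HasLift (MonoidHom.id (O (Fin 3)))
    (fun m => (!![0, 1; -1, 0] : Matrix (Fin 2) (Fin 2) ℝ) ⊗ₖ quaternionLeft m) 1 := by
  have hd : ∀ Ω : O (Fin 3), Ω.1.det * Ω.1.det = 1 := fun Ω => by
    have h := congrArg Matrix.det Ω.transpose_mul_self
    rwa [det_mul, det_transpose, det_one] at h
  have hdm : ∀ a b : O (Fin 3), (a * b).1.det = a.1.det * b.1.det := fun a b => det_mul _ _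
  have hP : ∀ Ω : O (Fin 3), (Ω.1.det • Ω.1)ᵀ * (Ω.1.det • Ω.1) = 1 := fun Ω => by
    rw [transpose_smul, Matrix.smul_mul, Matrix.mul_smul, Ω.transpose_mul_self, smul_smul, hd, one_smul]
  have hD : ∀ d e : ℝ, (!![1, 0; 0, d] : Matrix (Fin 2) (Fin 2) ℝ) * !![1, 0; 0, e] =
      !![1, 0; 0, d * e] := fun d e => by simp
  have hD1 : (!![1, 0; 0, 1] : Matrix (Fin 2) (Fin 2) ℝ) = 1 := one_fin_two.symm
  have hDt : ∀ d : ℝ, (!![1, 0; 0, d] : Matrix (Fin 2) (Fin 2) ℝ)ᵀ = !![1, 0; 0, d] := fun d => by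
    ext i j
    fin_cases i <;> fin_cases j <;> rfl
  -- Write `Ω` as its determinant times a rotation. The rotation acts by a quaternion automorphism,
  -- and the remaining sign by `diag(1, det)`, complex conjugation, under which the antisymmetric
  -- factor changes sign.
  refine ⟨O.hom (fun Ω => (!![1, 0; 0, Ω.1.det] : Matrix (Fin 2) (Fin 2) ℝ) ⊗ₖ
      imaginaryBlock (Ω.1.det • Ω.1)) ?_ (fun a b => ?_) (fun Ω => ?_), O.continuous_hom ?_,
    fun Ω => intertwines_of_mul (O.transpose_mul_self _) fun n => ?_, fun g hg hg1 => (hg1 hg).elim⟩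
  · change (!![1, 0; 0, (1 : Matrix (Fin 3) (Fin 3) ℝ).det] : Matrix (Fin 2) (Fin 2) ℝ) ⊗ₖ
      imaginaryBlock ((1 : Matrix (Fin 3) (Fin 3) ℝ).det • 1) = 1
    rw [det_one, one_smul, imaginaryBlock_one, hD1, one_kronecker_one]
  · rw [← mul_kronecker_mul, hD, ← imaginaryBlock_mul, hdm, Matrix.smul_mul, Matrix.mul_smul, smul_smul]
    rfl
  · rw [← kroneckerMap_transpose, ← mul_kronecker_mul, hDt, hD, hd, hD1, imaginaryBlock_transpose,
      ← imaginaryBlock_mul, hP, imaginaryBlock_one, one_kronecker_one]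
  · have h1 : Continuous fun Ω : O (Fin 3) => Ω.1.det := continuous_subtype_val.matrix_det
    have h2 : Continuous fun Ω : O (Fin 3) => imaginaryBlock (Ω.1.det • Ω.1) :=
      continuous_imaginaryBlock.comp (h1.smul continuous_subtype_val)
    refine continuous_matrix fun i j => Continuous.mul ?_ (h2.matrix_elem _ _)
    generalize i.1 = a
    generalize j.1 = b
    fin_cases a <;> fin_cases b <;> first | exact continuous_const | exact h1
  · have h1 := imaginaryBlock_mul_quaternionLeft (P := O.mk _ (hP Ω)) (by
      change (Ω.1.det • Ω.1).det = 1
      rw [det_smul, Fintype.card_fin]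
      linear_combination (Ω.1.det * Ω.1.det + 1) * hd Ω) n
    change imaginaryBlock (Ω.1.det • Ω.1) * quaternionLeft n =
      (∑ m, (Ω.1.det • Ω.1) m n • quaternionLeft m) * imaginaryBlock (Ω.1.det • Ω.1) at h1
    have h2 : ∑ m, (Ω.1.det • Ω.1) m n • quaternionLeft m =
        Ω.1.det • ∑ m, Ω.1 m n • quaternionLeft m := by
      rw [Finset.smul_sum]
      exact Finset.sum_congr rfl fun m _ => by rw [Matrix.smul_apply, smul_assoc]
    have h3 : (!![1, 0; 0, Ω.1.det] : Matrix (Fin 2) (Fin 2) ℝ) * !![0, 1; -1, 0] =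
        Ω.1.det • (!![0, 1; -1, 0] * !![1, 0; 0, Ω.1.det]) := by
      simp [hd]
    have h4 : ∑ m, (MonoidHom.id (O (Fin 3)) Ω).1 m n •
        ((!![0, 1; -1, 0] : Matrix (Fin 2) (Fin 2) ℝ) ⊗ₖ quaternionLeft m) =
          (!![0, 1; -1, 0] : Matrix (Fin 2) (Fin 2) ℝ) ⊗ₖ ∑ m, Ω.1 m n • quaternionLeft m := by
      rw [Fin.sum_univ_three, Fin.sum_univ_three, kronecker_add, kronecker_add, kronecker_smul,
        kronecker_smul, kronecker_smul]
      rfl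
    rw [O.hom_coe, h4, ← mul_kronecker_mul, ← mul_kronecker_mul, h1, h2, h3, Matrix.smul_mul,
      smul_kronecker, kronecker_smul, smul_smul, hd, one_smul]

theorem hasLift_flavors_pauliTriple (a : ℝ) :
    HasLift (MonoidHom.id (O (Fin 3))) (flavors (Fin 2) (pauliTriple a)) 1 := by
  have h : flavors (Fin 2) (pauliTriple a) = fun m => a • flavors (Fin 2) (pauliTriple 1) m := by
    funext m
    rw [flavors, pauliTriple_eq_smul, kronecker_smul]
    rfl
  rw [h]
  exact (HasLift.of_equivalent equivalent_flavors_pauliTriple hasLift_quaternionLeft).smul a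

end EvenTriple
end GNY

/-! ### The double cover of `O(3)` for Pauli triples -/

namespace GNY
open Matrix
open scoped Kronecker

section TripleLift

/-- The reflection in the hyperplane orthogonal to a unit vector. -/
def O.householder {n : ℕ} (u : Fin n → ℝ) (hu : u ⬝ᵥ u = 1) : O (Fin n) :=
  O.mk (1 - (2 : ℝ) • vecMulVec u u) (by
    rw [transpose_sub, transpose_one, transpose_smul, transpose_vecMulVec, sub_mul, one_mul,
      mul_sub, mul_one, Matrix.smul_mul, Matrix.mul_smul, vecMulVec_mul_vecMulVec, hu, one_smul]
    module)

theorem O.householder_mulVec {n : ℕ} (u : Fin n → ℝ) (hu : u ⬝ᵥ u = 1) (φ : Fin n → ℝ) :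
    (O.householder u hu).1 *ᵥ φ = φ - (2 * (u ⬝ᵥ φ)) • u := by
  change (1 - (2 : ℝ) • vecMulVec u u) *ᵥ φ = _
  rw [sub_mulVec, one_mulVec, smul_mulVec, vecMulVec_mulVec, op_smul_eq_smul, smul_smul]

/-- A subgroup of the orthogonal group that contains the reflections is the whole group. -/
theorem O.mem_of_householder_mem {n : ℕ} (P : Subgroup (O (Fin n)))
    (h : ∀ (u : Fin n → ℝ) (hu : u ⬝ᵥ u = 1), O.householder u hu ∈ P) (Ω : O (Fin n)) : Ω ∈ P := by
  have hP : ∀ f : EuclideanSpace ℝ (Fin n) ≃ₗᵢ[ℝ] EuclideanSpace ℝ (Fin n),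
      ∃ Ω ∈ P, ∀ φ, Ω.1 *ᵥ φ = (f (WithLp.toLp 2 φ)).ofLp := by
    intro f
    -- By the Cartan-Dieudonné theorem every isometry is a product of reflections. A reflection
    -- given by the zero vector is the identity and is treated separately.
    have hf : f ∈ Subgroup.closure (Set.range fun v : EuclideanSpace ℝ (Fin n) =>
        (ℝ ∙ v)ᗮ.reflection) := by
      rw [LinearIsometryEquiv.reflections_generate]
      trivial
    induction hf using Subgroup.closure_induction with
    | one => exact ⟨1, one_mem _, fun φ => by simp⟩
    | mul x y _ _ hx hy =>
      obtain ⟨X, hX, hx⟩ := hx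
      obtain ⟨Y, hY, hy⟩ := hy
      refine ⟨X * Y, mul_mem hX hY, fun φ => ?_⟩
      change (X.1 * Y.1) *ᵥ φ = _
      rw [← mulVec_mulVec, hy, hx]
      rfl
    | inv x _ hx =>
      obtain ⟨X, hX, hx⟩ := hx
      refine ⟨X⁻¹, inv_mem hX, fun φ => ?_⟩
      have h1 := hx (x⁻¹ (WithLp.toLp 2 φ)).ofLp
      have h2 : x (x⁻¹ (WithLp.toLp 2 φ)) = WithLp.toLp 2 φ := x.apply_symm_apply _
      rw [WithLp.toLp_ofLp, h2] at h1
      have h3 : X⁻¹.1 * X.1 = 1 := congrArg Subtype.val (inv_mul_cancel X)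
      change X.1 *ᵥ _ = φ at h1
      conv_lhs => rw [← h1]
      rw [mulVec_mulVec, h3, one_mulVec]
    | mem x hx =>
      obtain ⟨v, rfl⟩ := hx
      rcases eq_or_ne v 0 with rfl | hv
      · refine ⟨1, one_mem _, fun φ => ?_⟩
        rw [Submodule.reflection_orthogonal_apply, Submodule.reflection_singleton_apply]
        simp
      · have hv' : ‖v‖ ≠ 0 := norm_ne_zero_iff.2 hv
        have hi : ∀ φ : Fin n → ℝ, inner ℝ v (WithLp.toLp 2 φ) = v.ofLp ⬝ᵥ φ := fun φ => by
          rw [EuclideanSpace.inner_eq_star_dotProduct, star_trivial, dotProduct_comm]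
        have hu : (‖v‖⁻¹ • v.ofLp) ⬝ᵥ (‖v‖⁻¹ • v.ofLp) = 1 := by
          rw [dotProduct_smul, smul_dotProduct, ← hi, WithLp.toLp_ofLp, real_inner_self_eq_norm_sq,
            smul_eq_mul, smul_eq_mul]
          field_simp
        refine ⟨_, h _ hu, fun φ => ?_⟩
        rw [O.householder_mulVec, Submodule.reflection_orthogonal_apply,
          Submodule.reflection_singleton_apply, hi, smul_dotProduct, smul_smul, two_smul, two_mul]
        ext i
        simp only [Pi.sub_apply, Pi.smul_apply, smul_eq_mul, WithLp.ofLp_neg, WithLp.ofLp_sub,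
          WithLp.ofLp_smul, Pi.neg_apply, WithLp.ofLp_add, Pi.add_apply]
        rw [RCLike.ofReal_real_eq_id, id]
        field_simp
        ring
  have hΩ : Matrix.toEuclideanCLM (n := Fin n) (𝕜 := ℝ) Ω.1 ∈
      unitary (EuclideanSpace ℝ (Fin n) →L[ℝ] EuclideanSpace ℝ (Fin n)) :=
    Unitary.map_mem (Matrix.toEuclideanCLM (n := Fin n) (𝕜 := ℝ)) Ω.2
  obtain ⟨Ω', hm, he⟩ := hP (Unitary.linearIsometryEquiv ⟨_, hΩ⟩)
  have : Ω' = Ω := by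
    refine Subtype.ext (Matrix.ext_of_mulVec_single fun i => ?_)
    rw [he]
    exact Matrix.ofLp_toEuclideanCLM (𝕜 := ℝ) Ω.1 _
  exact this ▸ hm

theorem comb_pauliTriple_one (φ : Fin 3 → ℝ) :
    comb (pauliTriple 1) φ = !![φ 0, φ 1, 0, φ 2; φ 1, -φ 0, -φ 2, 0; 0, -φ 2, φ 0, φ 1;
      φ 2, 0, φ 1, -φ 0] := by
  rw [comb, Fin.sum_univ_three]
  simp [pauliTriple, pauliPair, pauliThird]

/-- An antisymmetric matrix that anticommutes with the Yukawa matrices of Pauli type. -/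
def pauliCenter : Matrix (Fin 4) (Fin 4) ℝ :=
  !![0, 1, 0, 0; -1, 0, 0, 0; 0, 0, 0, -1; 0, 0, 1, 0]

/-- The pairs of rotations that intertwine the Yukawa matrices of Pauli type and commute with
`pauliCenter`. -/
def pinThree : Subgroup (O (Fin 4) × O (Fin 3)) where
  carrier := {g | Intertwines (pauliTriple 1) g.1.1 g.2.1 ∧ g.1.1 * pauliCenter * g.1.1ᵀ = pauliCenter}
  one_mem' := ⟨fun φ => by simp, by simp⟩
  mul_mem' := by
    rintro g g' ⟨hg, hk⟩ ⟨hg', hk'⟩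
    refine ⟨fun φ => ?_, ?_⟩
    · change (g.1.1 * g'.1.1) * _ * (g.1.1 * g'.1.1)ᵀ = comb _ ((g.2.1 * g'.2.1) *ᵥ φ)
      rw [← mulVec_mulVec, ← hg, ← hg', transpose_mul]
      simp only [mul_assoc]
    · change (g.1.1 * g'.1.1) * _ * (g.1.1 * g'.1.1)ᵀ = _
      nth_rw 2 [← hk]
      nth_rw 2 [← hk']
      rw [transpose_mul]
      simp only [mul_assoc]
  inv_mem' := by
    rintro g ⟨hg, hk⟩
    have h1 := g.1.transpose_mul_self
    refine ⟨fun φ => ?_, ?_⟩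
    · change g.1.1ᵀ * _ * g.1.1ᵀᵀ = comb _ (g.2.1ᵀ *ᵥ φ)
      have h2 : φ = g.2.1 *ᵥ (g.2.1ᵀ *ᵥ φ) := by rw [mulVec_mulVec, g.2.mul_transpose_self, one_mulVec]
      conv_lhs => rw [h2, ← hg]
      rw [transpose_transpose]
      calc _ = (g.1.1ᵀ * g.1.1) * comb (pauliTriple 1) (g.2.1ᵀ *ᵥ φ) * (g.1.1ᵀ * g.1.1) := by
            simp only [mul_assoc]
        _ = _ := by rw [h1, one_mul, mul_one]
    · change g.1.1ᵀ * _ * g.1.1ᵀᵀ = _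
      rw [transpose_transpose]
      nth_rw 1 [← hk]
      calc _ = (g.1.1ᵀ * g.1.1) * pauliCenter * (g.1.1ᵀ * g.1.1) := by simp only [mul_assoc]
        _ = _ := by rw [h1, one_mul, mul_one]

theorem isClosed_pinThree : IsClosed (pinThree : Set (O (Fin 4) × O (Fin 3))) := by
  have h : (pinThree : Set (O (Fin 4) × O (Fin 3))) =
      (⋂ φ : Fin 3 → ℝ, {g | g.1.1 * comb (pauliTriple 1) φ * g.1.1ᵀ =
        comb (pauliTriple 1) (g.2.1 *ᵥ φ)}) ∩
      {g | g.1.1 * pauliCenter * g.1.1ᵀ = pauliCenter} := by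
    ext g
    simp only [pinThree, Intertwines, Set.mem_inter_iff, Set.mem_iInter, Set.mem_ofPred_eq,
      SetLike.mem_coe, Subgroup.mem_mk, Submonoid.mem_mk, Subsemigroup.mem_mk]
  rw [h]
  refine (isClosed_iInter fun φ => isClosed_eq (by fun_prop) ?_).inter
    (isClosed_eq (by fun_prop) (by fun_prop))
  unfold comb
  fun_prop

instance : CompactSpace pinThree :=
  isCompact_iff_compactSpace.1 isClosed_pinThree.isCompact

/-- The action of the covering group on the scalars. -/
def pinProj : pinThree →* O (Fin 3) := (MonoidHom.snd _ _).comp pinThree.subtype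

theorem continuous_pinProj : Continuous pinProj := continuous_snd.comp continuous_subtype_val

/-- The lift of a reflection to the fermions. -/
def reflectionLift (u : Fin 3 → ℝ) : Matrix (Fin 4) (Fin 4) ℝ :=
  comb (pauliTriple 1) u * !![0, 0, 0, 1; 0, 0, -1, 0; 0, 1, 0, 0; -1, 0, 0, 0]

theorem surjective_pinProj : Function.Surjective pinProj := by
  rw [← MonoidHom.range_eq_top, eq_top_iff]
  intro Ω _
  refine O.mem_of_householder_mem _ (fun u hu => ?_) Ω
  have hu' : u 0 * u 0 + u 1 * u 1 + u 2 * u 2 = 1 := by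
    rwa [dotProduct, Fin.sum_univ_three] at hu
  have hT : reflectionLift u = !![-u 2, 0, -u 1, u 0; 0, -u 2, u 0, u 1; -u 1, u 0, u 2, 0;
      u 0, u 1, 0, u 2] := by
    rw [reflectionLift, comb_pauliTriple_one]
    simp
  -- Conjugation by `R(u)` alone yields minus the reflection. The constant factor in
  -- `reflectionLift` anticommutes with all three Yukawa matrices and corrects this sign. It also
  -- anticommutes with `pauliCenter`, as `R(u)` does, so the product commutes with it.
  refine ⟨⟨(O.mk (reflectionLift u) ?_, O.householder u hu), fun φ => ?_, ?_⟩, rfl⟩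
  · rw [hT, transpose_fin_four, one_fin_four]
    simp
    grind
  · rw [O.householder_mulVec]
    change reflectionLift u * _ * (reflectionLift u)ᵀ = _
    rw [hT, transpose_fin_four, comb_pauliTriple_one, comb_pauliTriple_one, dotProduct, Fin.sum_univ_three]
    simp
    grind
  · change reflectionLift u * _ * (reflectionLift u)ᵀ = _
    rw [hT, transpose_fin_four, pauliCenter]
    simp
    grind

end TripleLift
end GNY

/-! ### The dichotomy for three scalars -/

namespace GNY
open Matrix
open scoped Kronecker

section TripleSymmetry

theorem pauliTriple_commutant {a : ℝ} (ha : a ≠ 0) {X : Matrix (Fin 4) (Fin 4) ℝ}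
    (h : ∀ m, X * pauliTriple a m = pauliTriple a m * X) :
    X = !![X 0 0, 0, X 0 2, 0; 0, X 0 0, 0, X 0 2; -X 0 2, 0, X 0 0, 0; 0, -X 0 2, 0, X 0 0] := by
  have h' : ∀ m, X * pauliTriple 1 m = pauliTriple 1 m * X := fun m => by
    have := h m
    rw [pauliTriple_eq_smul] at this
    simp only [Matrix.mul_smul, Matrix.smul_mul] at this
    exact smul_right_injective _ ha this
  have h0 := h' 0
  have h1 := h' 1
  have h2 := h' 2
  simp [← Matrix.ext_iff, Fin.forall_fin_succ, Matrix.mul_apply, Fin.sum_univ_four, pauliTriple,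
    pauliPair, pauliThird, Matrix.vecMul, dotProduct] at h0 h1 h2
  simp only [← Matrix.ext_iff, Fin.forall_fin_succ]
  simp
  grind

theorem Intertwines.commute {M : ℕ} {ι : Type} [Fintype ι] [DecidableEq ι] {R : Fin M → Matrix ι ι ℝ}
    {Q : O ι} (h : Intertwines R Q.1 1) (m : Fin M) : Q.1 * R m = R m * Q.1 := by
  have h1 := h (Pi.single m 1)
  have h2 : comb R (Pi.single m 1) = R m := by simp [comb, Pi.single_apply, ite_smul]
  rw [one_mulVec, h2] at h1
  nth_rw 2 [← h1]
  rw [mul_assoc, Q.transpose_mul_self, mul_one]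

/-- The orthogonal part of the commutant of a Pauli triple is a circle. Commuting with
`pauliCenter`, which anticommutes with the generator of this circle, cuts it down to `±1`; this
makes `pinProj` a double cover. -/
theorem pinThree_eq_one_or {Q : O (Fin 4)} {Ω : O (Fin 3)} (h : (Q, Ω) ∈ pinThree) (hΩ : Ω = 1) :
    Q.1 = 1 ∨ Q.1 = -1 := by
  obtain ⟨hi, hk⟩ := h
  subst hΩ
  have hX := pauliTriple_commutant one_ne_zero (X := Q.1) (Intertwines.commute hi)
  have hk' : Q.1 * pauliCenter = pauliCenter * Q.1 := by
    nth_rw 2 [← hk]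
    rw [mul_assoc, Q.transpose_mul_self, mul_one]
  have hQ := Q.transpose_mul_self
  generalize Q.1 0 0 = x at hX
  generalize Q.1 0 2 = y at hX
  rw [hX] at hk' hQ ⊢
  have hy : y = 0 := by
    have := congrFun (congrFun hk' 0) 3
    simp [pauliCenter, Matrix.mul_apply, Fin.sum_univ_four] at this
    linarith
  have hx := congrFun (congrFun hQ 0) 0
  simp [Matrix.mul_apply, Fin.sum_univ_four, hy] at hx
  rw [hy, one_fin_four]
  rcases mul_self_eq_one_iff.1 hx with rfl | rfl
  · left; simp
  · right; simp

theorem hasLift_pinProj : HasLift pinProj (pauliTriple 1) (-1) := by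
  refine ⟨(MonoidHom.fst _ _).comp pinThree.subtype, continuous_fst.comp continuous_subtype_val,
    fun l => l.2.1, ?_⟩
  rintro ⟨⟨Q, Ω⟩, hl⟩ h1 hne
  rcases pinThree_eq_one_or hl h1 with h | h
  · exact (hne (Subtype.ext (Prod.ext (Subtype.ext h) h1))).elim
  · rw [neg_one_smul]
    exact h

theorem card_ker_pinProj : Nat.card pinProj.ker = 2 := by
  let n : pinThree := ⟨(O.mk (-1) (by simp), 1), fun φ => by
    change (-1) * _ * (-1 : Matrix (Fin 4) (Fin 4) ℝ)ᵀ = comb _ ((1 : Matrix (Fin 3) (Fin 3) ℝ) *ᵥ φ)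
    simp, by
    change (-1) * _ * (-1 : Matrix (Fin 4) (Fin 4) ℝ)ᵀ = _
    simp⟩
  have hn1 : n ≠ 1 := by
    intro h
    have := congrFun (congrFun (congrArg (fun l : pinThree => l.1.1.1) h) 0) 0
    change (-1 : Matrix (Fin 4) (Fin 4) ℝ) 0 0 = (1 : Matrix (Fin 4) (Fin 4) ℝ) 0 0 at this
    norm_num at this
  rw [Nat.card_eq_two_iff]
  refine ⟨⟨1, one_mem _⟩, ⟨n, rfl⟩, fun h => hn1 (congrArg Subtype.val h).symm, ?_⟩
  refine Set.eq_univ_of_forall fun ⟨⟨⟨Q, Ω⟩, hl⟩, hg⟩ => ?_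
  have hg : Ω = 1 := hg
  subst hg
  rcases pinThree_eq_one_or hl rfl with h | h
  · obtain rfl : Q = 1 := Subtype.ext h
    exact Or.inl rfl
  · obtain rfl : Q = O.mk (-1) (by simp) := Subtype.ext h
    exact Or.inr rfl

variable {N : ℕ} {R : Yukawa 3}

/-- The commutant is a copy of the complex numbers, hence commutative. -/
theorem exists_multiplicity_one_of_pauliTriple {a : ℝ} (ha : 0 < a)
    (h : Equivalent R (pauliTriple a)) : ∃ c : SimpleType R, multiplicity c = 1 := by
  refine exists_multiplicity_one_of_equivalent h 0 (fun hz => ?_) fun X Y hX hY => ?_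
  · have := congrFun (congrFun hz 0) 0
    simp [pauliTriple, pauliPair] at this
    exact ha.ne' this
  · have h1 : X * Y = Y * X := by
      rw [pauliTriple_commutant ha.ne' hX, pauliTriple_commutant ha.ne' hY]
      simp
      grind
    rw [h1]

theorem dichotomy_of_fin_three (hN : 1 ≤ N) (hR : IsValid N R) :
    IsSplit N R ∨ ((1 < 3 ∧ ∃ c : SimpleType R, Odd (N * multiplicity c)) ∧
      IsSplitUpToDoubleCover N R) := by
  have : Nonempty (Fin N) := ⟨⟨0, hN⟩⟩
  have h3 : 1 < 3 := by decide
  by_cases h0 : R = 0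
  · subst h0
    exact Or.inl (isSplit_of_hasLift h3 hR.symm hasLift_zero.flavors_of_untwisted)
  rcases hR.rotatable.fin_three hR.symm h0 with ⟨a, ha, h⟩ | ⟨p, h⟩
  · rcases Nat.even_or_odd N with hN | hN
    · exact Or.inl (isSplit_of_hasLift h3 hR.symm
        (hasLift_flavors_of_even hN (HasLift.of_equivalent h.flavors (hasLift_flavors_pauliTriple a))))
    · obtain ⟨c, hc⟩ := exists_multiplicity_one_of_pauliTriple ha h
      have hl := hasLift_pinProj.smul a
      rw [← pauliTriple_eq_smul] at hl
      exact Or.inr ⟨⟨h3, c, by rwa [hc, mul_one]⟩,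
        isSplitUpToDoubleCover_of_hasLift h3 hR.symm continuous_pinProj surjective_pinProj
          card_ker_pinProj (HasLift.of_equivalent h hl).flavors_of_untwisted⟩
  · exact Or.inl (isSplit_of_hasLift h3 hR.symm
      (HasLift.of_equivalent h (hasLift_vectorTriple.smul p)).flavors_of_untwisted)

end TripleSymmetry
end GNY

/-! ### Conclusion, by the number of scalars -/

theorem mainTheorem1 (N M : ℕ) (hN : 1 ≤ N) (hM : 1 ≤ M) (R : GNY.Yukawa M)
    (hR : GNY.IsValid N R) :
    GNY.IsSplit N R ∨
      ((1 < M ∧ ∃ c : GNY.SimpleType R, Odd (N * GNY.multiplicity c)) ∧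
        GNY.IsSplitUpToDoubleCover N R) := by
  have : Nonempty (Fin N) := ⟨⟨0, hN⟩⟩
  match M, hM with
  | 1, _ => exact Or.inl (GNY.isSplit_of_fin_one hN hR.symm)
  | 2, _ => exact GNY.dichotomy_of_fin_two hN hR
  | 3, _ => exact GNY.dichotomy_of_fin_three hN hR
  | n + 4, _ =>
    have h0 : R = 0 := hR.rotatable.eq_zero hR.symm
    subst h0
    exact Or.inl (GNY.isSplit_of_hasLift (by omega) hR.symm
      GNY.hasLift_zero.flavors_of_untwisted)
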